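/- Let $0<\alpha<2$ and consider on $\mathbb R$ the inviscid nonlocal transport equation $$\partial_t\theta+(\Lambda^{-\alpha}\partial_x\theta)\,\partial_x\theta=0,\qquad \theta(0,x)=\theta_0(x),$$ where $\Lambda^{-\alpha}\partial_x$ is the Fourier multiplier with symbol $i|\xi|^{-\alpha}\xi$ (for $\widehat f(\xi)=\int f(x)e^{-ix\xi}\,dx$). For $0<T<\infty$, a solution on $[0,T)$ is a real-valued function $\theta\in C\big([0,T);H^3(\mathbb R)\cap W^{1,1}(\mathbb R)\big)$ which satisfies the equation pointwise at every $(t,x)\in[0,T)\times\mathbb R$ (with the one-sided time derivative at $t=0$) and the initial condition. There exists a constant $A_\alpha>0$, depending only on $\alpha$, such that for every even real-valued Schwartz function $\theta_0$ with $$\int_0^\infty\frac{\theta_0(0)-\theta_0(x)}{x}\,e^{-x}\,dx\ \ge\ A_\alpha\,\big(\|\theta_0\|_\infty+1\big),$$ the corresponding solution blows up in finite time: there is $T_*<\infty$ (which may depend on $\theta_0$) such that every solution on $[0,T)$ with initial datum $\theta_0$ has $T\le T_*$. -/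

import Mathlib

open MeasureTheory Filter Topology Set
open scoped FourierTransform ENNReal SchwartzMap

noncomputable section

namespace AlphaModel

/-- The Fourier transform `ξ ↦ ∫ e^{-2πixξ} f(x) dx` of a real-valued function. -/
def fourier (f : ℝ → ℝ) : ℝ → ℂ :=
  𝓕 (fun x : ℝ => (f x : ℂ))

/-- The drift `Λ^{-α} ∂_x f`. In the angular frequency `2πξ` its symbol is `i |2πξ|^{-α} (2πξ)`.
For real-valued `f` the inverse Fourier integral is real, so taking the real part only changes the
type. For `0 < α < 2` and `f` in the class `MemClass` below the integral converges absolutely. -/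
def drift (α : ℝ) (f : ℝ → ℝ) (x : ℝ) : ℝ :=
  (𝓕⁻ (fun ξ : ℝ =>
    Complex.I * ((|2 * Real.pi * ξ| ^ (-α) * (2 * Real.pi * ξ) : ℝ) : ℂ) * fourier f ξ) x).re

/-- The Sobolev norm `‖(1 - ∂_xx)^{3/2} f‖_{L²}` of an integrable function, on the Fourier side. -/
def sobolevNorm (f : ℝ → ℝ) : ℝ≥0∞ :=
  eLpNorm (fun ξ : ℝ => (((1 + (2 * Real.pi * ξ) ^ 2) ^ (3 / 2 : ℝ) : ℝ) : ℂ) * fourier f ξ) 2 volume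

/-- The norm of `H³ ∩ W^{1,1}`. -/
def classNorm (f : ℝ → ℝ) : ℝ≥0∞ :=
  eLpNorm f 1 volume + eLpNorm (deriv f) 1 volume + sobolevNorm f

/-- The functions in `H³(ℝ) ∩ W^{1,1}(ℝ)` (their continuous representatives, which are
automatically continuously differentiable). Integrability is asked for because, for `3/2 ≤ α < 2`,
the symbol of the drift is not locally square integrable at the origin, so that the drift is not
defined on all of `H³`. -/
structure MemClass (f : ℝ → ℝ) : Prop where
  contDiff : ContDiff ℝ 1 f
  integrable : Integrable f volume
  integrable_deriv : Integrable (deriv f) volume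
  sobolev : sobolevNorm f < ∞

/-- `θ` (a function of time and space) is a solution on `[0, T)`, in `C([0, T); H³ ∩ W^{1,1})`, of
`∂_t θ + (Λ^{-α} ∂_x θ) ∂_x θ = 0` with initial datum `θ₀`. The equation holds at every point, with
the one-sided time derivative at `t = 0`. -/
structure IsSolution (α : ℝ) (θ₀ : ℝ → ℝ) (T : ℝ) (θ : ℝ → ℝ → ℝ) : Prop where
  initial : θ 0 = θ₀
  memClass : ∀ t ∈ Ico 0 T, MemClass (θ t)
  continuous : ∀ t ∈ Ico 0 T,
    Tendsto (fun s => classNorm (fun x => θ s x - θ t x)) (𝓝[Ico 0 T] t) (𝓝 0)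
  equation : ∀ t ∈ Ico 0 T, ∀ x : ℝ,
    HasDerivWithinAt (fun s => θ s x) (-(drift α (θ t) x * deriv (θ t) x)) (Ico 0 T) t

/-- The solution with initial datum `θ₀` blows up in finite time: there is a finite time beyond
which no solution with this datum can be continued. -/
def BlowsUpInFiniteTime (α : ℝ) (θ₀ : ℝ → ℝ) : Prop :=
  ∃ Tstar : ℝ, 0 < Tstar ∧ ∀ (T : ℝ) (θ : ℝ → ℝ → ℝ), IsSolution α θ₀ T θ → T ≤ Tstar

end AlphaModel

end

/-! Write u for the drift and let J be the integral of (θ(0) - θ(x)) e^{-x} / x over the half line.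
Evenness makes u odd, so u(0) = 0, the value θ(t, 0) does not change, and J' is the integral of u
θ_x e^{-x} / x. The core of the proof is a lower bound of this integral by a multiple of J² minus a
constant multiple of M², where M bounds |θ|. A Riccati argument then gives blow-up when J is large
compared with M at time 0.

The lower bound rests on a formula for the drift. Since the integral of s^{1-α}/(s² + k²) over s > 0
is a multiple of |k|^{-α}, the drift is, up to the factor `mixConst α`, the average of the operators
∂(s² - ∂²)⁻¹ with weight s^{1-α} (`MemClass.drift_eq_integral_flux`). For one s, put h = ∂(s² -
∂²)⁻¹ f. Then f' = s² h - h'', so the form ∫ (h/x) f' e^{-x} is local in h. An explicit primitive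
shows that it is at least h'(0)²/2, without error if s ≥ 1 and up to 2M² for every s > 0
(`Tame.half_sq_le_integral_flux_div`). Moreover h'(0) = -s L(s), with L the Laplace transform of
f(0) - f, and J is the integral of L over s > 1, because e^{-x}/x is the integral of e^{-sx} over s
> 1. Cauchy–Schwarz with the weight s^{3-α} converts the gain s^{1-α} s² L²/2 into (2 - α) J²/2,
while the range s ≤ 1 costs only 2M²/(2 - α) (`MemClass.le_integral_drift_div`).

Two facts about solutions are needed. The supremum norm does not grow, because θ_t = 0 at an
extremum (`IsSolution.abs_le`). Evenness persists, because the reflected solution has the same datum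
and solutions are unique (`IsSolution.unique`). Uniqueness is an energy argument in which the
skewness of each ∂(s² - ∂²)⁻¹ absorbs the possible positive order 1 - α of the drift. For α > 1 the
low frequencies are singular instead, and the L¹ norm of the difference is estimated together with
the L² norm. -/

noncomputable section

namespace AlphaModel

/-! ### General lemmas -/

/-- The Cauchy–Schwarz inequality for real functions. -/
theorem integral_abs_mul_le_sqrt_mul_sqrt {X : Type*} [MeasurableSpace X] {μ : Measure X}
    {f g : X → ℝ} (hfm : AEStronglyMeasurable f μ) (hgm : AEStronglyMeasurable g μ)
    (hf : Integrable (fun x => f x ^ 2) μ) (hg : Integrable (fun x => g x ^ 2) μ) :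
    ∫ x, |f x| * |g x| ∂μ ≤ √(∫ x, f x ^ 2 ∂μ) * √(∫ x, g x ^ 2 ∂μ) := by
  have h := integral_mul_le_Lp_mul_Lq_of_nonneg (μ := μ) (p := 2) (q := 2)
    (f := fun x => |f x|) (g := fun x => |g x|) ⟨by norm_num, by norm_num, by norm_num⟩
    (ae_of_all _ fun x => abs_nonneg _) (ae_of_all _ fun x => abs_nonneg _)
    (by simpa using! ((memLp_two_iff_integrable_sq hfm).2 hf).abs)
    (by simpa using! ((memLp_two_iff_integrable_sq hgm).2 hg).abs)
  simpa [Real.sqrt_eq_rpow] using h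

theorem sq_integral_abs_mul_le {X : Type*} [MeasurableSpace X] {μ : Measure X}
    {f g : X → ℝ} (hfm : AEStronglyMeasurable f μ) (hgm : AEStronglyMeasurable g μ)
    (hf : Integrable (fun x => f x ^ 2) μ) (hg : Integrable (fun x => g x ^ 2) μ) :
    (∫ x, |f x| * |g x| ∂μ) ^ 2 ≤ (∫ x, f x ^ 2 ∂μ) * ∫ x, g x ^ 2 ∂μ := by
  have h := integral_abs_mul_le_sqrt_mul_sqrt hfm hgm hf hg
  have h0 : 0 ≤ ∫ x, |f x| * |g x| ∂μ := integral_nonneg fun x => by positivity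
  calc _ ≤ (√(∫ x, f x ^ 2 ∂μ) * √(∫ x, g x ^ 2 ∂μ)) ^ 2 := by gcongr
    _ = _ := by
      rw [mul_pow, Real.sq_sqrt (integral_nonneg fun x => sq_nonneg _),
        Real.sq_sqrt (integral_nonneg fun x => sq_nonneg _)]

/-- A bounded measurable function times an integrable one is integrable. -/
theorem integrable_mul_of_abs_le {X : Type*} [MeasurableSpace X] {μ : Measure X}
    {a f : X → ℝ} (ha : AEStronglyMeasurable a μ) {C : ℝ} (hC : ∀ x, |a x| ≤ C)
    (hf : Integrable f μ) : Integrable (fun x => a x * f x) μ :=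
  hf.bdd_mul ha (ae_of_all _ hC)

theorem abs_integral_le_of_abs_le {X : Type*} [MeasurableSpace X] {μ : Measure X} {f g : X → ℝ}
    (hg : Integrable g μ) (h : ∀ x, |f x| ≤ g x) : |∫ x, f x ∂μ| ≤ ∫ x, g x ∂μ :=
  norm_integral_le_of_norm_le (f := f) hg (ae_of_all _ h)

theorem abs_setIntegral_le_of_abs_le {X : Type*} [MeasurableSpace X] {μ : Measure X} {f g : X → ℝ}
    {S : Set X} (hS : MeasurableSet S) (hg : IntegrableOn g S μ) (h : ∀ x ∈ S, |f x| ≤ g x) :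
    |∫ x in S, f x ∂μ| ≤ ∫ x in S, g x ∂μ :=
  norm_integral_le_of_norm_le (f := f) hg ((ae_restrict_iff' hS).2 (ae_of_all _ h))

/-- Integration by parts against a bounded multiplier with bounded continuous derivative. -/
theorem integral_mul_deriv_eq_neg {a a' g g' : ℝ → ℝ} {C C' : ℝ}
    (ha : ∀ x, HasDerivAt a (a' x) x) (ha' : Continuous a') (hC : ∀ x, |a x| ≤ C)
    (hC' : ∀ x, |a' x| ≤ C') (hg : ∀ x, HasDerivAt g (g' x) x) (hgi : Integrable g)
    (hgi' : Integrable g') : ∫ x, a x * g' x = -∫ x, a' x * g x := by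
  have hac : Continuous a := continuous_iff_continuousAt.2 fun x => (ha x).continuousAt
  have i1 := integrable_mul_of_abs_le ha'.aestronglyMeasurable hC' hgi
  have i2 := integrable_mul_of_abs_le hac.aestronglyMeasurable hC hgi'
  have h := integral_eq_zero_of_hasDerivAt_of_integrable (fun x => (ha x).mul (hg x))
    (i1.add i2) (integrable_mul_of_abs_le hac.aestronglyMeasurable hC hgi)
  rw [integral_add i1 i2] at h
  linarith

theorem integral_exp_neg_mul_Ioi_zero {s : ℝ} (hs : 0 < s) :
    ∫ z in Ioi (0 : ℝ), Real.exp (-s * z) = 1 / s := by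
  rw [integral_exp_mul_Ioi (by linarith)]
  simp

theorem integrableOn_exp_neg_mul {s : ℝ} (hs : 0 < s) :
    IntegrableOn (fun z => Real.exp (-s * z)) (Ioi (0 : ℝ)) :=
  integrableOn_exp_mul_Ioi (by linarith) 0

theorem integrableOn_mul_exp_neg_mul {s : ℝ} (hs : 0 < s) :
    IntegrableOn (fun z => z * Real.exp (-s * z)) (Ioi (0 : ℝ)) := by
  have := integrableOn_rpow_mul_exp_neg_mul_rpow (s := 1) (p := 1) (b := s) (by norm_num)
    (by norm_num) hs
  simpa using this

theorem integral_mul_exp_neg_mul_Ioi_zero {s : ℝ} (hs : 0 < s) :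
    ∫ z in Ioi (0 : ℝ), z * Real.exp (-s * z) = 1 / s ^ 2 := by
  have := Real.integral_rpow_mul_exp_neg_mul_Ioi (a := 2) (r := s) (by norm_num) hs
  have e : (2 : ℝ) - 1 = 1 := by norm_num
  rw [e] at this
  simpa [neg_mul] using this

theorem setIntegral_Ioi_zero_comp_add (g : ℝ → ℝ) (x : ℝ) :
    ∫ z in Ioi (0 : ℝ), g (x + z) = ∫ y in Ioi x, g y := by
  have := (measurePreserving_add_left volume x).setIntegral_preimage_emb
    (measurableEmbedding_addLeft x) g (Ioi x)
  simpa using this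

/-! ### The resolvent `(s² - ∂²)⁻¹` -/

/-- The forward exponential average of `f`. -/
def fwd (s : ℝ) (f : ℝ → ℝ) (x : ℝ) : ℝ := ∫ z in Ioi (0 : ℝ), Real.exp (-s * z) * f (x + z)

/-- The backward exponential average of `f`. -/
def bwd (s : ℝ) (f : ℝ → ℝ) (x : ℝ) : ℝ := ∫ z in Ioi (0 : ℝ), Real.exp (-s * z) * f (x - z)

/-- The resolvent `(s² - ∂²)⁻¹ f`. -/
def pot (s : ℝ) (f : ℝ → ℝ) (x : ℝ) : ℝ := (fwd s f x + bwd s f x) / (2 * s)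

/-- The derivative `∂ (s² - ∂²)⁻¹ f` of the resolvent. -/
def flux (s : ℝ) (f : ℝ → ℝ) (x : ℝ) : ℝ := (fwd s f x - bwd s f x) / 2

/-- Integrable functions of class `C¹` that are bounded together with their derivative. -/
structure Tame (f : ℝ → ℝ) : Prop where
  contDiff : ContDiff ℝ 1 f
  integrable : Integrable f
  bdd : ∃ C, ∀ x, |f x| ≤ C
  bdd_deriv : ∃ C, ∀ x, |deriv f x| ≤ C

namespace Tame

variable {f : ℝ → ℝ} {s : ℝ}

theorem continuous (hf : Tame f) : Continuous f := hf.contDiff.continuous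

theorem continuous_deriv (hf : Tame f) : Continuous (deriv f) :=
  hf.contDiff.continuous_deriv le_rfl

theorem hasDerivAt (hf : Tame f) (x : ℝ) : HasDerivAt f (deriv f x) x :=
  (hf.contDiff.differentiable one_ne_zero x).hasDerivAt

theorem comp_neg (hf : Tame f) : Tame (fun x => f (-x)) where
  contDiff := hf.contDiff.comp contDiff_neg
  integrable := hf.integrable.comp_neg
  bdd := let ⟨C, hC⟩ := hf.bdd; ⟨C, fun x => hC _⟩
  bdd_deriv := let ⟨C, hC⟩ := hf.bdd_deriv; ⟨C, fun x => by rw [deriv_comp_neg, abs_neg]; exact hC _⟩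

theorem integrable_sq (hf : Tame f) : Integrable (fun x => f x ^ 2) := by
  obtain ⟨C, hC⟩ := hf.bdd
  simpa [sq] using integrable_mul_of_abs_le hf.continuous.aestronglyMeasurable hC hf.integrable

end Tame

theorem bwd_eq_fwd (s : ℝ) (f : ℝ → ℝ) (x : ℝ) : bwd s f x = fwd s (fun y => f (-y)) (-x) := by
  simp only [bwd, fwd]
  congr with z
  congr 2
  ring

/-! ### Derivatives, bounds and energy identities for the exponential averages. -/

section Resolvent

variable {f : ℝ → ℝ} {s : ℝ}

theorem integrableOn_fwd (hs : 0 < s) (hf : Continuous f) {C : ℝ} (hC : ∀ x, |f x| ≤ C) (x : ℝ) :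
    IntegrableOn (fun z => Real.exp (-s * z) * f (x + z)) (Ioi 0) :=
  (integrableOn_exp_neg_mul hs).mul_bdd (c := C) (by fun_prop) (ae_of_all _ fun z => hC _)

theorem integrableOn_bwd (hs : 0 < s) (hf : Continuous f) {C : ℝ} (hC : ∀ x, |f x| ≤ C) (x : ℝ) :
    IntegrableOn (fun z => Real.exp (-s * z) * f (x - z)) (Ioi 0) :=
  (integrableOn_exp_neg_mul hs).mul_bdd (c := C) (by fun_prop) (ae_of_all _ fun z => hC _)

/-- The average equals e^{sx} times the integral of e^{-sy} f(y) over y > x, so the product rule and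
the fundamental theorem of calculus apply although f need not be differentiable. -/
theorem hasDerivAt_fwd (hs : 0 < s) (hf : Continuous f) (hfi : Integrable f) (x : ℝ) :
    HasDerivAt (fwd s f) (s * fwd s f x - f x) x := by
  set g : ℝ → ℝ := fun y => Real.exp (-s * y) * f y with hg
  have hgc : Continuous g := by fun_prop
  have hgi : ∀ x, IntegrableOn g (Ioi x) := by
    intro x
    refine (hfi.integrableOn).bdd_mul (c := Real.exp (-s * x)) (by fun_prop) ?_
    refine (ae_restrict_iff' measurableSet_Ioi).2 (ae_of_all _ fun y hy => ?_)
    rw [Real.norm_eq_abs, abs_of_pos (Real.exp_pos _)]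
    apply Real.exp_le_exp.2
    have : x < y := hy
    nlinarith
  have key : ∀ x, fwd s f x = Real.exp (s * x) * (∫ y in Ioi x, g y) := by
    intro x
    rw [← setIntegral_Ioi_zero_comp_add, ← integral_const_mul, fwd]
    congr with z
    rw [hg]
    simp only
    rw [← mul_assoc, ← Real.exp_add]
    congr 2
    ring
  have hG : ∀ x, ∫ y in Ioi x, g y = (∫ y in Ioi 0, g y) - ∫ y in (0 : ℝ)..x, g y := by
    intro x
    linarith [intervalIntegral.integral_Ioi_sub_Ioi' (hgi 0) (hgi x)]
  have hD : HasDerivAt (fun x => ∫ y in Ioi x, g y) (-g x) x := by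
    rw [funext hG]
    simpa using (intervalIntegral.integral_hasDerivAt_right (hgc.intervalIntegrable _ _)
      hgc.stronglyMeasurable.stronglyMeasurableAtFilter hgc.continuousAt).const_sub _
  have hE : HasDerivAt (fun x => Real.exp (s * x)) (Real.exp (s * x) * s) x := by
    simpa using ((hasDerivAt_id x).const_mul s).exp
  rw [funext key]
  refine (hE.mul hD).congr_deriv ?_
  rw [hg]
  simp only
  have e : Real.exp (s * x) * Real.exp (-s * x) = 1 := by
    rw [← Real.exp_add]; simp
  linear_combination (-f x) * e

theorem hasDerivAt_bwd (hs : 0 < s) (hf : Continuous f) (hfi : Integrable f) (x : ℝ) :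
    HasDerivAt (bwd s f) (f x - s * bwd s f x) x := by
  have h := hasDerivAt_fwd hs (f := fun y => f (-y)) (by fun_prop) hfi.comp_neg (-x)
  have h2 := HasDerivAt.comp x h (hasDerivAt_neg x)
  rw [funext (bwd_eq_fwd s f)]
  refine h2.congr_deriv ?_
  rw [neg_neg]
  ring

theorem hasDerivAt_pot (hs : 0 < s) (hf : Continuous f) (hfi : Integrable f) (x : ℝ) :
    HasDerivAt (pot s f) (flux s f x) x := by
  refine (((hasDerivAt_fwd hs hf hfi x).add
    (hasDerivAt_bwd hs hf hfi x)).div_const (2 * s)).congr_deriv ?_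
  rw [flux]
  field_simp
  ring

theorem hasDerivAt_flux (hs : 0 < s) (hf : Continuous f) (hfi : Integrable f) (x : ℝ) :
    HasDerivAt (flux s f) (s ^ 2 * pot s f x - f x) x := by
  refine (((hasDerivAt_fwd hs hf hfi x).sub
    (hasDerivAt_bwd hs hf hfi x)).div_const 2).congr_deriv ?_
  rw [pot]
  field_simp
  ring

theorem abs_fwd_le_div (hs : 0 < s) {C : ℝ} (hC : ∀ x, |f x| ≤ C) (x : ℝ) :
    |fwd s f x| ≤ C / s := by
  calc |fwd s f x| ≤ ∫ z in Ioi (0 : ℝ), Real.exp (-s * z) * C := by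
        refine abs_integral_le_of_abs_le ((integrableOn_exp_neg_mul hs).mul_const C) fun z => ?_
        rw [abs_mul, abs_of_pos (Real.exp_pos _)]
        gcongr
        exact hC _
    _ = C / s := by
        rw [integral_mul_const, integral_exp_neg_mul_Ioi_zero hs]
        ring

theorem abs_bwd_le_div (hs : 0 < s) {C : ℝ} (hC : ∀ x, |f x| ≤ C) (x : ℝ) :
    |bwd s f x| ≤ C / s := by
  rw [bwd_eq_fwd]
  exact abs_fwd_le_div hs (fun y => hC _) _

theorem abs_fwd_le_integral (hs : 0 < s) (hfi : Integrable f) (x : ℝ) :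
    |fwd s f x| ≤ ∫ y, |f y| := by
  have hi : Integrable (fun z => |f (x + z)|) := (hfi.comp_add_left x).abs
  calc |fwd s f x| ≤ ∫ z in Ioi (0 : ℝ), |f (x + z)| := by
        refine abs_setIntegral_le_of_abs_le measurableSet_Ioi hi.integrableOn fun z hz => ?_
        rw [abs_mul, abs_of_pos (Real.exp_pos _)]
        have : Real.exp (-s * z) ≤ 1 := by
          apply Real.exp_le_one_iff.2
          have : 0 < z := hz
          nlinarith
        exact mul_le_of_le_one_left (abs_nonneg _) this
    _ ≤ ∫ z, |f (x + z)| := setIntegral_le_integral hi (ae_of_all _ fun z => abs_nonneg _)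
    _ = ∫ y, |f y| := integral_add_left_eq_self (fun y => |f y|) x

theorem abs_bwd_le_integral (hs : 0 < s) (hfi : Integrable f) (x : ℝ) :
    |bwd s f x| ≤ ∫ y, |f y| := by
  rw [bwd_eq_fwd]
  refine (abs_fwd_le_integral hs hfi.comp_neg _).trans_eq ?_
  exact integral_neg_eq_self (fun y => |f y|) volume

theorem abs_flux_le_integral (hs : 0 < s) (hfi : Integrable f) (x : ℝ) :
    |flux s f x| ≤ ∫ y, |f y| := by
  have h1 := abs_le.1 (abs_fwd_le_integral hs hfi x)
  have h2 := abs_le.1 (abs_bwd_le_integral hs hfi x)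
  rw [flux, abs_le]
  constructor <;> linarith [h1.1, h1.2, h2.1, h2.2]

/-- Cauchy–Schwarz against e^{-sz}. The growth s^{-1/2} as s → 0 is the price for using only the L²
norm; it decides how far the pure L² uniqueness argument reaches. -/
theorem abs_fwd_le_sqrt (hs : 0 < s) (hf : Continuous f) (hf2 : Integrable (fun x => f x ^ 2))
    (x : ℝ) : |fwd s f x| ≤ √(∫ y, f y ^ 2) / √s := by
  have hi : Integrable (fun z => f (x + z) ^ 2) := hf2.comp_add_left x
  have hexp : ∀ z : ℝ, Real.exp (-s * z) ^ 2 = Real.exp (-(2 * s) * z) := by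
    intro z
    rw [sq, ← Real.exp_add]
    congr 1
    ring
  have h := integral_abs_mul_le_sqrt_mul_sqrt (μ := volume.restrict (Ioi 0))
    (f := fun z => Real.exp (-s * z)) (g := fun z => f (x + z)) (by fun_prop) (by fun_prop)
    (by simp only [hexp]; exact integrableOn_exp_neg_mul (by positivity)) hi.integrableOn
  have h1 : |fwd s f x| ≤ ∫ z in Ioi (0 : ℝ), |Real.exp (-s * z)| * |f (x + z)| := by
    simp only [← abs_mul]
    exact abs_integral_le_integral_abs
  have h2 : ∫ z in Ioi (0 : ℝ), f (x + z) ^ 2 ≤ ∫ y, f y ^ 2 :=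
    (setIntegral_le_integral hi (ae_of_all _ fun z => sq_nonneg _)).trans_eq
      (integral_add_left_eq_self (fun y => f y ^ 2) x)
  have h3 : ∫ z in Ioi (0 : ℝ), Real.exp (-s * z) ^ 2 ≤ 1 / s := by
    simp only [hexp]
    rw [integral_exp_neg_mul_Ioi_zero (by positivity)]
    gcongr
    linarith
  calc _ ≤ _ := h1.trans h
    _ ≤ √(1 / s) * √(∫ y, f y ^ 2) := by gcongr
    _ = _ := by rw [Real.sqrt_div zero_le_one, Real.sqrt_one]; ring

theorem abs_flux_le_sqrt (hs : 0 < s) (hf : Continuous f) (hf2 : Integrable (fun x => f x ^ 2))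
    (x : ℝ) : |flux s f x| ≤ √(∫ y, f y ^ 2) / √s := by
  have h1 := abs_le.1 (abs_fwd_le_sqrt hs hf hf2 x)
  have h2 := abs_fwd_le_sqrt hs (f := fun y => f (-y)) (by fun_prop) hf2.comp_neg (-x)
  rw [← bwd_eq_fwd, integral_neg_eq_self (fun y => f y ^ 2) volume] at h2
  have h2 := abs_le.1 h2
  rw [flux, abs_le]
  constructor <;> linarith [h1.1, h1.2, h2.1, h2.2]

theorem flux_eq_integral (hs : 0 < s) (hf : Continuous f) {C : ℝ} (hC : ∀ x, |f x| ≤ C) (x : ℝ) :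
    flux s f x = (∫ z in Ioi (0 : ℝ), Real.exp (-s * z) * (f (x + z) - f (x - z))) / 2 := by
  rw [flux, fwd, bwd, ← integral_sub (integrableOn_fwd hs hf hC x) (integrableOn_bwd hs hf hC x)]
  simp only [mul_sub]

/-- The difference f(x + z) - f(x - z) is O(z), which gains one power of 1/s over the bound of each
average. This gives the decay in s needed to integrate against s^{1-α} at infinity. -/
theorem Tame.abs_flux_le_div (hf : Tame f) (hs : 0 < s) {C : ℝ} (hC : ∀ x, |deriv f x| ≤ C)
    (x : ℝ) : |flux s f x| ≤ C / s ^ 2 := by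
  obtain ⟨C0, hC0⟩ := hf.bdd
  have hlip : ∀ x y, |f y - f x| ≤ C * |y - x| := fun x y =>
    Convex.norm_image_sub_le_of_norm_deriv_le (fun z _ => (hf.hasDerivAt z).differentiableAt)
      (fun z _ => hC z) convex_univ (mem_univ x) (mem_univ y)
  rw [flux_eq_integral hs hf.continuous hC0, abs_div, abs_two, div_le_iff₀ two_pos]
  calc _ ≤ ∫ z in Ioi (0 : ℝ), (z * Real.exp (-s * z)) * (2 * C) := by
        refine abs_setIntegral_le_of_abs_le measurableSet_Ioi
          ((integrableOn_mul_exp_neg_mul hs).mul_const _) fun z hz => ?_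
        rw [abs_mul, abs_of_pos (Real.exp_pos _)]
        have h := hlip (x - z) (x + z)
        have hz' : (0 : ℝ) < z := hz
        have e : x + z - (x - z) = 2 * z := by ring
        rw [e, abs_of_pos (by positivity : 0 < 2 * z)] at h
        calc _ ≤ Real.exp (-s * z) * (C * (2 * z)) := by gcongr
          _ = _ := by ring
    _ = C / s ^ 2 * 2 := by
        rw [integral_mul_const, integral_mul_exp_neg_mul_Ioi_zero hs]
        ring

/-- The average is a convolution with the integrable one-sided exponential. -/
theorem integrable_bwd (hs : 0 < s) (hfi : Integrable f) : Integrable (bwd s f) := by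
  have hg : Integrable ((Ioi (0 : ℝ)).indicator fun z => Real.exp (-s * z)) :=
    (integrable_indicator_iff measurableSet_Ioi).2 (integrableOn_exp_neg_mul hs)
  have := hg.integrable_convolution (ContinuousLinearMap.mul ℝ ℝ) hfi
  refine this.congr (ae_of_all _ fun x => ?_)
  simp only [convolution, bwd]
  rw [← integral_indicator measurableSet_Ioi]
  congr with z
  by_cases hz : z ∈ Ioi (0 : ℝ) <;> simp [hz]

theorem integrable_fwd (hs : 0 < s) (hfi : Integrable f) : Integrable (fwd s f) := by
  have := (integrable_bwd hs hfi.comp_neg).comp_neg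
  refine this.congr (ae_of_all _ fun x => ?_)
  simp [bwd_eq_fwd]

theorem integrable_pot (hs : 0 < s) (hfi : Integrable f) : Integrable (pot s f) :=
  ((integrable_fwd hs hfi).add (integrable_bwd hs hfi)).div_const _

theorem integrable_flux (hs : 0 < s) (hfi : Integrable f) : Integrable (flux s f) :=
  ((integrable_fwd hs hfi).sub (integrable_bwd hs hfi)).div_const _

theorem continuous_pot (hs : 0 < s) (hf : Continuous f) (hfi : Integrable f) :
    Continuous (pot s f) :=
  continuous_iff_continuousAt.2 fun x => (hasDerivAt_pot hs hf hfi x).continuousAt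

theorem continuous_flux (hs : 0 < s) (hf : Continuous f) (hfi : Integrable f) :
    Continuous (flux s f) :=
  continuous_iff_continuousAt.2 fun x => (hasDerivAt_flux hs hf hfi x).continuousAt

theorem abs_pot_le (hs : 0 < s) {C : ℝ} (hC : ∀ x, |f x| ≤ C) (x : ℝ) :
    |pot s f x| ≤ C / s ^ 2 := by
  have h1 := abs_fwd_le_div hs hC x
  have h2 := abs_bwd_le_div hs hC x
  rw [pot, abs_div, abs_of_pos (by positivity : 0 < 2 * s), div_le_iff₀ (by positivity)]
  calc _ ≤ C / s + C / s := (abs_add_le _ _).trans (add_le_add h1 h2)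
    _ = _ := by field_simp; ring

/-- Joint measurability in s and x, needed for Fubini in the mixture formula. -/
theorem stronglyMeasurable_flux (hf : Continuous f) :
    StronglyMeasurable (Function.uncurry fun s x => flux s f x) := by
  have h1 : StronglyMeasurable (fun p : ℝ × ℝ => fwd p.1 f p.2) :=
    StronglyMeasurable.integral_prod_right (ν := volume.restrict (Ioi 0))
      (f := fun (p : ℝ × ℝ) z => Real.exp (-p.1 * z) * f (p.2 + z))
      (Continuous.stronglyMeasurable (by fun_prop))
  have h2 : StronglyMeasurable (fun p : ℝ × ℝ => bwd p.1 f p.2) :=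
    StronglyMeasurable.integral_prod_right (ν := volume.restrict (Ioi 0))
      (f := fun (p : ℝ × ℝ) z => Real.exp (-p.1 * z) * f (p.2 - z))
      (Continuous.stronglyMeasurable (by fun_prop))
  have h3 : StronglyMeasurable (fun p : ℝ × ℝ => (fwd p.1 f p.2 - bwd p.1 f p.2) / 2) :=
    ((h1.measurable.sub h2.measurable).div_const 2).stronglyMeasurable
  exact h3

namespace Tame

theorem integrable_pot_sq (hf : Tame f) (hs : 0 < s) : Integrable (fun x => pot s f x ^ 2) := by
  obtain ⟨C, hC⟩ := hf.bdd
  simpa [sq] using integrable_mul_of_abs_le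
    (continuous_pot hs hf.continuous hf.integrable).aestronglyMeasurable (abs_pot_le hs hC)
    (integrable_pot hs hf.integrable)

theorem integrable_flux_sq (hf : Tame f) (hs : 0 < s) : Integrable (fun x => flux s f x ^ 2) := by
  simpa [sq] using integrable_mul_of_abs_le
    (continuous_flux hs hf.continuous hf.integrable).aestronglyMeasurable
    (abs_flux_le_integral hs hf.integrable) (integrable_flux hs hf.integrable)

/-- The energy estimate for the resolvent. -/
theorem resolvent_energy (hf : Tame f) (hs : 0 < s) :
    s ^ 2 * (∫ x, pot s f x ^ 2) + 2 * (∫ x, flux s f x ^ 2) ≤ (∫ x, f x ^ 2) / s ^ 2 := by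
  obtain ⟨C, hC⟩ := hf.bdd
  have hpc := continuous_pot hs hf.continuous hf.integrable
  have hfc := continuous_flux hs hf.continuous hf.integrable
  have ip := hf.integrable_pot_sq hs
  have ifl := hf.integrable_flux_sq hs
  have i0 : Integrable (fun x => pot s f x * f x) :=
    integrable_mul_of_abs_le hpc.aestronglyMeasurable (abs_pot_le hs hC) hf.integrable
  have i1 : Integrable (fun x => flux s f x * flux s f x +
      pot s f x * (s ^ 2 * pot s f x - f x)) := by
    have := (ifl.add (ip.const_mul (s ^ 2))).sub i0
    refine this.congr (ae_of_all _ fun x => ?_)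
    simp only [Pi.add_apply, Pi.sub_apply]
    ring
  -- With p = (s² - ∂²)⁻¹ f and h = p', the derivative of p h is h² + p (s² p - f), and its integral
  -- vanishes. Young's inequality for ∫ p f then absorbs half of s² ∫ p².
  have h := integral_eq_zero_of_hasDerivAt_of_integrable
    (fun x => (hasDerivAt_pot hs hf.continuous hf.integrable x).mul
      (hasDerivAt_flux hs hf.continuous hf.integrable x)) i1
    (integrable_mul_of_abs_le hpc.aestronglyMeasurable (abs_pot_le hs hC)
      (integrable_flux hs hf.integrable))
  have e : ∫ x, (flux s f x * flux s f x + pot s f x * (s ^ 2 * pot s f x - f x)) =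
      (∫ x, flux s f x ^ 2) + s ^ 2 * (∫ x, pot s f x ^ 2) - ∫ x, pot s f x * f x := by
    have ic := ip.const_mul (s ^ 2)
    rw [← integral_const_mul, ← integral_add ifl ic, ← integral_sub (by exact ifl.add ic) i0]
    congr with x
    ring
  rw [e] at h
  have h2 : ∫ x, pot s f x * f x ≤ (s ^ 2 / 2) * (∫ x, pot s f x ^ 2) +
      (1 / (2 * s ^ 2)) * ∫ x, f x ^ 2 := by
    rw [← integral_const_mul, ← integral_const_mul,
      ← integral_add (ip.const_mul _) (hf.integrable_sq.const_mul _)]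
    refine integral_mono i0 ((ip.const_mul _).add (hf.integrable_sq.const_mul _)) fun x => ?_
    have e2 : s ^ 2 / 2 * pot s f x ^ 2 + 1 / (2 * s ^ 2) * f x ^ 2 - pot s f x * f x
        = (s * pot s f x - f x / s) ^ 2 / 2 := by
      field_simp
      ring
    have := sq_nonneg (s * pot s f x - f x / s)
    simp only
    linarith
  have e3 : (∫ x, f x ^ 2) / s ^ 2 = 2 * ((1 / (2 * s ^ 2)) * ∫ x, f x ^ 2) := by
    field_simp
  rw [e3]
  linarith

theorem integral_flux_sq_le (hf : Tame f) (hs : 0 < s) :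
    ∫ x, flux s f x ^ 2 ≤ (∫ x, f x ^ 2) / s ^ 2 := by
  have h := hf.resolvent_energy hs
  have h1 : 0 ≤ s ^ 2 * ∫ x, pot s f x ^ 2 :=
    mul_nonneg (sq_nonneg _) (integral_nonneg fun x => sq_nonneg _)
  have h2 : 0 ≤ ∫ x, flux s f x ^ 2 := integral_nonneg fun x => sq_nonneg _
  linarith

/-- The commutator estimate: the operator `∂ (s² - ∂²)⁻¹` is skew, so that its quadratic form with
a multiplier `a` is controlled by the derivative of `a`. -/
theorem abs_integral_mul_flux_le (hf : Tame f) (hs : 0 < s) {a a' : ℝ → ℝ} {C C' : ℝ}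
    (ha : ∀ x, HasDerivAt a (a' x) x) (ha' : Continuous a') (hC : ∀ x, |a x| ≤ C)
    (hC' : ∀ x, |a' x| ≤ C') :
    |∫ x, a x * f x * flux s f x| ≤ C' * (∫ x, f x ^ 2) / s ^ 2 := by
  have ip := hf.integrable_pot_sq hs
  have ifl := hf.integrable_flux_sq hs
  have hpc := continuous_pot hs hf.continuous hf.integrable
  have hfc := continuous_flux hs hf.continuous hf.integrable
  -- Skewness in local form: f h is half the derivative of s² p² - h². Integrating by parts moves
  -- the derivative onto `a`, and the energy estimate supplies the factor 1/s².
  have hg : ∀ x, HasDerivAt (fun x => s ^ 2 * pot s f x ^ 2 - flux s f x ^ 2)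
      (2 * (f x * flux s f x)) x := by
    intro x
    have h1 := ((hasDerivAt_pot hs hf.continuous hf.integrable x).pow 2).const_mul (s ^ 2)
    have h2 := (hasDerivAt_flux hs hf.continuous hf.integrable x).pow 2
    refine (h1.sub h2).congr_deriv ?_
    simp only [Nat.cast_ofNat, Nat.add_one_sub_one, pow_one]
    ring
  have hgi := (ip.const_mul (s ^ 2)).sub ifl
  have hgi' : Integrable (fun x => 2 * (f x * flux s f x)) := by
    refine Integrable.const_mul ?_ 2
    simpa [mul_comm] using integrable_mul_of_abs_le hfc.aestronglyMeasurable
      (abs_flux_le_integral hs hf.integrable) hf.integrable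
  have h := integral_mul_deriv_eq_neg ha ha' hC hC' hg hgi hgi'
  have e : ∫ x, a x * f x * flux s f x = (∫ x, a x * (2 * (f x * flux s f x))) / 2 := by
    rw [← integral_div]
    congr with x
    ring
  have hC0 : 0 ≤ C' := (abs_nonneg _).trans (hC' 0)
  rw [e, h, abs_div, abs_neg, abs_two, div_le_iff₀ two_pos]
  have hE := hf.resolvent_energy hs
  have hfl : 0 ≤ ∫ x, flux s f x ^ 2 := integral_nonneg fun x => sq_nonneg _
  have hf2 : 0 ≤ (∫ x, f x ^ 2) / s ^ 2 := div_nonneg (integral_nonneg fun x => sq_nonneg _)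
    (sq_nonneg _)
  calc _ ≤ ∫ x, C' * (s ^ 2 * pot s f x ^ 2 + flux s f x ^ 2) := by
        refine abs_integral_le_of_abs_le (by exact ((ip.const_mul _).add ifl).const_mul _)
          fun x => ?_
        rw [abs_mul]
        gcongr
        · exact hC' x
        · rw [abs_le]
          constructor <;> nlinarith [sq_nonneg (s * pot s f x), sq_nonneg (flux s f x)]
    _ = C' * (s ^ 2 * (∫ x, pot s f x ^ 2) + ∫ x, flux s f x ^ 2) := by
        rw [integral_const_mul, integral_add (ip.const_mul _) ifl, integral_const_mul]
    _ ≤ C' * ((∫ x, f x ^ 2) / s ^ 2) := by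
        gcongr
        linarith
    _ ≤ C' * (∫ x, f x ^ 2) / s ^ 2 * 2 := by
        have := mul_nonneg hC0 hf2
        rw [mul_div_assoc]
        linarith

end Tame

end Resolvent

/-! ### The weighted inequality on the half line -/

/-- The functional that blows up. -/
def blowupFunctional (f : ℝ → ℝ) : ℝ :=
  ∫ x in Ioi (0 : ℝ), (f 0 - f x) / x * Real.exp (-x)

/-- The Laplace transform of `f 0 - f`. -/
def laplaceDefect (f : ℝ → ℝ) (s : ℝ) : ℝ :=
  ∫ x in Ioi (0 : ℝ), Real.exp (-s * x) * (f 0 - f x)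

section Weighted

variable {f : ℝ → ℝ} {s M : ℝ}

theorem flux_neg_of_even (hev : ∀ x, f (-x) = f x) (x : ℝ) : flux s f (-x) = -flux s f x := by
  have e : (fun y => f (-y)) = f := funext hev
  simp only [flux, bwd_eq_fwd, e, neg_neg]
  ring

theorem flux_zero_of_even (hev : ∀ x, f (-x) = f x) : flux s f 0 = 0 := by
  have := flux_neg_of_even (s := s) hev 0
  rw [neg_zero] at this
  linarith

theorem flux_comp_neg (s : ℝ) (f : ℝ → ℝ) (x : ℝ) :
    flux s (fun y => f (-y)) x = -flux s f (-x) := by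
  simp only [flux, bwd_eq_fwd, neg_neg]
  ring

namespace Tame

theorem abs_deriv_flux_le (hs : 0 < s) (hM : ∀ x, |f x| ≤ M) (x : ℝ) :
    |s ^ 2 * pot s f x - f x| ≤ 2 * M := by
  have h1 := abs_pot_le hs hM x
  have h2 := hM x
  rw [le_div_iff₀ (by positivity)] at h1
  calc _ ≤ |s ^ 2 * pot s f x| + |f x| := abs_sub _ _
    _ = |pot s f x| * s ^ 2 + |f x| := by rw [abs_mul, abs_of_pos (by positivity)]; ring
    _ ≤ _ := by linarith

/-- The flux of an even function vanishes at 0 and its derivative s² p - f is at most 2M in absolute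
value. The bound is uniform in s and uses no derivative of f, so the final error depends on M alone.
-/
theorem abs_flux_le_mul (hf : Tame f) (hs : 0 < s) (hev : ∀ x, f (-x) = f x)
    (hM : ∀ x, |f x| ≤ M) (x : ℝ) : |flux s f x| ≤ 2 * M * |x| := by
  have h := Convex.norm_image_sub_le_of_norm_hasDerivWithin_le
    (fun z _ => (hasDerivAt_flux hs hf.continuous hf.integrable z).hasDerivWithinAt)
    (fun z _ => abs_deriv_flux_le hs hM z) convex_univ (mem_univ 0) (mem_univ x)
  simpa [flux_zero_of_even hev] using h

theorem abs_flux_div_le (hf : Tame f) (hs : 0 < s) (hev : ∀ x, f (-x) = f x)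
    (hM : ∀ x, |f x| ≤ M) {x : ℝ} (hx : 0 < x) : |flux s f x / x| ≤ 2 * M := by
  have := hf.abs_flux_le_mul hs hev hM x
  rwa [abs_div, div_le_iff₀ (abs_pos.2 hx.ne')]

theorem integrableOn_flux_div (hf : Tame f) (hs : 0 < s) (hev : ∀ x, f (-x) = f x) :
    IntegrableOn (fun x => flux s f x / x * deriv f x * Real.exp (-x)) (Ioi 0) := by
  obtain ⟨M, hM⟩ := hf.bdd
  obtain ⟨C, hC⟩ := hf.bdd_deriv
  have hi : IntegrableOn (fun x => Real.exp (-x)) (Ioi (0 : ℝ)) := integrableOn_exp_neg_Ioi 0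
  have hc := continuous_flux hs hf.continuous hf.integrable
  refine hi.bdd_mul (c := 2 * M * C) ?_ ?_
  · refine ((hc.measurable.div measurable_id).mul
      hf.continuous_deriv.measurable).aestronglyMeasurable
  · refine (ae_restrict_iff' measurableSet_Ioi).2 (ae_of_all _ fun x hx => ?_)
    rw [Real.norm_eq_abs, abs_mul]
    have h1 := hf.abs_flux_div_le hs hev hM hx
    exact mul_le_mul h1 (hC x) (abs_nonneg _) ((abs_nonneg _).trans h1)

/-- With h the flux and p = h/x, substitute f' = s² h - h'' and integrate: the boundary term at 0
gives h'(0)²/2, a square of p' has a favourable sign and is dropped, and the zero-order term (1/2 -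
s²) p² is bounded by D. The weight x e^{-x} that multiplies it has integral 1, so D enters with
coefficient 1. -/
theorem half_sq_le_integral_flux_div (hf : Tame f) (hs : 0 < s) (hev : ∀ x, f (-x) = f x)
    (hM : ∀ x, |f x| ≤ M) {D : ℝ}
    (hD : ∀ p : ℝ, |p| ≤ 2 * M → (1 / 2 - s ^ 2) * p ^ 2 ≤ D) :
    (s ^ 2 * pot s f 0 - f 0) ^ 2 / 2 ≤
      (∫ x in Ioi (0 : ℝ), flux s f x / x * deriv f x * Real.exp (-x)) + D := by
  have hM0 : 0 ≤ M := (abs_nonneg _).trans (hM 0)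
  set h := flux s f with hh
  set h' : ℝ → ℝ := fun x => s ^ 2 * pot s f x - f x with hh'
  have hder : ∀ x, HasDerivAt h (h' x) x := hasDerivAt_flux hs hf.continuous hf.integrable
  have hder' : ∀ x, HasDerivAt h' (s ^ 2 * h x - deriv f x) x := fun x =>
    ((hasDerivAt_pot hs hf.continuous hf.integrable x).const_mul _).sub (hf.hasDerivAt x)
  have hcont : Continuous h := continuous_flux hs hf.continuous hf.integrable
  have hcont' : Continuous h' := continuous_iff_continuousAt.2 fun x => (hder' x).continuousAt
  -- The term p h' comes from integrating p h'' by parts, and (x - 1)/2 · p² collects what remains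
  -- of p p' after the weight e^{-x} is differentiated. Its derivative is the integrand minus x
  -- e^{-x} p'² plus x e^{-x} (1/2 - s²) p².
  set G : ℝ → ℝ := fun x => -(Real.exp (-x) * (h x / x * h' x + (x - 1) / 2 * (h x / x) ^ 2))
    with hG
  -- Division by zero makes p equal to 0 at the origin instead of its limit h'(0); the limit of G
  -- there is -(h'(0)² - h'(0)²/2), and this value restores continuity.
  set G₀ : ℝ → ℝ := fun x => if x ≤ 0 then -(h' 0 ^ 2 / 2) else G x with hG₀
  set g : ℝ → ℝ := fun x => h x / x * deriv f x * Real.exp (-x) + D * (x * Real.exp (-1 * x)) with hg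
  have hi0 : IntegrableOn (fun x => D * (x * Real.exp (-1 * x))) (Ioi (0 : ℝ)) :=
    (integrableOn_mul_exp_neg_mul one_pos).const_mul D
  have hgi : IntegrableOn g (Ioi 0) := (hf.integrableOn_flux_div hs hev).add hi0
  have hGder : ∀ x : ℝ, 0 < x → HasDerivAt G
      (h x / x * deriv f x * Real.exp (-x) - Real.exp (-x) * x * ((h' x * x - h x) / x ^ 2) ^ 2
        + x * Real.exp (-x) * ((1 / 2 - s ^ 2) * (h x / x) ^ 2)) x := by
    intro x hx
    have hp : HasDerivAt (fun x => h x / x) ((h' x * x - h x * 1) / x ^ 2) x :=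
      (hder x).div (hasDerivAt_id x) hx.ne'
    have he : HasDerivAt (fun x => Real.exp (-x)) (Real.exp (-x) * (-1)) x :=
      (hasDerivAt_neg x).exp
    have hl : HasDerivAt (fun x : ℝ => (x - 1) / 2) (1 / 2) x :=
      ((hasDerivAt_id x).sub_const 1).div_const 2
    refine (he.mul ((hp.mul (hder' x)).add (hl.mul (hp.pow 2)))).neg.congr_deriv ?_
    simp only [Pi.add_apply, Pi.mul_apply, Pi.pow_apply, Nat.cast_ofNat, Nat.add_one_sub_one,
      pow_one]
    field_simp
    ring
  have hpt : Tendsto (fun x => h x / x) (𝓝[>] 0) (𝓝 (h' 0)) := by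
    have := (hder 0).tendsto_slope
    refine (this.mono_left (nhdsWithin_mono 0 fun x hx => (ne_of_gt hx))).congr fun x => ?_
    simp [slope_def_field, hh, flux_zero_of_even hev]
  have hG0 : Tendsto G (𝓝[>] 0) (𝓝 (-(h' 0 ^ 2 / 2))) := by
    have t1 : Tendsto h' (𝓝[>] 0) (𝓝 (h' 0)) := (hcont'.tendsto 0).mono_left nhdsWithin_le_nhds
    have t2 : Tendsto (fun x : ℝ => Real.exp (-x)) (𝓝[>] 0) (𝓝 1) := by
      have : Continuous fun x : ℝ => Real.exp (-x) := by fun_prop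
      simpa using (this.tendsto 0).mono_left nhdsWithin_le_nhds
    have t3 : Tendsto (fun x : ℝ => (x - 1) / 2) (𝓝[>] 0) (𝓝 ((0 - 1) / 2)) := by
      have : Continuous fun x : ℝ => (x - 1) / 2 := by fun_prop
      exact (this.tendsto 0).mono_left nhdsWithin_le_nhds
    have := (t2.mul ((hpt.mul t1).add (t3.mul (hpt.pow 2)))).neg
    convert this using 2
    ring
  have hcG : ContinuousOn G₀ (Ici 0) := by
    intro x hx
    rcases (mem_Ici.1 hx).eq_or_lt with rfl | hx
    · have e : G₀ 0 = -(h' 0 ^ 2 / 2) := by simp [hG₀]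
      have : ContinuousWithinAt G₀ (Ioi 0) 0 := by
        rw [ContinuousWithinAt, e]
        refine hG0.congr' ?_
        filter_upwards [self_mem_nhdsWithin] with x hx
        simp [hG₀, not_le.2 (mem_Ioi.1 hx)]
      rwa [continuousWithinAt_Ioi_iff_Ici] at this
    · refine (((hGder x hx).continuousAt).congr ?_).continuousWithinAt
      filter_upwards [lt_mem_nhds hx] with y hy
      simp [hG₀, not_le.2 hy]
  have hineq : ∀ b : ℝ, 0 ≤ b → G₀ b - G₀ 0 ≤ ∫ x in (0 : ℝ)..b, g x := by
    intro b hb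
    refine intervalIntegral.sub_le_integral_of_hasDeriv_right_of_le
      (g' := fun x => h x / x * deriv f x * Real.exp (-x)
        - Real.exp (-x) * x * ((h' x * x - h x) / x ^ 2) ^ 2
        + x * Real.exp (-x) * ((1 / 2 - s ^ 2) * (h x / x) ^ 2)) hb
      (hcG.mono Icc_subset_Ici_self) (fun x hx => ?_)
      ((integrableOn_Icc_iff_integrableOn_Ioc).2 (hgi.mono_set Ioc_subset_Ioi_self)) fun x hx => ?_
    · refine ((hGder x hx.1).congr_of_eventuallyEq ?_).hasDerivWithinAt
      filter_upwards [lt_mem_nhds hx.1] with y hy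
      simp [hG₀, not_le.2 hy]
    · have hx0 := hx.1
      have h1 := hD (h x / x) (hf.abs_flux_div_le hs hev hM hx.1)
      have h2 : 0 ≤ Real.exp (-x) * x * ((h' x * x - h x) / x ^ 2) ^ 2 := by positivity
      have h3 : 0 ≤ x * Real.exp (-x) := by positivity
      have h4 := mul_le_mul_of_nonneg_left h1 h3
      simp only [hg, neg_one_mul]
      linarith
  have hinf : Tendsto G₀ atTop (𝓝 0) := by
    have hb : Tendsto (fun x : ℝ => (4 * M ^ 2 + 2 * M ^ 2 * (x + 1)) * Real.exp (-x)) atTop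
        (𝓝 0) := by
      have t0 := Real.tendsto_pow_mul_exp_neg_atTop_nhds_zero 0
      have t1 := Real.tendsto_pow_mul_exp_neg_atTop_nhds_zero 1
      have := (t0.const_mul (6 * M ^ 2)).add (t1.const_mul (2 * M ^ 2))
      simp only [mul_zero, add_zero] at this
      refine this.congr fun x => ?_
      ring
    refine squeeze_zero_norm' ?_ hb
    filter_upwards [eventually_gt_atTop 0] with x hx
    have h1 := hf.abs_flux_div_le hs hev hM hx
    have h2 := abs_deriv_flux_le hs hM x
    have e : G₀ x = G x := by simp [hG₀, not_le.2 hx]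
    rw [e, hG, norm_neg, norm_mul, Real.norm_eq_abs, Real.norm_eq_abs,
      abs_of_pos (Real.exp_pos _), mul_comm]
    gcongr
    have h3 : |h x / x * h' x| ≤ 2 * M * (2 * M) := by
      rw [abs_mul]
      exact mul_le_mul h1 h2 (abs_nonneg _) (by positivity)
    have h4 : |(x - 1) / 2 * (h x / x) ^ 2| ≤ (x + 1) / 2 * (2 * M) ^ 2 := by
      rw [abs_mul, abs_pow]
      have : |(x - 1) / 2| ≤ (x + 1) / 2 := by
        rw [abs_le]
        constructor <;> linarith
      gcongr
    calc _ ≤ _ := abs_add_le _ _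
      _ ≤ 2 * M * (2 * M) + (x + 1) / 2 * (2 * M) ^ 2 := add_le_add h3 h4
      _ = _ := by ring
  have hlim := intervalIntegral_tendsto_integral_Ioi 0 hgi tendsto_id
  have hfin : 0 - G₀ 0 ≤ ∫ x in Ioi 0, g x := by
    refine le_of_tendsto_of_tendsto (hinf.sub_const _) hlim ?_
    filter_upwards [eventually_ge_atTop 0] with b hb
    exact hineq b hb
  have e1 : ∫ x in Ioi 0, g x =
      (∫ x in Ioi (0 : ℝ), h x / x * deriv f x * Real.exp (-x)) + D := by
    rw [hg, integral_add (hf.integrableOn_flux_div hs hev) hi0, integral_const_mul,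
      integral_mul_exp_neg_mul_Ioi_zero one_pos, hh]
    simp
  rw [e1] at hfin
  have e0 : G₀ 0 = -(h' 0 ^ 2 / 2) := by simp [hG₀]
  rw [e0] at hfin
  simpa using hfin

/-- For even f the two averages agree at 0, and the average of the constant f(0) is f(0)/s. -/
theorem deriv_flux_zero (hf : Tame f) (hs : 0 < s) (hev : ∀ x, f (-x) = f x) :
    s ^ 2 * pot s f 0 - f 0 = -(s * laplaceDefect f s) := by
  obtain ⟨C, hC⟩ := hf.bdd
  have e : (fun y => f (-y)) = f := funext hev
  have h1 : bwd s f 0 = fwd s f 0 := by rw [bwd_eq_fwd, e, neg_zero]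
  have h2 : laplaceDefect f s = f 0 / s - fwd s f 0 := by
    have i1 := (integrableOn_exp_neg_mul hs).mul_const (f 0)
    have i2 := integrableOn_fwd hs hf.continuous hC 0
    simp only [laplaceDefect, fwd, mul_sub]
    simp only [zero_add] at i2 ⊢
    rw [integral_sub i1 i2, integral_mul_const, integral_exp_neg_mul_Ioi_zero hs]
    ring
  rw [pot, h1, h2]
  field_simp
  ring

theorem sq_laplaceDefect_le (hf : Tame f) (hs : 1 ≤ s) (hev : ∀ x, f (-x) = f x) :
    s ^ 2 * laplaceDefect f s ^ 2 / 2 ≤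
      ∫ x in Ioi (0 : ℝ), flux s f x / x * deriv f x * Real.exp (-x) := by
  obtain ⟨M, hM⟩ := hf.bdd
  -- No error is needed here, since 1/2 - s² ≤ 0 for s ≥ 1.
  have := hf.half_sq_le_integral_flux_div (D := 0) (by linarith) hev hM fun p _ => by
    exact mul_nonpos_of_nonpos_of_nonneg (by nlinarith) (sq_nonneg p)
  rw [hf.deriv_flux_zero (by linarith) hev] at this
  calc _ = (-(s * laplaceDefect f s)) ^ 2 / 2 := by ring
    _ ≤ _ := by simpa using this

theorem neg_le_integral_flux_div (hf : Tame f) (hs : 0 < s) (hev : ∀ x, f (-x) = f x)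
    (hM : ∀ x, |f x| ≤ M) :
    -(2 * M ^ 2) ≤ ∫ x in Ioi (0 : ℝ), flux s f x / x * deriv f x * Real.exp (-x) := by
  -- Dropping -s² p² and using |p| ≤ 2M leaves (1/2)(2M)² = 2M².
  have := hf.half_sq_le_integral_flux_div (D := 2 * M ^ 2) hs hev hM fun p hp => by
    have h1 : p ^ 2 ≤ (2 * M) ^ 2 := sq_le_sq' (by linarith [(abs_le.1 hp).1]) (abs_le.1 hp).2
    nlinarith [sq_nonneg p, sq_nonneg s, mul_nonneg (sq_nonneg s) (sq_nonneg p)]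
  have h2 := sq_nonneg (s ^ 2 * pot s f 0 - f 0)
  linarith

theorem abs_sub_zero_le (hf : Tame f) {C : ℝ} (hC : ∀ x, |deriv f x| ≤ C) {x : ℝ} (hx : 0 < x) :
    |f 0 - f x| ≤ C * x := by
  have := Convex.norm_image_sub_le_of_norm_deriv_le
    (fun z _ => (hf.hasDerivAt z).differentiableAt) (fun z _ => hC z) convex_univ (mem_univ x)
    (mem_univ 0)
  simpa [abs_of_pos hx] using! this

theorem integrableOn_blowupFunctional (hf : Tame f) :
    IntegrableOn (fun x => (f 0 - f x) / x * Real.exp (-x)) (Ioi 0) := by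
  obtain ⟨C, hC⟩ := hf.bdd_deriv
  have hi : IntegrableOn (fun x => Real.exp (-x)) (Ioi (0 : ℝ)) := integrableOn_exp_neg_Ioi 0
  refine hi.bdd_mul (c := C) ?_ ?_
  · exact ((measurable_const.sub hf.continuous.measurable).div measurable_id).aestronglyMeasurable
  · refine (ae_restrict_iff' measurableSet_Ioi).2 (ae_of_all _ fun x hx => ?_)
    rw [Real.norm_eq_abs, abs_div, abs_of_pos (mem_Ioi.1 hx), div_le_iff₀ (mem_Ioi.1 hx)]
    exact hf.abs_sub_zero_le hC hx

/-- Fubini and e^{-x}/x = ∫_1^∞ e^{-sx} ds. The exponential in the functional is chosen so that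
exactly the range s > 1, where the weighted inequality is free of error, appears. -/
theorem blowupFunctional_eq (hf : Tame f) :
    IntegrableOn (laplaceDefect f) (Ioi 1) ∧
      blowupFunctional f = ∫ s in Ioi (1 : ℝ), laplaceDefect f s := by
  have hexp : ∀ x : ℝ, 0 < x → ∫ s in Ioi (1 : ℝ), Real.exp (-s * x) = Real.exp (-x) / x := by
    intro x hx
    have := integral_exp_mul_Ioi (a := -x) (by linarith) 1
    simp only [neg_mul, mul_comm x, mul_one] at this ⊢
    rw [this]
    field_simp
  have hexpi : ∀ x : ℝ, 0 < x → IntegrableOn (fun s => Real.exp (-s * x)) (Ioi (1 : ℝ)) := by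
    intro x hx
    have := integrableOn_exp_mul_Ioi (a := -x) (by linarith) 1
    simpa only [neg_mul, mul_comm x] using this
  set F : ℝ → ℝ → ℝ := fun s x => Real.exp (-s * x) * (f 0 - f x) with hF
  have hFc : Continuous (Function.uncurry F) := by
    have := hf.continuous
    simp only [hF, Function.uncurry_def]
    fun_prop
  have hint : Integrable (Function.uncurry F)
      ((volume.restrict (Ioi (1 : ℝ))).prod (volume.restrict (Ioi (0 : ℝ)))) := by
    rw [integrable_prod_iff' hFc.aestronglyMeasurable]
    constructor
    · refine (ae_restrict_iff' measurableSet_Ioi).2 (ae_of_all _ fun x hx => ?_)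
      exact (hexpi x hx).mul_const (f 0 - f x)
    · refine (hf.integrableOn_blowupFunctional).norm.congr
        ((ae_restrict_iff' measurableSet_Ioi).2 (ae_of_all _ fun x hx => ?_))
      have hx0 : (0 : ℝ) < x := hx
      simp only [Function.uncurry_apply_pair, hF, norm_mul, Real.norm_eq_abs,
        abs_of_pos (Real.exp_pos _)]
      rw [integral_mul_const, hexp x hx, abs_div, abs_of_pos hx0]
      ring
  refine ⟨hint.integral_prod_left, ?_⟩
  have hsw := integral_integral_swap hint
  simp only [laplaceDefect]
  rw [hsw, blowupFunctional]
  refine setIntegral_congr_fun measurableSet_Ioi fun x hx => ?_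
  simp only [hF]
  rw [integral_mul_const, hexp x hx]
  ring

end Tame

end Weighted

/-! ### Fourier multipliers on the class `H³ ∩ W^{1,1}` -/

/-- The angular frequency. -/
def angFreq (ξ : ℝ) : ℝ := 2 * Real.pi * ξ

theorem continuous_angFreq : Continuous angFreq := by unfold angFreq; fun_prop

/-! ### The Fourier transform of real functions and of the flux. -/

section FourierBasics

variable {f g : ℝ → ℝ}

theorem fourier_def (f : ℝ → ℝ) (ξ : ℝ) :
    fourier f ξ = ∫ v : ℝ, Real.fourierChar (-(v * ξ)) • (f v : ℂ) :=
  Real.fourier_real_eq _ _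

theorem integrable_fourierChar_smul (hf : Integrable f) (ξ : ℝ) :
    Integrable (fun v : ℝ => Real.fourierChar (-(v * ξ)) • (f v : ℂ)) := by
  have := (Real.fourierIntegral_convergent_iff (μ := volume) (f := fun v => (f v : ℂ)) ξ).2
    hf.ofReal
  simpa [mul_comm] using this

theorem fourier_sub (hf : Integrable f) (hg : Integrable g) (ξ : ℝ) :
    fourier (fun x => f x - g x) ξ = fourier f ξ - fourier g ξ := by
  simp only [fourier_def]
  rw [← integral_sub (integrable_fourierChar_smul hf ξ) (integrable_fourierChar_smul hg ξ)]
  congr with v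
  rw [← smul_sub, Complex.ofReal_sub]

theorem fourier_const_mul (c : ℝ) (f : ℝ → ℝ) (ξ : ℝ) :
    fourier (fun x => c * f x) ξ = c * fourier f ξ := by
  simp only [fourier_def]
  rw [← integral_const_mul]
  congr with v
  rw [Complex.ofReal_mul, mul_smul_comm]

theorem norm_fourier_le (f : ℝ → ℝ) (ξ : ℝ) : ‖fourier f ξ‖ ≤ ∫ x, |f x| := by
  rw [fourier_def]
  refine (norm_integral_le_integral_norm _).trans_eq ?_
  congr with v
  rw [Circle.norm_smul, Complex.norm_real, Real.norm_eq_abs]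

theorem continuous_fourier (hf : Integrable f) : Continuous (fourier f) :=
  VectorFourier.fourierIntegral_continuous Real.continuous_fourierChar
    (by exact continuous_inner) hf.ofReal

theorem fourier_of_hasDerivAt {f' : ℝ → ℝ} (hd : ∀ x, HasDerivAt f (f' x) x) (hf : Integrable f)
    (hf' : Integrable f') (ξ : ℝ) :
    fourier f' ξ = Complex.I * (angFreq ξ : ℂ) * fourier f ξ := by
  have hdc : ∀ x, HasDerivAt (fun x => (f x : ℂ)) (f' x : ℂ) x := fun x => (hd x).ofReal_comp
  have e : deriv (fun x => (f x : ℂ)) = fun x => (f' x : ℂ) := funext fun x => (hdc x).deriv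
  have := Real.fourier_deriv (f := fun x => (f x : ℂ)) hf.ofReal
    (fun x => (hdc x).differentiableAt) (by rw [e]; exact hf'.ofReal)
  rw [e] at this
  rw [fourier, this, fourier, angFreq]
  simp only [smul_eq_mul]
  push_cast
  ring

theorem fourier_comp_neg (f : ℝ → ℝ) (ξ : ℝ) : fourier (fun x => f (-x)) ξ = fourier f (-ξ) := by
  simp only [fourier_def]
  rw [← integral_neg_eq_self]
  simp

/-- Transforming the two relations p' = h and h' = s² p - f gives a linear system whose solution is
the symbol; the exponential kernel is never transformed. -/
theorem fourier_flux {s : ℝ} (hs : 0 < s) (hf : Continuous f) (hfi : Integrable f) (ξ : ℝ) :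
    fourier (flux s f) ξ =
      Complex.I * ((angFreq ξ / (s ^ 2 + angFreq ξ ^ 2) : ℝ) : ℂ) * fourier f ξ := by
  have ip := integrable_pot hs hfi
  have ifl := integrable_flux hs hfi
  have h1 := fourier_of_hasDerivAt (hasDerivAt_pot hs hf hfi) ip ifl ξ
  have h2 := fourier_of_hasDerivAt (hasDerivAt_flux hs hf hfi) ifl
    ((ip.const_mul (s ^ 2)).sub hfi) ξ
  rw [fourier_sub (ip.const_mul (s ^ 2)) hfi, fourier_const_mul, h1] at h2
  have hpos : (0 : ℝ) < s ^ 2 + angFreq ξ ^ 2 := by positivity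
  have hne : ((s : ℂ) ^ 2 + (angFreq ξ : ℂ) ^ 2) ≠ 0 := by
    exact_mod_cast hpos.ne'
  have h3 : ((s : ℂ) ^ 2 + (angFreq ξ : ℂ) ^ 2) * fourier (pot s f) ξ = fourier f ξ := by
    push_cast at h2
    linear_combination h2 + (angFreq ξ : ℂ) ^ 2 * fourier (pot s f) ξ * Complex.I_sq
  rw [h1, ← h3]
  push_cast
  field_simp

end FourierBasics

/-- The real part of the Fourier multiplier with symbol `σ`. -/
def mult (σ : ℝ → ℂ) (f : ℝ → ℝ) (x : ℝ) : ℝ := (𝓕⁻ (fun ξ => σ ξ * fourier f ξ) x).re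

theorem drift_eq_mult (α : ℝ) (f : ℝ → ℝ) :
    drift α f = mult (fun ξ => Complex.I * ((|angFreq ξ| ^ (-α) * angFreq ξ : ℝ) : ℂ)) f := rfl

theorem norm_fourierInv_le (g : ℝ → ℂ) (x : ℝ) : ‖𝓕⁻ g x‖ ≤ ∫ ξ, ‖g ξ‖ := by
  rw [Real.fourierInv_eq]
  refine (norm_integral_le_integral_norm _).trans_eq ?_
  simp [Circle.norm_smul]

theorem hasDerivAt_fourierInv {g : ℝ → ℂ} (hg : Integrable g)
    (hg' : Integrable (fun ξ : ℝ => Complex.I * (angFreq ξ : ℂ) * g ξ)) (x : ℝ) :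
    HasDerivAt (𝓕⁻ g) (𝓕⁻ (fun ξ : ℝ => Complex.I * (angFreq ξ : ℂ) * g ξ) x) x := by
  have h1 : Integrable (fun ξ : ℝ => ξ • g ξ) := by
    have := hg'.const_mul (Complex.I * (2 * Real.pi))⁻¹
    refine this.congr (ae_of_all _ fun ξ => ?_)
    have hpi : (Real.pi : ℂ) ≠ 0 := by exact_mod_cast Real.pi_ne_zero
    have hI := Complex.I_ne_zero
    simp only [angFreq, Complex.real_smul]
    push_cast
    field_simp
  have h2 := Real.hasDerivAt_fourier hg h1 (-x)
  have h3 := HasDerivAt.scomp x h2 (hasDerivAt_neg x)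
  have e : 𝓕⁻ g = fun x => 𝓕 g (-x) := funext fun x => Real.fourierInv_eq_fourier_neg g x
  rw [e, Real.fourierInv_eq_fourier_neg]
  refine h3.congr_deriv ?_
  rw [neg_smul, one_smul, Real.fourier_real_eq, Real.fourier_real_eq, ← integral_neg]
  congr with v
  rw [← smul_neg]
  congr 1
  simp only [angFreq, smul_eq_mul]
  push_cast
  ring

/-- The size of `f` in `H³ ∩ W^{1,1}`. -/
def cnorm (f : ℝ → ℝ) : ℝ := (classNorm f).toReal

theorem cnorm_nonneg (f : ℝ → ℝ) : 0 ≤ cnorm f := ENNReal.toReal_nonneg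

theorem toReal_eLpNorm_one {f : ℝ → ℝ} (hf : Integrable f) :
    (eLpNorm f 1 volume).toReal = ∫ x, |f x| := by
  rw [eLpNorm_one_eq_lintegral_enorm, ← integral_norm_eq_lintegral_enorm hf.aestronglyMeasurable]
  rfl

namespace MemClass

variable {f g : ℝ → ℝ}

theorem eLpNorm_ne_top (hf : MemClass f) : eLpNorm f 1 volume ≠ ∞ :=
  (memLp_one_iff_integrable.2 hf.integrable).2.ne

theorem eLpNorm_deriv_ne_top (hf : MemClass f) : eLpNorm (deriv f) 1 volume ≠ ∞ :=
  (memLp_one_iff_integrable.2 hf.integrable_deriv).2.ne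

theorem cnorm_eq (hf : MemClass f) :
    cnorm f = (∫ x, |f x|) + (∫ x, |deriv f x|) + (sobolevNorm f).toReal := by
  rw [cnorm, classNorm, ENNReal.toReal_add (ENNReal.add_ne_top.2
    ⟨hf.eLpNorm_ne_top, hf.eLpNorm_deriv_ne_top⟩) hf.sobolev.ne,
    ENNReal.toReal_add hf.eLpNorm_ne_top hf.eLpNorm_deriv_ne_top,
    toReal_eLpNorm_one hf.integrable, toReal_eLpNorm_one hf.integrable_deriv]

theorem integral_abs_le (hf : MemClass f) : ∫ x, |f x| ≤ cnorm f := by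
  rw [hf.cnorm_eq]
  have h1 : 0 ≤ ∫ x, |deriv f x| := integral_nonneg fun x => abs_nonneg _
  have h2 : 0 ≤ (sobolevNorm f).toReal := ENNReal.toReal_nonneg
  linarith

theorem integral_abs_deriv_le (hf : MemClass f) : ∫ x, |deriv f x| ≤ cnorm f := by
  rw [hf.cnorm_eq]
  have h1 : 0 ≤ ∫ x, |f x| := integral_nonneg fun x => abs_nonneg _
  have h2 : 0 ≤ (sobolevNorm f).toReal := ENNReal.toReal_nonneg
  linarith

theorem sobolevNorm_le (hf : MemClass f) : (sobolevNorm f).toReal ≤ cnorm f := by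
  rw [hf.cnorm_eq]
  have h1 : 0 ≤ ∫ x, |f x| := integral_nonneg fun x => abs_nonneg _
  have h2 : 0 ≤ ∫ x, |deriv f x| := integral_nonneg fun x => abs_nonneg _
  linarith

theorem differentiable (hf : MemClass f) : Differentiable ℝ f :=
  hf.contDiff.differentiable one_ne_zero

theorem continuous_deriv (hf : MemClass f) : Continuous (deriv f) :=
  hf.contDiff.continuous_deriv le_rfl

theorem deriv_sub_apply (hf : MemClass f) (hg : MemClass g) (x : ℝ) :
    deriv (fun x => f x - g x) x = deriv f x - deriv g x :=
  deriv_fun_sub (hf.differentiable x) (hg.differentiable x)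

theorem sobolev_measurable (hf : MemClass f) : AEStronglyMeasurable
    (fun ξ : ℝ => (((1 + (2 * Real.pi * ξ) ^ 2) ^ (3 / 2 : ℝ) : ℝ) : ℂ) * fourier f ξ) := by
  have h := continuous_fourier hf.integrable
  have h2 : Continuous fun ξ : ℝ => (1 + (2 * Real.pi * ξ) ^ 2) ^ (3 / 2 : ℝ) :=
    Continuous.rpow_const (by fun_prop) fun ξ => Or.inl (by positivity)
  exact (Continuous.mul (by fun_prop) h).aestronglyMeasurable

theorem sub (hf : MemClass f) (hg : MemClass g) : MemClass (fun x => f x - g x) where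
  contDiff := hf.contDiff.sub hg.contDiff
  integrable := hf.integrable.sub hg.integrable
  integrable_deriv := by
    rw [funext (hf.deriv_sub_apply hg)]
    exact hf.integrable_deriv.sub hg.integrable_deriv
  sobolev := by
    refine lt_of_le_of_lt ?_ (ENNReal.add_lt_top.2 ⟨hf.sobolev, hg.sobolev⟩)
    refine le_trans (le_of_eq ?_) (eLpNorm_sub_le hf.sobolev_measurable hg.sobolev_measurable
      one_le_two)
    rw [sobolevNorm]
    congr 1
    ext ξ
    rw [fourier_sub hf.integrable hg.integrable, Pi.sub_apply, mul_sub]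

theorem comp_neg (hf : MemClass f) : MemClass (fun x => f (-x)) where
  contDiff := hf.contDiff.comp contDiff_neg
  integrable := hf.integrable.comp_neg
  integrable_deriv := by
    rw [funext fun x => deriv_comp_neg f x]
    exact hf.integrable_deriv.comp_neg.neg
  sobolev := by
    have h := hf.sobolev
    have e := eLpNorm_comp_measurePreserving (p := 2) hf.sobolev_measurable
      (Measure.measurePreserving_neg volume)
    rw [sobolevNorm] at h ⊢
    rw [← e] at h
    convert h using 3 with ξ
    simp [fourier_comp_neg]

end MemClass

theorem classNorm_comp_neg {f : ℝ → ℝ} (hf : MemClass f) :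
    classNorm (fun x => f (-x)) = classNorm f := by
  have hmp := Measure.measurePreserving_neg (volume : Measure ℝ)
  have e1 := eLpNorm_comp_measurePreserving (p := 1) hf.integrable.aestronglyMeasurable hmp
  have e2 := eLpNorm_comp_measurePreserving (p := 1) hf.integrable_deriv.aestronglyMeasurable hmp
  have e3 := eLpNorm_comp_measurePreserving (p := 2) hf.sobolev_measurable hmp
  rw [classNorm, classNorm, ← e1, ← e2, sobolevNorm, sobolevNorm, ← e3]
  congr 2
  · rw [← eLpNorm_neg]
    congr 1
    ext x
    simp [deriv_comp_neg]
  · ext ξ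
    simp [fourier_comp_neg]

/-- A weight that dominates all the symbols in use. -/
def symbolWeight (α ξ : ℝ) : ℝ := |angFreq ξ| ^ (1 - α) + 1 + angFreq ξ ^ 2

theorem symbolWeight_nonneg (α ξ : ℝ) : 0 ≤ symbolWeight α ξ := by
  unfold symbolWeight; positivity

theorem measurable_symbolWeight (α : ℝ) : Measurable (symbolWeight α) := by
  have := continuous_angFreq.measurable
  unfold symbolWeight
  fun_prop

theorem integrable_indicator_abs_rpow {r : ℝ} (hr : -1 < r) :
    Integrable ((Ioo (-1 : ℝ) 1).indicator fun x => |x| ^ r) := by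
  have h1 : IntervalIntegrable (fun x : ℝ => x ^ r) volume 0 1 :=
    intervalIntegral.intervalIntegrable_rpow' hr
  rw [intervalIntegrable_iff_integrableOn_Ioo_of_le zero_le_one] at h1
  have h2 : IntegrableOn (fun x : ℝ => |x| ^ r) (Ioo 0 1) :=
    h1.congr_fun (fun x hx => by simp [abs_of_pos hx.1]) measurableSet_Ioo
  have h3 : IntegrableOn (fun x : ℝ => |x| ^ r) (Ioo (-1) 0) := by
    have := (((integrable_indicator_iff measurableSet_Ioo).2 h2).comp_neg)
    rw [← integrable_indicator_iff measurableSet_Ioo]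
    refine this.congr (ae_of_all _ fun x => ?_)
    simp only [indicator, mem_Ioo, abs_neg]
    congr 1
    apply propext
    constructor <;> rintro ⟨h, h'⟩ <;> constructor <;> linarith
  have h4 : IntegrableOn (fun x : ℝ => |x| ^ r) (Ioo (-1) 0 ∪ {0} ∪ Ioo 0 1) :=
    (h3.union (by simp)).union h2
  rw [integrable_indicator_iff measurableSet_Ioo]
  refine h4.mono_set fun x hx => ?_
  rcases lt_trichotomy x 0 with h | h | h
  · exact Or.inl (Or.inl ⟨hx.1, h⟩)
  · exact Or.inl (Or.inr h)
  · exact Or.inr ⟨h, hx.2⟩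

theorem integrable_indicator_abs_angFreq_rpow {r : ℝ} (hr : -1 < r) :
    Integrable (fun ξ => (Ioo (-1 : ℝ) 1).indicator (fun x => |x| ^ r) (angFreq ξ)) :=
  (integrable_indicator_abs_rpow hr).comp_mul_left' (by positivity)

theorem symbolWeight_le {α : ℝ} (hα : 0 < α) (ξ : ℝ) : symbolWeight α ξ ≤
    (Ioo (-1 : ℝ) 1).indicator (fun x => |x| ^ (1 - α)) (angFreq ξ) + 2 * (1 + angFreq ξ ^ 2) := by
  unfold symbolWeight
  by_cases h : angFreq ξ ∈ Ioo (-1 : ℝ) 1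
  -- Only for |k| < 1 can the power 1 - α be singular; for |k| ≥ 1 it is at most |k|, because α > 0.
  · rw [indicator_of_mem h]
    nlinarith [sq_nonneg (angFreq ξ)]
  · rw [indicator_of_notMem h]
    have h1 : 1 ≤ |angFreq ξ| := by
      by_contra hc
      exact h (abs_lt.1 (not_le.1 hc))
    have h2 : |angFreq ξ| ^ (1 - α) ≤ |angFreq ξ| ^ (1 : ℝ) :=
      Real.rpow_le_rpow_of_exponent_le h1 (by linarith)
    rw [Real.rpow_one] at h2
    nlinarith [sq_abs (angFreq ξ)]

/-- The basic estimate of the class on the Fourier side. -/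
theorem exists_integral_symbolWeight_le {α : ℝ} (hα0 : 0 < α) (hα2 : α < 2) :
    ∃ C : ℝ, 0 < C ∧ ∀ f, MemClass f →
      Integrable (fun ξ => symbolWeight α ξ * ‖fourier f ξ‖) ∧
        ∫ ξ, symbolWeight α ξ * ‖fourier f ξ‖ ≤ C * cnorm f := by
  -- The factorization 1 + k² = (1 + k²)^{-1/2} (1 + k²)^{3/2}: the first factor is in L², the
  -- second is absorbed by the H³ norm.
  set φ : ℝ → ℝ := fun ξ => (1 + (2 * Real.pi * ξ) ^ 2) ^ (-(1 / 2) : ℝ) with hφ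
  have hφc : Continuous φ :=
    Continuous.rpow_const (by fun_prop) fun ξ => Or.inl (by positivity)
  have hφ2 : MemLp φ 2 := by
    rw [memLp_two_iff_integrable_sq hφc.aestronglyMeasurable]
    have := integrable_inv_one_add_sq.comp_mul_left' (R := 2 * Real.pi) (by positivity)
    refine this.congr (ae_of_all _ fun ξ => ?_)
    simp only [hφ]
    rw [sq (_ ^ _), ← Real.rpow_add (by positivity)]
    norm_num [Real.rpow_neg_one]
  set K := (eLpNorm φ 2 volume).toReal with hK
  -- At low frequency the transform is bounded by the L¹ norm, and |k|^{1-α} is integrable near 0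
  -- exactly because α < 2.
  have hi1 := integrable_indicator_abs_angFreq_rpow (r := 1 - α) (by linarith)
  set L := ∫ ξ, (Ioo (-1 : ℝ) 1).indicator (fun x => |x| ^ (1 - α)) (angFreq ξ) with hL
  have hL0 : 0 ≤ L := integral_nonneg fun ξ => indicator_nonneg (fun x _ => by positivity) _
  have hK0 : 0 ≤ K := ENNReal.toReal_nonneg
  refine ⟨L + 2 * K + 1, by linarith, fun f hf => ?_⟩
  set G : ℝ → ℂ := fun ξ => (((1 + (2 * Real.pi * ξ) ^ 2) ^ (3 / 2 : ℝ) : ℝ) : ℂ) * fourier f ξ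
    with hG
  have hG2 : MemLp G 2 := ⟨hf.sobolev_measurable, hf.sobolev⟩
  have hprod : ∀ ξ, ‖φ ξ • G ξ‖ = (1 + angFreq ξ ^ 2) * ‖fourier f ξ‖ := by
    intro ξ
    simp only [hφ, hG, norm_smul, norm_mul, Complex.norm_real, Real.norm_eq_abs]
    rw [abs_of_pos (by positivity), abs_of_pos (by positivity), ← mul_assoc,
      ← Real.rpow_add (by positivity)]
    norm_num [angFreq]
  have hm : MemLp (φ • G) 1 := hG2.smul hφ2
  have hm1 : Integrable (fun ξ => (1 + angFreq ξ ^ 2) * ‖fourier f ξ‖) := by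
    have := (memLp_one_iff_integrable.1 hm).norm
    refine this.congr (ae_of_all _ fun ξ => hprod ξ)
  have hm2 : ∫ ξ, (1 + angFreq ξ ^ 2) * ‖fourier f ξ‖ ≤ K * cnorm f := by
    have h1 : eLpNorm (φ • G) 1 volume ≤ eLpNorm φ 2 volume * eLpNorm G 2 volume :=
      eLpNorm_smul_le_mul_eLpNorm hG2.1 hφ2.1
    have h2 := ENNReal.toReal_mono (ENNReal.mul_ne_top hφ2.2.ne hG2.2.ne) h1
    rw [ENNReal.toReal_mul, eLpNorm_one_eq_lintegral_enorm,
      ← integral_norm_eq_lintegral_enorm hm.1] at h2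
    calc _ = ∫ ξ, ‖(φ • G) ξ‖ := by
          congr with ξ
          exact (hprod ξ).symm
      _ ≤ K * (eLpNorm G 2 volume).toReal := h2
      _ ≤ K * cnorm f := mul_le_mul_of_nonneg_left hf.sobolevNorm_le hK0
  have hfc := continuous_fourier hf.integrable
  have hi2 := hi1.mul_const (cnorm f)
  have hi3 := hi2.add (hm1.const_mul 2)
  have hle : ∀ ξ, symbolWeight α ξ * ‖fourier f ξ‖ ≤
      (Ioo (-1 : ℝ) 1).indicator (fun x => |x| ^ (1 - α)) (angFreq ξ) * cnorm f +
        2 * ((1 + angFreq ξ ^ 2) * ‖fourier f ξ‖) := by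
    intro ξ
    have h1 := mul_le_mul_of_nonneg_right (symbolWeight_le hα0 ξ) (norm_nonneg (fourier f ξ))
    have h2 : ‖fourier f ξ‖ ≤ cnorm f := (norm_fourier_le f ξ).trans hf.integral_abs_le
    have h3 : 0 ≤ (Ioo (-1 : ℝ) 1).indicator (fun x => |x| ^ (1 - α)) (angFreq ξ) :=
      indicator_nonneg (fun x _ => by positivity) _
    have h4 := mul_le_mul_of_nonneg_left h2 h3
    linarith
  have hint : Integrable (fun ξ => symbolWeight α ξ * ‖fourier f ξ‖) := by
    refine hi3.mono' ((measurable_symbolWeight α).mul hfc.norm.measurable).aestronglyMeasurable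
      (ae_of_all _ fun ξ => ?_)
    rw [Real.norm_eq_abs, abs_of_nonneg (mul_nonneg (symbolWeight_nonneg _ _) (norm_nonneg _))]
    exact hle ξ
  refine ⟨hint, ?_⟩
  calc _ ≤ _ := integral_mono hint hi3 hle
    _ = L * cnorm f + 2 * ∫ ξ, (1 + angFreq ξ ^ 2) * ‖fourier f ξ‖ := by
        rw [integral_add' hi2 (hm1.const_mul 2), integral_mul_const, integral_const_mul]
    _ ≤ _ := by nlinarith [cnorm_nonneg f]

/-! ### Pointwise estimates for the class -/

section Mult

variable {α : ℝ} {σ : ℝ → ℂ} {f g : ℝ → ℝ}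

theorem MemClass.integrable_mult (hα0 : 0 < α) (hα2 : α < 2) (hf : MemClass f)
    (hσm : Measurable σ) (hσ : ∀ ξ, ‖σ ξ‖ ≤ symbolWeight α ξ) :
    Integrable (fun ξ => σ ξ * fourier f ξ) := by
  obtain ⟨C, -, hC⟩ := exists_integral_symbolWeight_le hα0 hα2
  refine (hC f hf).1.mono'
    (hσm.mul (continuous_fourier hf.integrable).measurable).aestronglyMeasurable
    (ae_of_all _ fun ξ => ?_)
  rw [norm_mul]
  exact mul_le_mul_of_nonneg_right (hσ ξ) (norm_nonneg _)

/-- The constant does not depend on the symbol, so one estimate serves f, its first two derivatives,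
the drift and the derivative of the drift. -/
theorem exists_abs_mult_le (hα0 : 0 < α) (hα2 : α < 2) :
    ∃ C : ℝ, 0 < C ∧ ∀ (σ : ℝ → ℂ), Measurable σ → (∀ ξ, ‖σ ξ‖ ≤ symbolWeight α ξ) →
      ∀ f, MemClass f → ∀ x, |mult σ f x| ≤ C * cnorm f := by
  obtain ⟨C, hC0, hC⟩ := exists_integral_symbolWeight_le hα0 hα2
  refine ⟨C, hC0, fun σ hσm hσ f hf x => ?_⟩
  calc |mult σ f x| ≤ ‖𝓕⁻ (fun ξ => σ ξ * fourier f ξ) x‖ := Complex.abs_re_le_norm _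
    _ ≤ ∫ ξ, ‖σ ξ * fourier f ξ‖ := norm_fourierInv_le _ _
    _ ≤ ∫ ξ, symbolWeight α ξ * ‖fourier f ξ‖ := by
        refine integral_mono (hf.integrable_mult hα0 hα2 hσm hσ).norm (hC f hf).1 fun ξ => ?_
        simp only [norm_mul]
        exact mul_le_mul_of_nonneg_right (hσ ξ) (norm_nonneg _)
    _ ≤ _ := (hC f hf).2

theorem mult_sub (hα0 : 0 < α) (hα2 : α < 2) (hσm : Measurable σ)
    (hσ : ∀ ξ, ‖σ ξ‖ ≤ symbolWeight α ξ) (hf : MemClass f) (hg : MemClass g) (x : ℝ) :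
    mult σ (fun x => f x - g x) x = mult σ f x - mult σ g x := by
  have i1 := hf.integrable_mult hα0 hα2 hσm hσ
  have i2 := hg.integrable_mult hα0 hα2 hσm hσ
  have key : ∀ {u : ℝ → ℂ}, Integrable u → Integrable (fun v : ℝ => Real.fourierChar (v * x) • u v) := by
    intro u hu
    have := (Real.fourierIntegral_convergent_iff (μ := volume) (f := u) (-x)).2 hu
    simpa [mul_comm] using this
  simp only [mult, Real.fourierInv_eq_fourier_neg, Real.fourier_real_eq, mul_neg, neg_neg]
  rw [← Complex.sub_re, ← integral_sub (key i1) (key i2)]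
  congr 2
  ext ξ
  rw [fourier_sub hf.integrable hg.integrable, mul_sub, smul_sub]

theorem hasDerivAt_mult (hα0 : 0 < α) (hα2 : α < 2) (hσm : Measurable σ)
    (hσ : ∀ ξ, ‖σ ξ‖ ≤ symbolWeight α ξ)
    (hσ' : ∀ ξ, ‖Complex.I * (angFreq ξ : ℂ) * σ ξ‖ ≤ symbolWeight α ξ) (hf : MemClass f) (x : ℝ) :
    HasDerivAt (mult σ f) (mult (fun ξ => Complex.I * (angFreq ξ : ℂ) * σ ξ) f x) x := by
  have hm : Measurable (fun ξ => Complex.I * (angFreq ξ : ℂ) * σ ξ) :=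
    ((Complex.measurable_ofReal.comp continuous_angFreq.measurable).const_mul _).mul hσm
  have i2 := hf.integrable_mult hα0 hα2 hm hσ'
  simp only [mul_assoc] at i2
  have h := hasDerivAt_fourierInv (hf.integrable_mult hα0 hα2 hσm hσ)
    (by simpa only [mul_assoc] using i2) x
  simp only [mult]
  have h2 := Complex.reCLM.hasFDerivAt.comp_hasDerivAt x h
  refine h2.congr_deriv ?_
  simp [mul_assoc]

theorem continuous_mult (hα0 : 0 < α) (hα2 : α < 2) (hσm : Measurable σ)
    (hσ : ∀ ξ, ‖σ ξ‖ ≤ symbolWeight α ξ) (hf : MemClass f) : Continuous (mult σ f) := by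
  have i := hf.integrable_mult hα0 hα2 hσm hσ
  have : Continuous (𝓕⁻ (fun ξ => σ ξ * fourier f ξ)) := by
    have h : Continuous (𝓕 (fun ξ => σ ξ * fourier f ξ)) :=
      VectorFourier.fourierIntegral_continuous Real.continuous_fourierChar
        (by exact continuous_inner) i
    rw [funext (Real.fourierInv_eq_fourier_neg _)]
    exact h.comp continuous_neg
  exact Complex.continuous_re.comp this

theorem MemClass.integrable_fourier (hf : MemClass f) : Integrable (fourier f) := by
  have := hf.integrable_mult (α := 1) one_pos one_lt_two (σ := fun _ => 1) measurable_const
    (fun ξ => by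
      unfold symbolWeight
      have : 0 ≤ |angFreq ξ| ^ (1 - (1 : ℝ)) := by positivity
      rw [norm_one]
      nlinarith [sq_nonneg (angFreq ξ)])
  simpa using this

theorem eq_re_fourierInv_fourier (hf : Continuous f) (hfi : Integrable f)
    (hi : Integrable (fourier f)) (x : ℝ) : f x = (𝓕⁻ (fourier f) x).re := by
  have h := Continuous.fourierInv_fourier_eq (f := fun x => (f x : ℂ)) (by fun_prop) hfi.ofReal hi
  have := congrFun h x
  rw [fourier, this, Complex.ofReal_re]

theorem MemClass.eq_mult_one (hf : MemClass f) : f = mult (fun _ => 1) f := by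
  funext x
  simp only [mult, one_mul]
  exact eq_re_fourierInv_fourier hf.contDiff.continuous hf.integrable hf.integrable_fourier x

end Mult

/-! ### The symbols in use and the resulting bounds and regularity. -/

section Symbols

variable {α : ℝ}

/-- The symbol of the drift. -/
def driftSymbol (α ξ : ℝ) : ℂ := Complex.I * ((|angFreq ξ| ^ (-α) * angFreq ξ : ℝ) : ℂ)

theorem measurable_driftSymbol (α : ℝ) : Measurable (driftSymbol α) := by
  have h := continuous_angFreq.measurable
  unfold driftSymbol
  exact (Complex.measurable_ofReal.comp ((h.abs.pow_const (-α)).mul h)).const_mul _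

theorem norm_driftSymbol (ξ : ℝ) : ‖driftSymbol α ξ‖ ≤ |angFreq ξ| ^ (1 - α) := by
  rw [driftSymbol, norm_mul, Complex.norm_I, one_mul, Complex.norm_real, Real.norm_eq_abs, abs_mul,
    abs_of_nonneg (by positivity : 0 ≤ |angFreq ξ| ^ (-α))]
  rcases (abs_nonneg (angFreq ξ)).eq_or_lt with h | h
  · rw [← h, mul_zero]
    positivity
  · rw [sub_eq_add_neg, add_comm, Real.rpow_add h, Real.rpow_one]

theorem norm_driftSymbol_le (ξ : ℝ) : ‖driftSymbol α ξ‖ ≤ symbolWeight α ξ := by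
  have := norm_driftSymbol (α := α) ξ
  unfold symbolWeight
  nlinarith [sq_nonneg (angFreq ξ)]

theorem norm_freq_mul (ξ : ℝ) (z : ℂ) : ‖Complex.I * (angFreq ξ : ℂ) * z‖ = |angFreq ξ| * ‖z‖ := by
  rw [norm_mul, norm_mul, Complex.norm_I, one_mul, Complex.norm_real, Real.norm_eq_abs]

/-- The product has size at most |k|^{2-α}, which is bounded for |k| ≤ 1 since α < 2 and is at most
k² for |k| ≥ 1 since α > 0. -/
theorem norm_freq_mul_driftSymbol_le (hα0 : 0 < α) (hα : α < 2) (ξ : ℝ) :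
    ‖Complex.I * (angFreq ξ : ℂ) * driftSymbol α ξ‖ ≤ symbolWeight α ξ := by
  rw [norm_freq_mul]
  have h1 := norm_driftSymbol (α := α) ξ
  have h0 := abs_nonneg (angFreq ξ)
  have h2 : |angFreq ξ| * |angFreq ξ| ^ (1 - α) ≤ 1 + angFreq ξ ^ 2 := by
    rcases le_total |angFreq ξ| 1 with h | h
    · rcases h0.eq_or_lt with h' | h'
      · rw [← h', zero_mul]; positivity
      · have e : |angFreq ξ| * |angFreq ξ| ^ (1 - α) = |angFreq ξ| ^ (2 - α) := by
          nth_rw 1 [← Real.rpow_one |angFreq ξ|]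
          rw [← Real.rpow_add h']
          congr 1
          ring
        rw [e]
        have := Real.rpow_le_one h0 h (by linarith : 0 ≤ 2 - α)
        nlinarith [sq_nonneg (angFreq ξ)]
    · have : |angFreq ξ| ^ (1 - α) ≤ |angFreq ξ| ^ (1 : ℝ) :=
        Real.rpow_le_rpow_of_exponent_le h (by linarith)
      rw [Real.rpow_one] at this
      nlinarith [sq_abs (angFreq ξ)]
  have h3 : 0 ≤ |angFreq ξ| ^ (1 - α) := by positivity
  have h4 := mul_le_mul_of_nonneg_left h1 h0
  unfold symbolWeight
  linarith

theorem norm_one_le_symbolWeight (α ξ : ℝ) : ‖(1 : ℂ)‖ ≤ symbolWeight α ξ := by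
  unfold symbolWeight
  have : 0 ≤ |angFreq ξ| ^ (1 - α) := by positivity
  rw [norm_one]
  nlinarith [sq_nonneg (angFreq ξ)]

theorem norm_freq_le_symbolWeight (α ξ : ℝ) :
    ‖Complex.I * (angFreq ξ : ℂ) * 1‖ ≤ symbolWeight α ξ := by
  rw [norm_freq_mul, norm_one]
  unfold symbolWeight
  have : 0 ≤ |angFreq ξ| ^ (1 - α) := by positivity
  nlinarith [sq_abs (angFreq ξ), sq_nonneg (|angFreq ξ| - 1)]

theorem norm_freq_sq_le_symbolWeight (α ξ : ℝ) :
    ‖Complex.I * (angFreq ξ : ℂ) * (Complex.I * (angFreq ξ : ℂ) * 1)‖ ≤ symbolWeight α ξ := by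
  rw [norm_freq_mul, norm_freq_mul, norm_one, mul_one, ← sq, sq_abs]
  unfold symbolWeight
  have : 0 ≤ |angFreq ξ| ^ (1 - α) := by positivity
  linarith

theorem measurable_freq {σ : ℝ → ℂ} (hσ : Measurable σ) :
    Measurable (fun ξ => Complex.I * (angFreq ξ : ℂ) * σ ξ) :=
  ((Complex.measurable_ofReal.comp continuous_angFreq.measurable).const_mul _).mul hσ

variable {f g : ℝ → ℝ}

theorem MemClass.deriv_eq_mult (hf : MemClass f) :
    deriv f = mult (fun ξ => Complex.I * (angFreq ξ : ℂ) * 1) f := by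
  funext x
  have := hasDerivAt_mult (α := 1) one_pos one_lt_two (measurable_const (a := (1 : ℂ)))
    (norm_one_le_symbolWeight 1) (norm_freq_le_symbolWeight 1) hf x
  rw [← hf.eq_mult_one] at this
  exact this.deriv

/-- The H³ norm makes k² times the transform integrable, so the functions of the class have a second
derivative although only C¹ is demanded. -/
theorem MemClass.hasDerivAt_deriv (hf : MemClass f) (x : ℝ) :
    HasDerivAt (deriv f) (deriv (deriv f) x) x ∧ deriv (deriv f) x =
      mult (fun ξ => Complex.I * (angFreq ξ : ℂ) * (Complex.I * (angFreq ξ : ℂ) * 1)) f x := by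
  have := hasDerivAt_mult (α := 1) one_pos one_lt_two (measurable_freq measurable_const)
    (norm_freq_le_symbolWeight 1) (norm_freq_sq_le_symbolWeight 1) hf x
  rw [← hf.deriv_eq_mult] at this
  exact ⟨this.differentiableAt.hasDerivAt, this.deriv⟩

theorem MemClass.continuous_deriv_deriv (hf : MemClass f) : Continuous (deriv (deriv f)) := by
  rw [funext fun x => (hf.hasDerivAt_deriv x).2]
  exact continuous_mult (α := 1) one_pos one_lt_two (measurable_freq (measurable_freq
    measurable_const)) (norm_freq_sq_le_symbolWeight 1) hf

theorem MemClass.differentiable_drift (hα0 : 0 < α) (hα2 : α < 2) (hf : MemClass f) :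
    Differentiable ℝ (drift α f) := fun x =>
  (hasDerivAt_mult hα0 hα2 (measurable_driftSymbol α) norm_driftSymbol_le
    (norm_freq_mul_driftSymbol_le hα0 hα2) hf x).differentiableAt

theorem MemClass.deriv_drift (hα0 : 0 < α) (hα2 : α < 2) (hf : MemClass f) :
    deriv (drift α f) = mult (fun ξ => Complex.I * (angFreq ξ : ℂ) * driftSymbol α ξ) f :=
  funext fun x => (hasDerivAt_mult hα0 hα2 (measurable_driftSymbol α) norm_driftSymbol_le
    (norm_freq_mul_driftSymbol_le hα0 hα2) hf x).deriv

theorem MemClass.continuous_deriv_drift (hα0 : 0 < α) (hα2 : α < 2) (hf : MemClass f) :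
    Continuous (deriv (drift α f)) := by
  rw [hf.deriv_drift hα0 hα2]
  exact continuous_mult hα0 hα2 (measurable_freq (measurable_driftSymbol α))
    (norm_freq_mul_driftSymbol_le hα0 hα2) hf

theorem drift_sub (hα0 : 0 < α) (hα2 : α < 2) (hf : MemClass f) (hg : MemClass g) (x : ℝ) :
    drift α (fun x => f x - g x) x = drift α f x - drift α g x :=
  mult_sub hα0 hα2 (measurable_driftSymbol α) norm_driftSymbol_le hf hg x

/-- The pointwise bounds available in the class. -/
structure PointwiseBounds (α B : ℝ) (f : ℝ → ℝ) : Prop where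
  abs_le : ∀ x, |f x| ≤ B
  integral_abs_le : ∫ x, |f x| ≤ B
  integral_abs_deriv_le : ∫ x, |deriv f x| ≤ B
  abs_deriv_le : ∀ x, |deriv f x| ≤ B
  abs_deriv_deriv_le : ∀ x, |deriv (deriv f) x| ≤ B
  abs_drift_le : ∀ x, |drift α f x| ≤ B
  abs_deriv_drift_le : ∀ x, |deriv (drift α f) x| ≤ B

theorem exists_pointwiseBounds (hα0 : 0 < α) (hα2 : α < 2) :
    ∃ C : ℝ, 0 < C ∧ ∀ f, MemClass f → PointwiseBounds α (C * cnorm f) f := by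
  obtain ⟨C, hC0, hC⟩ := exists_abs_mult_le hα0 hα2
  have hle : ∀ f, C * cnorm f ≤ (C + 1) * cnorm f := fun f => by nlinarith [cnorm_nonneg f]
  have hle1 : ∀ f, cnorm f ≤ (C + 1) * cnorm f := fun f => by nlinarith [cnorm_nonneg f]
  refine ⟨C + 1, by linarith, fun f hf => ⟨?_, ?_, ?_, ?_, ?_, ?_, ?_⟩⟩
  · intro x
    rw [hf.eq_mult_one, ← hf.eq_mult_one]
    have := hC (fun _ => 1) measurable_const (norm_one_le_symbolWeight α) f hf x
    rw [← hf.eq_mult_one] at this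
    exact this.trans (hle f)
  · exact hf.integral_abs_le.trans (hle1 f)
  · exact hf.integral_abs_deriv_le.trans (hle1 f)
  · intro x
    rw [hf.deriv_eq_mult]
    exact (hC _ (measurable_freq measurable_const) (norm_freq_le_symbolWeight α) f hf x).trans
      (hle f)
  · intro x
    rw [(hf.hasDerivAt_deriv x).2]
    exact (hC _ (measurable_freq (measurable_freq measurable_const))
      (norm_freq_sq_le_symbolWeight α) f hf x).trans (hle f)
  · intro x
    exact (hC _ (measurable_driftSymbol α) norm_driftSymbol_le f hf x).trans (hle f)
  · intro x
    rw [hf.deriv_drift hα0 hα2]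
    exact (hC _ (measurable_freq (measurable_driftSymbol α))
      (norm_freq_mul_driftSymbol_le hα0 hα2) f hf x).trans (hle f)

theorem PointwiseBounds.mono {B B' : ℝ} (h : PointwiseBounds α B f) (hB : B ≤ B') :
    PointwiseBounds α B' f where
  abs_le x := (h.abs_le x).trans hB
  integral_abs_le := h.integral_abs_le.trans hB
  integral_abs_deriv_le := h.integral_abs_deriv_le.trans hB
  abs_deriv_le x := (h.abs_deriv_le x).trans hB
  abs_deriv_deriv_le x := (h.abs_deriv_deriv_le x).trans hB
  abs_drift_le x := (h.abs_drift_le x).trans hB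
  abs_deriv_drift_le x := (h.abs_deriv_drift_le x).trans hB

theorem MemClass.tame (hf : MemClass f) : Tame f := by
  obtain ⟨C, -, hC⟩ := exists_pointwiseBounds (α := 1) one_pos one_lt_two
  exact ⟨hf.contDiff, hf.integrable, ⟨_, (hC f hf).abs_le⟩, ⟨_, (hC f hf).abs_deriv_le⟩⟩

end Symbols

/-! ### The drift as a mixture of resolvents -/

section Mixture

variable {α : ℝ}

/-- The normalizing constant of the mixture. -/
def mixConst (α : ℝ) : ℝ := ∫ s in Ioi (0 : ℝ), s ^ (1 - α) / (s ^ 2 + 1)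

theorem integrableOn_mix (hα0 : 0 < α) (hα2 : α < 2) :
    IntegrableOn (fun s : ℝ => s ^ (1 - α) / (s ^ 2 + 1)) (Ioi 0) := by
  have hm : Measurable (fun s : ℝ => s ^ (1 - α) / (s ^ 2 + 1)) := by fun_prop
  rw [← Ioc_union_Ioi_eq_Ioi (zero_le_one' ℝ)]
  refine IntegrableOn.union ?_ ?_
  · have h1 : IntervalIntegrable (fun x : ℝ => x ^ (1 - α)) volume 0 1 :=
      intervalIntegral.intervalIntegrable_rpow' (by linarith)
    rw [intervalIntegrable_iff_integrableOn_Ioc_of_le zero_le_one] at h1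
    refine h1.mono' hm.aestronglyMeasurable
      ((ae_restrict_iff' measurableSet_Ioc).2 (ae_of_all _ fun s hs => ?_))
    have hs0 : 0 < s := hs.1
    rw [Real.norm_eq_abs, abs_of_nonneg (by positivity)]
    exact div_le_self (by positivity) (by nlinarith)
  · refine (integrableOn_Ioi_rpow_of_lt (a := -1 - α) (by linarith) one_pos).mono'
      hm.aestronglyMeasurable ((ae_restrict_iff' measurableSet_Ioi).2 (ae_of_all _ fun s hs => ?_))
    have hs0 : 0 < s := one_pos.trans hs
    rw [Real.norm_eq_abs, abs_of_nonneg (by positivity), div_le_iff₀ (by positivity)]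
    have e : s ^ (1 - α) = s ^ (-1 - α) * s ^ 2 := by
      rw [← Real.rpow_natCast, ← Real.rpow_add hs0]
      congr 1
      push_cast
      ring
    rw [e]
    gcongr
    linarith

theorem mixConst_pos (hα0 : 0 < α) (hα2 : α < 2) : 0 < mixConst α := by
  rw [mixConst, setIntegral_pos_iff_support_of_nonneg_ae _ (integrableOn_mix hα0 hα2)]
  · have : Function.support (fun s : ℝ => s ^ (1 - α) / (s ^ 2 + 1)) ∩ Ioi 0 = Ioi 0 := by
      refine inter_eq_right.2 fun s hs => ?_
      have hs0 : (0 : ℝ) < s := hs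
      exact (by positivity : (0 : ℝ) < s ^ (1 - α) / (s ^ 2 + 1)).ne'
    rw [this]
    simp
  · refine (ae_restrict_iff' measurableSet_Ioi).2 (ae_of_all _ fun s hs => ?_)
    have hs0 : (0 : ℝ) < s := hs
    simp only [Pi.zero_apply]
    positivity

/-- The substitution s = k r. The power k^{-α} of the drift symbol arises here. -/
theorem mix_scaling (hα0 : 0 < α) (hα2 : α < 2) {k : ℝ} (hk : 0 < k) :
    IntegrableOn (fun s : ℝ => s ^ (1 - α) / (s ^ 2 + k ^ 2)) (Ioi 0) ∧
      ∫ s in Ioi (0 : ℝ), s ^ (1 - α) / (s ^ 2 + k ^ 2) = k ^ (-α) * mixConst α := by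
  have hki : 0 < k⁻¹ := by positivity
  have e : ∀ s ∈ Ioi (0 : ℝ), s ^ (1 - α) / (s ^ 2 + k ^ 2) =
      k ^ (-α) * k⁻¹ * ((fun s : ℝ => s ^ (1 - α) / (s ^ 2 + 1)) (k⁻¹ * s)) := by
    intro s hs
    have hs0 : (0 : ℝ) < s := hs
    simp only
    rw [Real.mul_rpow hki.le hs0.le, Real.inv_rpow hk.le, Real.rpow_neg hk.le,
      Real.rpow_sub hk, Real.rpow_one]
    field_simp
  constructor
  · have := (integrableOn_Ioi_comp_mul_left_iff
      (fun s : ℝ => s ^ (1 - α) / (s ^ 2 + 1)) 0 hki).2 (by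
        rw [mul_zero]; exact integrableOn_mix hα0 hα2)
    exact IntegrableOn.congr_fun (this.const_mul (k ^ (-α) * k⁻¹)) (fun s hs => (e s hs).symm) measurableSet_Ioi
  · rw [setIntegral_congr_fun measurableSet_Ioi e, integral_const_mul,
      integral_comp_mul_left_Ioi (fun s : ℝ => s ^ (1 - α) / (s ^ 2 + 1)) 0 hki, mul_zero, mixConst]
    rw [smul_eq_mul, inv_inv]
    field_simp

/-- Fourier inversion for the flux; its transform is integrable since |k|/(s² + k²) ≤ 1/s. -/
theorem MemClass.flux_eq_mult {f : ℝ → ℝ} (hf : MemClass f) {s : ℝ} (hs : 0 < s) (x : ℝ) :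
    flux s f x =
      mult (fun ξ => Complex.I * ((angFreq ξ / (s ^ 2 + angFreq ξ ^ 2) : ℝ) : ℂ)) f x := by
  have hc := hf.contDiff.continuous
  have e : fourier (flux s f) = fun ξ =>
      Complex.I * ((angFreq ξ / (s ^ 2 + angFreq ξ ^ 2) : ℝ) : ℂ) * fourier f ξ :=
    funext (fourier_flux hs hc hf.integrable)
  have hcs : Continuous fun ξ => angFreq ξ / (s ^ 2 + angFreq ξ ^ 2) := by
    have := continuous_angFreq
    exact this.div (by fun_prop) fun ξ => by positivity
  have hi : Integrable (fourier (flux s f)) := by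
    rw [e]
    refine hf.integrable_fourier.bdd_mul (c := 1 / s)
      (Continuous.aestronglyMeasurable (by fun_prop)) (ae_of_all _ fun ξ => ?_)
    rw [norm_mul, Complex.norm_I, one_mul, Complex.norm_real, Real.norm_eq_abs, abs_div,
      abs_of_pos (by positivity : 0 < s ^ 2 + angFreq ξ ^ 2),
      div_le_div_iff₀ (by positivity) hs]
    nlinarith [sq_abs (angFreq ξ), sq_nonneg (|angFreq ξ| - s), abs_nonneg (angFreq ξ)]
  rw [eq_re_fourierInv_fourier (continuous_flux hs hc hf.integrable)
    (integrable_flux hs hf.integrable) hi x, e, mult]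

/-- The drift is a mixture of the operators `∂ (s² - ∂²)⁻¹`. -/
theorem MemClass.drift_eq_integral_flux {f : ℝ → ℝ} (hα0 : 0 < α) (hα2 : α < 2) (hf : MemClass f)
    (x : ℝ) : mixConst α * drift α f x = ∫ s in Ioi (0 : ℝ), s ^ (1 - α) * flux s f x := by
  have hfc := (continuous_fourier hf.integrable).measurable
  have hk := continuous_angFreq.measurable
  set F : ℝ → ℝ → ℂ := fun s ξ =>
    ((s ^ (1 - α) * (angFreq ξ / (s ^ 2 + angFreq ξ ^ 2)) : ℝ) : ℂ) *
      (Complex.I * (Real.fourierChar (ξ * x) • fourier f ξ)) with hF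
  have hFn : ∀ s ∈ Ioi (0 : ℝ), ∀ ξ, ‖F s ξ‖ =
      s ^ (1 - α) / (s ^ 2 + |angFreq ξ| ^ 2) * (|angFreq ξ| * ‖fourier f ξ‖) := by
    intro s hs ξ
    have hs0 : (0 : ℝ) < s := hs
    simp only [hF, norm_mul, Complex.norm_real, Real.norm_eq_abs, Complex.norm_I, Circle.norm_smul,
      abs_div, sq_abs]
    rw [abs_of_pos (by positivity : 0 < s ^ (1 - α)),
      abs_of_pos (by positivity : 0 < s ^ 2 + angFreq ξ ^ 2)]
    ring
  have hFm : Measurable (Function.uncurry F) := by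
    have h1 : Measurable fun p : ℝ × ℝ => angFreq p.2 := hk.comp measurable_snd
    have h2 : Measurable fun p : ℝ × ℝ => fourier f p.2 := hfc.comp measurable_snd
    have h3 : Measurable fun p : ℝ × ℝ => ((Real.fourierChar (p.2 * x) : Circle) : ℂ) := by
      have : Continuous fun p : ℝ × ℝ => ((Real.fourierChar (p.2 * x) : Circle) : ℂ) :=
        continuous_subtype_val.comp (Real.continuous_fourierChar.comp (by fun_prop))
      exact this.measurable
    have h4 : Measurable fun p : ℝ × ℝ => p.1 ^ (1 - α) := by fun_prop
    simp only [Function.uncurry_def, hF, Circle.smul_def, smul_eq_mul]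
    exact (Complex.measurable_ofReal.comp (h4.mul (h1.div ((measurable_fst.pow_const 2).add
      (h1.pow_const 2))))).mul ((h3.mul h2).const_mul _)
  have hinner : ∀ ξ, IntegrableOn (fun s => F s ξ) (Ioi 0) := by
    intro ξ
    simp only [hF]
    rcases eq_or_ne (angFreq ξ) 0 with h0 | h0
    · simp [h0]
    · have hm := (mix_scaling hα0 hα2 (abs_pos.2 h0)).1.mul_const (angFreq ξ)
      have hm' : IntegrableOn (fun s : ℝ => s ^ (1 - α) * (angFreq ξ / (s ^ 2 + angFreq ξ ^ 2)))
          (Ioi 0) := by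
        refine hm.congr (ae_of_all _ fun s => ?_)
        simp only [sq_abs]
        ring
      exact (Integrable.ofReal hm').mul_const _
  -- Integrating the absolute value over s first gives `mixConst α` times the absolute value of the
  -- drift integrand. The zero frequency is treated apart: the scaling formula needs k > 0, and both
  -- sides vanish there through the factor k.
  have hint : Integrable (Function.uncurry F) ((volume.restrict (Ioi (0 : ℝ))).prod volume) := by
    rw [integrable_prod_iff' hFm.aestronglyMeasurable]
    refine ⟨ae_of_all _ fun ξ => hinner ξ, ?_⟩
    have hd := ((hf.integrable_mult hα0 hα2 (measurable_driftSymbol α)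
      norm_driftSymbol_le).norm).const_mul (mixConst α)
    refine hd.congr (ae_of_all _ fun ξ => ?_)
    simp only [Function.uncurry_apply_pair]
    rw [setIntegral_congr_fun measurableSet_Ioi fun s hs => hFn s hs ξ, integral_mul_const]
    rcases eq_or_ne (angFreq ξ) 0 with h0 | h0
    · simp [h0, driftSymbol]
    · rw [(mix_scaling hα0 hα2 (abs_pos.2 h0)).2, driftSymbol, norm_mul, norm_mul, Complex.norm_I,
        Complex.norm_real, Real.norm_eq_abs, abs_mul, abs_of_nonneg
          (by positivity : 0 ≤ |angFreq ξ| ^ (-α))]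
      ring
  have hsw := integral_integral_swap hint
  have hL : ∀ s ∈ Ioi (0 : ℝ), s ^ (1 - α) * flux s f x = (∫ ξ, F s ξ).re := by
    intro s hs
    have hs0 : (0 : ℝ) < s := hs
    rw [hf.flux_eq_mult hs0, mult, ← Complex.re_ofReal_mul, Real.fourierInv_eq_fourier_neg,
      Real.fourier_real_eq, ← integral_const_mul]
    congr 2
    ext ξ
    simp only [hF, Circle.smul_def, smul_eq_mul, mul_neg, neg_neg]
    push_cast
    ring
  have hR : ∀ ξ, ∫ s in Ioi (0 : ℝ), F s ξ =
      (mixConst α : ℂ) * (Real.fourierChar (ξ * x) • (driftSymbol α ξ * fourier f ξ)) := by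
    intro ξ
    simp only [hF]
    rw [integral_mul_const, integral_complex_ofReal]
    have : ∫ s in Ioi (0 : ℝ), s ^ (1 - α) * (angFreq ξ / (s ^ 2 + angFreq ξ ^ 2)) =
        mixConst α * (|angFreq ξ| ^ (-α) * angFreq ξ) := by
      rcases eq_or_ne (angFreq ξ) 0 with h0 | h0
      · simp [h0]
      · have hm := (mix_scaling hα0 hα2 (abs_pos.2 h0)).2
        simp only [sq_abs] at hm
        have e : ∀ s : ℝ, s ^ (1 - α) * (angFreq ξ / (s ^ 2 + angFreq ξ ^ 2)) =
            s ^ (1 - α) / (s ^ 2 + angFreq ξ ^ 2) * angFreq ξ := fun s => by ring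
        simp only [e]
        rw [integral_mul_const, hm]
        ring
    rw [this, driftSymbol]
    simp only [Circle.smul_def, smul_eq_mul]
    push_cast
    ring
  rw [setIntegral_congr_fun measurableSet_Ioi hL]
  have hre : ∫ s in Ioi (0 : ℝ), (∫ ξ, F s ξ).re = (∫ s in Ioi (0 : ℝ), ∫ ξ, F s ξ).re := by
    have := integral_re (𝕜 := ℂ) (hint.integral_prod_left)
    simpa using! this
  rw [hre, hsw]
  simp only [hR]
  rw [integral_const_mul, Complex.re_ofReal_mul, drift_eq_mult, mult,
    Real.fourierInv_eq_fourier_neg, Real.fourier_real_eq]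
  simp only [mul_neg, neg_neg, driftSymbol]

end Mixture

/-! ### Integrals depending on time -/

/-- The fundamental theorem of calculus at each x, followed by Fubini. Joint continuity of the
derivative gives measurability, and the L¹ bound uniform in time gives integrability on the product.
-/
theorem integral_sub_eq_integral_deriv {Φ Φ' : ℝ → ℝ → ℝ} {t B : ℝ} (ht : 0 ≤ t) {S : Set ℝ}
    (hS : MeasurableSet S)
    (hd : ∀ x ∈ S, ∀ τ ∈ Icc 0 t, HasDerivWithinAt (fun τ => Φ τ x) (Φ' τ x) (Icc 0 t) τ)
    (hc : ContinuousOn (Function.uncurry Φ') (Icc 0 t ×ˢ S))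
    (hi : ∀ τ ∈ Icc 0 t, IntegrableOn (Φ' τ) S)
    (hB : ∀ τ ∈ Icc 0 t, ∫ x in S, |Φ' τ x| ≤ B)
    (h0 : IntegrableOn (Φ 0) S) (h1 : IntegrableOn (Φ t) S) :
    IntervalIntegrable (fun τ => ∫ x in S, Φ' τ x) volume 0 t ∧
      (∫ x in S, Φ t x) - (∫ x in S, Φ 0 x) = ∫ τ in (0 : ℝ)..t, ∫ x in S, Φ' τ x := by
  have hm : AEStronglyMeasurable (Function.uncurry Φ')
      ((volume.restrict (Ioc 0 t)).prod (volume.restrict S)) := by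
    rw [Measure.prod_restrict]
    exact (hc.mono (prod_mono Ioc_subset_Icc_self Subset.rfl)).aestronglyMeasurable
      (measurableSet_Ioc.prod hS)
  have hint : Integrable (Function.uncurry Φ')
      ((volume.restrict (Ioc 0 t)).prod (volume.restrict S)) := by
    rw [integrable_prod_iff hm]
    refine ⟨(ae_restrict_iff' measurableSet_Ioc).2 (ae_of_all _ fun τ hτ =>
      hi τ (Ioc_subset_Icc_self hτ)), ?_⟩
    refine Integrable.of_bound hm.norm.integral_prod_right' B
      ((ae_restrict_iff' measurableSet_Ioc).2 (ae_of_all _ fun τ hτ => ?_))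
    rw [Real.norm_eq_abs, abs_of_nonneg (integral_nonneg fun x => norm_nonneg _)]
    exact hB τ (Ioc_subset_Icc_self hτ)
  refine ⟨(intervalIntegrable_iff_integrableOn_Ioc_of_le ht).2 hint.integral_prod_left, ?_⟩
  rw [intervalIntegral.integral_of_le ht, integral_integral_swap hint, ← integral_sub h1 h0]
  refine setIntegral_congr_fun hS fun x hx => ?_
  rw [← intervalIntegral.integral_of_le ht]
  have hcx : ContinuousOn (fun τ => Φ' τ x) (Icc 0 t) :=
    hc.comp (f := fun τ => (τ, x)) (by fun_prop) fun τ hτ => ⟨hτ, hx⟩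
  refine (intervalIntegral.integral_eq_sub_of_hasDerivAt_of_le ht
    (fun τ hτ => (hd x hx τ hτ).continuousWithinAt) (fun τ hτ => ?_)
    (hcx.intervalIntegrable_of_Icc ht)).symm
  exact (hd x hx τ (Ioo_subset_Icc_self hτ)).hasDerivAt (Icc_mem_nhds hτ.1 hτ.2)

/-- Grönwall's inequality in integral form. -/
theorem eq_zero_of_le_integral {Z : ℝ → ℝ} {t K : ℝ} (hZ : ContinuousOn Z (Icc 0 t))
    (h0 : ∀ τ ∈ Icc 0 t, 0 ≤ Z τ)
    (hle : ∀ τ ∈ Icc 0 t, Z τ ≤ K * ∫ r in (0 : ℝ)..τ, Z r) : ∀ τ ∈ Icc 0 t, Z τ = 0 := by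
  intro τ hτ
  have ht : 0 ≤ t := hτ.1.trans hτ.2
  set G : ℝ → ℝ := fun τ => ∫ r in (0 : ℝ)..τ, Z r with hG
  have hint : ∀ τ ∈ Icc 0 t, IntervalIntegrable Z volume 0 τ := fun τ hτ =>
    (hZ.mono (Icc_subset_Icc_right hτ.2)).intervalIntegrable_of_Icc hτ.1
  have hGc : ContinuousOn G (Icc 0 t) :=
    intervalIntegral.continuousOn_primitive_interval
      (by rw [uIcc_of_le ht]; exact hZ.integrableOn_Icc) |>.mono (by rw [uIcc_of_le ht])
  have hGd : ∀ τ ∈ Ico 0 t, HasDerivWithinAt G (Z τ) (Ici τ) τ := by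
    intro τ hτ
    have hτ' := Ico_subset_Icc_self hτ
    have hcw : ContinuousWithinAt Z (Icc τ t) τ :=
      (hZ τ hτ').mono (Icc_subset_Icc_left hτ.1)
    have hnb : Icc τ t ∈ 𝓝[Ici τ] τ := Icc_mem_nhdsGE hτ.2
    have hcI : ContinuousWithinAt Z (Ici τ) τ := hcw.mono_of_mem_nhdsWithin hnb
    refine intervalIntegral.integral_hasDerivWithinAt_right (hint τ hτ') (s := Ici τ)
      (t := Ioi τ) ?_ (hcI.mono Ioi_subset_Ici_self)
    refine ⟨Icc τ t, mem_of_superset (nhdsWithin_mono τ Ioi_subset_Ici_self hnb) Subset.rfl, ?_⟩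
    exact (hZ.mono (Icc_subset_Icc_left hτ.1)).aestronglyMeasurable measurableSet_Icc
  have hG0 : ∀ τ ∈ Icc 0 t, 0 ≤ G τ := fun τ hτ =>
    intervalIntegral.integral_nonneg hτ.1 fun r hr => h0 r ⟨hr.1, hr.2.trans hτ.2⟩
  have hb := norm_le_gronwallBound_of_norm_deriv_right_le (δ := 0) (K := K) (ε := 0) hGc hGd
    (by simp [hG]) (fun τ hτ => by
      have hτ' := Ico_subset_Icc_self hτ
      rw [Real.norm_eq_abs, Real.norm_eq_abs, abs_of_nonneg (h0 τ hτ'),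
        abs_of_nonneg (hG0 τ hτ'), add_zero]
      exact hle τ hτ')
  have hGz := hb τ hτ
  rw [gronwallBound_ε0_δ0, norm_le_zero_iff] at hGz
  have := hle τ hτ
  rw [show ∫ r in (0 : ℝ)..τ, Z r = G τ from rfl, hGz, mul_zero] at this
  exact le_antisymm this (h0 τ hτ)

/-! ### Continuity in time of solutions -/

theorem cnorm_le_add {f g : ℝ → ℝ} (hf : MemClass f) (hg : MemClass g) :
    cnorm f ≤ cnorm (fun x => f x - g x) + cnorm g := by
  have hs := hf.sub hg
  have h1 : ∫ x, |f x| ≤ (∫ x, |f x - g x|) + ∫ x, |g x| := by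
    rw [← integral_add hs.integrable.abs hg.integrable.abs]
    refine integral_mono hf.integrable.abs (hs.integrable.abs.add hg.integrable.abs) fun x => ?_
    simpa using abs_add_le (f x - g x) (g x)
  have h2 : ∫ x, |deriv f x| ≤ (∫ x, |deriv (fun x => f x - g x) x|) + ∫ x, |deriv g x| := by
    rw [← integral_add hs.integrable_deriv.abs hg.integrable_deriv.abs]
    refine integral_mono hf.integrable_deriv.abs
      (hs.integrable_deriv.abs.add hg.integrable_deriv.abs) fun x => ?_
    simp only [hf.deriv_sub_apply hg]
    simpa using abs_add_le (deriv f x - deriv g x) (deriv g x)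
  have h3 : (sobolevNorm f).toReal ≤
      (sobolevNorm fun x => f x - g x).toReal + (sobolevNorm g).toReal := by
    rw [← ENNReal.toReal_add hs.sobolev.ne hg.sobolev.ne]
    refine ENNReal.toReal_mono (ENNReal.add_ne_top.2 ⟨hs.sobolev.ne, hg.sobolev.ne⟩) ?_
    refine le_trans (le_of_eq ?_) (eLpNorm_add_le hs.sobolev_measurable hg.sobolev_measurable
      one_le_two)
    rw [sobolevNorm]
    congr 1
    ext ξ
    rw [Pi.add_apply, fourier_sub hf.integrable hg.integrable]
    ring
  rw [hf.cnorm_eq, hg.cnorm_eq, hs.cnorm_eq]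
  linarith

/-- A curve in the class, continuous on `[0, T)`. -/
structure ContCurve (T : ℝ) (θ : ℝ → ℝ → ℝ) : Prop where
  memClass : ∀ t ∈ Ico 0 T, MemClass (θ t)
  tendsto : ∀ t ∈ Ico 0 T, Tendsto (fun s => cnorm (fun x => θ s x - θ t x)) (𝓝[Ico 0 T] t) (𝓝 0)

theorem IsSolution.contCurve {α T : ℝ} {θ₀ : ℝ → ℝ} {θ : ℝ → ℝ → ℝ} (h : IsSolution α θ₀ T θ) :
    ContCurve T θ where
  memClass := h.memClass
  tendsto t ht := (ENNReal.tendsto_toReal ENNReal.zero_ne_top).comp (h.continuous t ht)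

namespace ContCurve

variable {T : ℝ} {θ η : ℝ → ℝ → ℝ}

theorem continuousOn_cnorm (h : ContCurve T θ) : ContinuousOn (fun t => cnorm (θ t)) (Ico 0 T) := by
  intro t ht
  have hsym : ∀ s ∈ Ico 0 T, cnorm (θ t) ≤ cnorm (fun x => θ s x - θ t x) + cnorm (θ s) := by
    intro s hs
    have h1 := cnorm_le_add (h.memClass t ht) (h.memClass s hs)
    have e : cnorm (fun x => θ t x - θ s x) = cnorm (fun x => θ s x - θ t x) := by
      rw [((h.memClass t ht).sub (h.memClass s hs)).cnorm_eq,
        ((h.memClass s hs).sub (h.memClass t ht)).cnorm_eq]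
      congr 1
      · congr 1
        · congr with x
          rw [abs_sub_comm]
        · congr with x
          rw [(h.memClass t ht).deriv_sub_apply (h.memClass s hs),
            (h.memClass s hs).deriv_sub_apply (h.memClass t ht), abs_sub_comm]
      · congr 1
        rw [sobolevNorm, sobolevNorm, ← eLpNorm_neg]
        congr 1
        ext ξ
        rw [Pi.neg_apply, fourier_sub (h.memClass t ht).integrable (h.memClass s hs).integrable,
          fourier_sub (h.memClass s hs).integrable (h.memClass t ht).integrable]
        ring
    rwa [e] at h1
  have := h.tendsto t ht
  rw [ContinuousWithinAt, tendsto_iff_norm_sub_tendsto_zero]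
  refine squeeze_zero' (Eventually.of_forall fun s => norm_nonneg _) ?_ this
  filter_upwards [self_mem_nhdsWithin] with s hs
  have h1 := cnorm_le_add (h.memClass s hs) (h.memClass t ht)
  have h2 := hsym s hs
  rw [Real.norm_eq_abs, abs_le]
  constructor <;> linarith

theorem exists_pointwiseBounds (h : ContCurve T θ) {α : ℝ} (hα0 : 0 < α) (hα2 : α < 2) {t : ℝ}
    (ht : t < T) : ∃ B : ℝ, 0 < B ∧ ∀ τ ∈ Icc 0 t, PointwiseBounds α B (θ τ) := by
  obtain ⟨C, hC0, hC⟩ := AlphaModel.exists_pointwiseBounds hα0 hα2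
  have hsub : Icc 0 t ⊆ Ico 0 T := fun τ hτ => ⟨hτ.1, hτ.2.trans_lt ht⟩
  obtain ⟨K, hK⟩ := isCompact_Icc.exists_bound_of_continuousOn (h.continuousOn_cnorm.mono hsub)
  refine ⟨C * |K| + 1, by positivity, fun τ hτ => ?_⟩
  refine (hC (θ τ) (h.memClass τ (hsub hτ))).mono ?_
  have h1 : cnorm (θ τ) ≤ |K| := (le_abs_self _).trans ((hK τ hτ).trans (le_abs_self K))
  nlinarith

/-- The bound by the class norm is uniform in x, so S(θ_s) - S(θ_t) tends to 0 uniformly in space;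
adding the spatial continuity of S(θ_t) gives joint continuity. -/
theorem continuousOn_uncurry (h : ContCurve T θ) {S : (ℝ → ℝ) → ℝ → ℝ} {C : ℝ}
    (hC : ∀ f, MemClass f → ∀ x, |S f x| ≤ C * cnorm f)
    (hsub : ∀ f g, MemClass f → MemClass g → ∀ x, S (fun x => f x - g x) x = S f x - S g x)
    (hcont : ∀ f, MemClass f → Continuous (S f)) :
    ContinuousOn (Function.uncurry fun t x => S (θ t) x) (Ico 0 T ×ˢ univ) := by
  rintro ⟨t, x⟩ ⟨ht, -⟩
  have hfst : Tendsto (Prod.fst : ℝ × ℝ → ℝ) (𝓝[Ico 0 T ×ˢ univ] (t, x)) (𝓝[Ico 0 T] t) :=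
    tendsto_nhdsWithin_of_tendsto_nhds_of_eventually_within _
      (continuous_fst.continuousAt.tendsto.mono_left nhdsWithin_le_nhds)
      (by filter_upwards [self_mem_nhdsWithin] with p hp using hp.1)
  have h1 : Tendsto (fun p : ℝ × ℝ => S (fun x => θ p.1 x - θ t x) p.2)
      (𝓝[Ico 0 T ×ˢ univ] (t, x)) (𝓝 0) := by
    have h2 : Tendsto (fun p : ℝ × ℝ => C * cnorm (fun x => θ p.1 x - θ t x))
        (𝓝[Ico 0 T ×ˢ univ] (t, x)) (𝓝 0) := by
      simpa using ((h.tendsto t ht).comp hfst).const_mul C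
    refine squeeze_zero_norm' ?_ h2
    filter_upwards [self_mem_nhdsWithin] with p hp
    exact hC _ ((h.memClass p.1 hp.1).sub (h.memClass t ht)) p.2
  have h3 : Tendsto (fun p : ℝ × ℝ => S (θ t) p.2) (𝓝[Ico 0 T ×ˢ univ] (t, x))
      (𝓝 (S (θ t) x)) :=
    (((hcont _ (h.memClass t ht)).comp continuous_snd).tendsto (t, x)).mono_left nhdsWithin_le_nhds
  have h4 := h1.add h3
  rw [zero_add] at h4
  refine h4.congr' ?_
  filter_upwards [self_mem_nhdsWithin] with p hp
  rw [hsub _ _ (h.memClass p.1 hp.1) (h.memClass t ht)]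
  simp [Function.uncurry_def]

theorem continuousOn_self (h : ContCurve T θ) :
    ContinuousOn (Function.uncurry θ) (Ico 0 T ×ˢ univ) := by
  obtain ⟨C, -, hC⟩ := AlphaModel.exists_pointwiseBounds (α := 1) one_pos one_lt_two
  exact h.continuousOn_uncurry (S := fun f => f) (fun f hf => (hC f hf).abs_le)
    (fun f g _ _ x => rfl) fun f hf => hf.contDiff.continuous

theorem continuousOn_deriv (h : ContCurve T θ) :
    ContinuousOn (Function.uncurry fun t x => deriv (θ t) x) (Ico 0 T ×ˢ univ) := by
  obtain ⟨C, -, hC⟩ := AlphaModel.exists_pointwiseBounds (α := 1) one_pos one_lt_two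
  exact h.continuousOn_uncurry (S := deriv) (fun f hf => (hC f hf).abs_deriv_le)
    (fun f g hf hg x => hf.deriv_sub_apply hg x) fun f hf => hf.continuous_deriv

theorem continuousOn_drift (h : ContCurve T θ) {α : ℝ} (hα0 : 0 < α) (hα2 : α < 2) :
    ContinuousOn (Function.uncurry fun t x => drift α (θ t) x) (Ico 0 T ×ˢ univ) := by
  obtain ⟨C, -, hC⟩ := AlphaModel.exists_pointwiseBounds hα0 hα2
  exact h.continuousOn_uncurry (S := drift α) (fun f hf => (hC f hf).abs_drift_le)
    (fun f g hf hg x => drift_sub hα0 hα2 hf hg x)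
    fun f hf => (hf.differentiable_drift hα0 hα2).continuous

theorem continuousOn_integral_abs_sub (h : ContCurve T θ) (h' : ContCurve T η) :
    ContinuousOn (fun t => ∫ x, |θ t x - η t x|) (Ico 0 T) := by
  intro t ht
  have h1 := (h.tendsto t ht).add (h'.tendsto t ht)
  rw [add_zero] at h1
  rw [ContinuousWithinAt, tendsto_iff_norm_sub_tendsto_zero]
  refine squeeze_zero' (Eventually.of_forall fun s => norm_nonneg _) ?_ h1
  filter_upwards [self_mem_nhdsWithin] with s hs
  have m1 := (h.memClass s hs).sub (h.memClass t ht)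
  have m2 := (h'.memClass s hs).sub (h'.memClass t ht)
  have i1 := ((h.memClass s hs).sub (h'.memClass s hs)).integrable.abs
  have i2 := ((h.memClass t ht).sub (h'.memClass t ht)).integrable.abs
  rw [← integral_sub i1 i2, Real.norm_eq_abs]
  calc _ ≤ ∫ x, (|θ s x - θ t x| + |η s x - η t x|) := by
        refine abs_integral_le_of_abs_le (m1.integrable.abs.add m2.integrable.abs) fun x => ?_
        refine (abs_abs_sub_abs_le _ _).trans ?_
        have e : θ s x - η s x - (θ t x - η t x) = (θ s x - θ t x) - (η s x - η t x) := by ring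
        rw [e]
        exact abs_sub _ _
    _ = (∫ x, |θ s x - θ t x|) + ∫ x, |η s x - η t x| :=
        integral_add m1.integrable.abs m2.integrable.abs
    _ ≤ _ := add_le_add m1.integral_abs_le m2.integral_abs_le

theorem continuousOn_integral_sq_sub (h : ContCurve T θ) (h' : ContCurve T η) :
    ContinuousOn (fun t => ∫ x, (θ t x - η t x) ^ 2) (Ico 0 T) := by
  intro t ht
  obtain ⟨C, hC0, hC⟩ := AlphaModel.exists_pointwiseBounds (α := 1) one_pos one_lt_two
  have h1 := (h.tendsto t ht).add (h'.tendsto t ht)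
  rw [add_zero] at h1
  have mt := (h.memClass t ht).sub (h'.memClass t ht)
  obtain ⟨K, hK⟩ := mt.tame.bdd
  have h2 := ((h1.const_mul C).add_const (2 * K)).mul h1
  rw [mul_zero] at h2
  rw [ContinuousWithinAt, tendsto_iff_norm_sub_tendsto_zero]
  refine squeeze_zero' (Eventually.of_forall fun s => norm_nonneg _) ?_ h2
  filter_upwards [self_mem_nhdsWithin] with s hs
  have m1 := (h.memClass s hs).sub (h.memClass t ht)
  have m2 := (h'.memClass s hs).sub (h'.memClass t ht)
  have i1 := ((h.memClass s hs).sub (h'.memClass s hs)).tame.integrable_sq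
  have i2 := mt.tame.integrable_sq
  set D := cnorm (fun x => θ s x - θ t x) + cnorm (fun x => η s x - η t x) with hD
  have hint := (m1.integrable.abs.add m2.integrable.abs).const_mul (C * D + 2 * K)
  have hpos : 0 ≤ C * D + 2 * K := by
    have h3 := cnorm_nonneg (fun x => θ s x - θ t x)
    have h4 := cnorm_nonneg (fun x => η s x - η t x)
    have h5 := (abs_nonneg _).trans (hK 0)
    positivity
  rw [← integral_sub i1 i2, Real.norm_eq_abs]
  calc _ ≤ ∫ x, (C * D + 2 * K) * (|θ s x - θ t x| + |η s x - η t x|) := by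
        refine abs_integral_le_of_abs_le hint fun x => ?_
        -- Difference of squares: one factor stays bounded and the other tends to 0 in L¹.
        have e : (θ s x - η s x) ^ 2 - (θ t x - η t x) ^ 2 =
            ((θ s x - θ t x) - (η s x - η t x) + 2 * (θ t x - η t x)) *
              ((θ s x - θ t x) - (η s x - η t x)) := by ring
        have b1 := (hC _ m1).abs_le x
        have b2 := (hC _ m2).abs_le x
        have b3 := hK x
        have b4 : |(θ s x - θ t x) - (η s x - η t x)| ≤ |θ s x - θ t x| + |η s x - η t x| :=
          abs_sub _ _
        rw [e, abs_mul]
        refine mul_le_mul ?_ b4 (abs_nonneg _) hpos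
        refine (abs_add_le _ _).trans ?_
        rw [abs_mul, abs_two, hD]
        linarith
    _ = (C * D + 2 * K) * ((∫ x, |θ s x - θ t x|) + ∫ x, |η s x - η t x|) := by
        rw [integral_const_mul, integral_add m1.integrable.abs m2.integrable.abs]
    _ ≤ _ := by
        gcongr
        exact add_le_add m1.integral_abs_le m2.integral_abs_le

end ContCurve

/-! ### Quadratic forms of the drift -/

section DriftForms

variable {α : ℝ} {f b : ℝ → ℝ} {S : Set ℝ}

/-- The decay 1/(s² + 1) makes the dominating function a product: s^{1-α}/(s² + 1) in s, times c in
x. -/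
theorem mixture_fubini (hα0 : 0 < α) (hα2 : α < 2) (hf : MemClass f) (hb : Measurable b)
    (hS : MeasurableSet S) {c : ℝ → ℝ} (hc : IntegrableOn c S)
    (hle : ∀ s : ℝ, 0 < s → ∀ x ∈ S, |flux s f x * b x| ≤ c x / (s ^ 2 + 1)) :
    IntegrableOn (fun s : ℝ => s ^ (1 - α) * ∫ x in S, flux s f x * b x) (Ioi 0) ∧
      mixConst α * ∫ x in S, drift α f x * b x =
        ∫ s in Ioi (0 : ℝ), s ^ (1 - α) * ∫ x in S, flux s f x * b x := by
  set F : ℝ → ℝ → ℝ := fun s x => s ^ (1 - α) * (flux s f x * b x) with hF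
  have hFm : Measurable (Function.uncurry F) := by
    have h1 := (stronglyMeasurable_flux hf.contDiff.continuous).measurable
    have h2 : Measurable fun p : ℝ × ℝ => p.1 ^ (1 - α) := by fun_prop
    exact h2.mul (h1.mul (hb.comp measurable_snd))
  have hint : Integrable (Function.uncurry F)
      ((volume.restrict (Ioi (0 : ℝ))).prod (volume.restrict S)) := by
    have hdom := (integrableOn_mix hα0 hα2).mul_prod hc
    refine hdom.mono' hFm.aestronglyMeasurable ?_
    rw [Measure.prod_restrict]
    refine (ae_restrict_iff' (measurableSet_Ioi.prod hS)).2 (ae_of_all _ ?_)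
    rintro ⟨s, x⟩ ⟨hs, hx⟩
    have hs0 : (0 : ℝ) < s := hs
    simp only [Function.uncurry_apply_pair, hF, Real.norm_eq_abs]
    rw [abs_mul, abs_of_pos (by positivity : 0 < s ^ (1 - α)), div_mul_eq_mul_div, mul_div_assoc]
    gcongr
    exact hle s hs x hx
  have hsw := integral_integral_swap hint
  have e1 : ∀ s, ∫ x in S, F s x = s ^ (1 - α) * ∫ x in S, flux s f x * b x := fun s => by
    simp only [hF]
    rw [integral_const_mul]
  have hl := hint.integral_prod_left
  simp only [Function.uncurry_apply_pair, e1] at hl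
  refine ⟨hl, ?_⟩
  simp only [e1] at hsw
  rw [hsw, ← integral_const_mul]
  refine setIntegral_congr_fun hS fun x _ => ?_
  simp only [hF, ← mul_assoc]
  rw [integral_mul_const, hf.drift_eq_integral_flux hα0 hα2]

/-- The L¹ bound for small s and the Lipschitz bound with factor 1/s² for large s, joined into one.
-/
theorem MemClass.abs_flux_le (hf : MemClass f) {B : ℝ} (hB : ∀ x, |deriv f x| ≤ B) {s : ℝ}
    (hs : 0 < s) (x : ℝ) : |flux s f x| ≤ 2 * ((∫ x, |f x|) + B) / (s ^ 2 + 1) := by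
  have h1 := abs_flux_le_integral hs hf.integrable x
  have h2 := hf.tame.abs_flux_le_div hs hB x
  have hY : 0 ≤ ∫ x, |f x| := integral_nonneg fun x => abs_nonneg _
  have hB0 : 0 ≤ B := (abs_nonneg _).trans (hB 0)
  rw [le_div_iff₀ (by positivity)] at h2 ⊢
  nlinarith [abs_nonneg (flux s f x)]

theorem mixture_fubini_of_integrable (hα0 : 0 < α) (hα2 : α < 2) (hf : MemClass f)
    (hb : Measurable b) (hbi : Integrable b) :
    IntegrableOn (fun s : ℝ => s ^ (1 - α) * ∫ x, flux s f x * b x) (Ioi 0) ∧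
      mixConst α * ∫ x, drift α f x * b x =
        ∫ s in Ioi (0 : ℝ), s ^ (1 - α) * ∫ x, flux s f x * b x := by
  obtain ⟨B, hB⟩ := hf.tame.bdd_deriv
  have := mixture_fubini hα0 hα2 hf hb MeasurableSet.univ
    (c := fun x => 2 * ((∫ x, |f x|) + B) * |b x|) (hbi.abs.const_mul _).integrableOn
    (fun s hs x _ => by
      rw [abs_mul, mul_div_right_comm]
      exact mul_le_mul_of_nonneg_right (hf.abs_flux_le hB hs x) (abs_nonneg _))
  simpa using this

/-- A bound for a form of the drift from bounds for the forms of the resolvents. -/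
theorem mixture_bound (hα0 : 0 < α) (hα2 : α < 2) (hf : MemClass f)
    (hb : Measurable b) (hbi : Integrable b) {R : ℝ} {ρ : ℝ → ℝ}
    (hρi : IntegrableOn (fun s : ℝ => s ^ (1 - α) * ρ s) (Ioi 0))
    (hρ : ∀ s : ℝ, 0 < s → |∫ x, flux s f x * b x| ≤ R * ρ s) :
    mixConst α * |∫ x, drift α f x * b x| ≤ R * ∫ s in Ioi (0 : ℝ), s ^ (1 - α) * ρ s := by
  have h := mixture_fubini_of_integrable hα0 hα2 hf hb hbi
  rw [← abs_of_pos (mixConst_pos hα0 hα2), ← abs_mul, h.2, ← integral_const_mul]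
  refine abs_setIntegral_le_of_abs_le measurableSet_Ioi (hρi.const_mul R) fun s hs => ?_
  have hs0 : (0 : ℝ) < s := hs
  rw [abs_mul, abs_of_pos (by positivity : 0 < s ^ (1 - α)), mul_left_comm]
  exact mul_le_mul_of_nonneg_left (hρ s hs) (by positivity)

/-- The hypotheses on the multiplier `a` in the energy estimates. -/
structure GoodMultiplier (B : ℝ) (a : ℝ → ℝ) : Prop where
  differentiable : Differentiable ℝ a
  continuous_deriv : Continuous (deriv a)
  integrable : Integrable a
  abs_le : ∀ x, |a x| ≤ B
  abs_deriv_le : ∀ x, |deriv a x| ≤ B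
  integral_abs_le : ∫ x, |a x| ≤ B

theorem PointwiseBounds.goodMultiplier {B : ℝ} (hf : MemClass f) (h : PointwiseBounds α B f) :
    GoodMultiplier B (deriv f) where
  differentiable x := (hf.hasDerivAt_deriv x).1.differentiableAt
  continuous_deriv := hf.continuous_deriv_deriv
  integrable := hf.integrable_deriv
  abs_le := h.abs_deriv_le
  abs_deriv_le := h.abs_deriv_deriv_le
  integral_abs_le := h.integral_abs_deriv_le

namespace GoodMultiplier

variable {a : ℝ → ℝ} {B : ℝ}

theorem nonneg (ha : GoodMultiplier B a) : 0 ≤ B := (abs_nonneg _).trans (ha.abs_le 0)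

theorem integrable_sq (ha : GoodMultiplier B a) : Integrable (fun x => a x ^ 2) := by
  simpa [sq] using integrable_mul_of_abs_le ha.differentiable.continuous.aestronglyMeasurable
    ha.abs_le ha.integrable

theorem sqrt_integral_sq_le (ha : GoodMultiplier B a) : √(∫ x, a x ^ 2) ≤ B := by
  rw [Real.sqrt_le_left ha.nonneg]
  calc ∫ x, a x ^ 2 ≤ ∫ x, B * |a x| := by
        refine integral_mono ha.integrable_sq (ha.integrable.abs.const_mul B) fun x => ?_
        simp only
        rw [← sq_abs, sq]
        exact mul_le_mul_of_nonneg_right (ha.abs_le x) (abs_nonneg _)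
    _ = B * ∫ x, |a x| := integral_const_mul _ _
    _ ≤ B ^ 2 := by
        rw [sq]
        exact mul_le_mul_of_nonneg_left ha.integral_abs_le ha.nonneg

/-- The commutator estimate, used for s ≥ 1: its factor 1/s² is integrable against s^{1-α} at
infinity for every α > 0. -/
theorem abs_flux_form_le (ha : GoodMultiplier B a) (hf : MemClass f) {s : ℝ} (hs : 0 < s) :
    |∫ x, flux s f x * (a x * f x)| ≤ B * (∫ x, f x ^ 2) / s ^ 2 := by
  have := hf.tame.abs_integral_mul_flux_le hs (fun x => (ha.differentiable x).hasDerivAt)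
    ha.continuous_deriv ha.abs_le ha.abs_deriv_le
  simpa only [mul_comm] using this

/-- Used for s ≤ 1, where no cancellation is needed and a pointwise bound of the flux is enough. -/
theorem abs_flux_form_le_of_abs_le (ha : GoodMultiplier B a) (hf : MemClass f) {s Λ : ℝ}
    (hΛ : ∀ x, |flux s f x| ≤ Λ) :
    |∫ x, flux s f x * (a x * f x)| ≤ Λ * ∫ x, |a x| * |f x| := by
  have hi : Integrable (fun x => |a x| * |f x|) := by
    have := (integrable_mul_of_abs_le ha.differentiable.continuous.aestronglyMeasurable
      ha.abs_le hf.integrable).abs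
    simpa only [abs_mul] using this
  rw [← integral_const_mul]
  refine abs_integral_le_of_abs_le (hi.const_mul Λ) fun x => ?_
  rw [abs_mul, abs_mul]
  exact mul_le_mul_of_nonneg_right (hΛ x) (by positivity)

end GoodMultiplier

theorem inv_sq_le_two_div {s : ℝ} (hs : 1 ≤ s) : 1 / s ^ 2 ≤ 2 / (s ^ 2 + 1) := by
  rw [div_le_div_iff₀ (by positivity) (by positivity)]
  nlinarith

theorem one_le_two_div {s : ℝ} (h0 : 0 < s) (hs : s ≤ 1) : 1 ≤ 2 / (s ^ 2 + 1) := by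
  rw [le_div_iff₀ (by positivity)]
  nlinarith

/-- The form estimate in `L²` alone, in the range `α ≤ 1`. -/
theorem exists_drift_form_le_of_le_one (hα0 : 0 < α) (hα1 : α ≤ 1) :
    ∃ K : ℝ, 0 ≤ K ∧ ∀ (B : ℝ) (a f : ℝ → ℝ), GoodMultiplier B a → MemClass f →
      |∫ x, drift α f x * (a x * f x)| ≤ K * B * ∫ x, f x ^ 2 := by
  have hα2 : α < 2 := by linarith
  have hmp := mixConst_pos hα0 hα2
  -- The first summand covers the bound 1/s² for s ≥ 1, the second the bound s^{-1/2} for s ≤ 1. The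
  -- second shifts α to α + 1/2, which must stay below 2; this holds for α ≤ 1.
  set ρ : ℝ → ℝ := fun s => 2 / (s ^ 2 + 1) + 2 * s ^ (-(1 / 2) : ℝ) / (s ^ 2 + 1) with hρ
  have hρi : IntegrableOn (fun s : ℝ => s ^ (1 - α) * ρ s) (Ioi 0) := by
    have h1 := (integrableOn_mix hα0 hα2).const_mul 2
    have h2 := (integrableOn_mix (α := α + 1 / 2) (by linarith) (by linarith)).const_mul 2
    refine IntegrableOn.congr_fun (h1.add h2) (fun s hs => ?_) measurableSet_Ioi
    have hs0 : (0 : ℝ) < s := hs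
    have e : s ^ (1 - (α + 1 / 2)) = s ^ (1 - α) * s ^ (-(1 / 2) : ℝ) := by
      rw [← Real.rpow_add hs0]
      congr 1
      ring
    simp only [Pi.add_apply, hρ, e]
    ring
  set L := ∫ s in Ioi (0 : ℝ), s ^ (1 - α) * ρ s with hL
  have hL0 : 0 ≤ L := setIntegral_nonneg measurableSet_Ioi fun s hs => by
    have hs0 : (0 : ℝ) < s := hs
    simp only [hρ]
    positivity
  refine ⟨L / mixConst α, by positivity, fun B a f ha hf => ?_⟩
  have hE : 0 ≤ ∫ x, f x ^ 2 := integral_nonneg fun x => sq_nonneg _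
  have hB := ha.nonneg
  have hm : Measurable (fun x => a x * f x) :=
    (ha.differentiable.continuous.mul hf.contDiff.continuous).measurable
  have hi := integrable_mul_of_abs_le ha.differentiable.continuous.aestronglyMeasurable
    ha.abs_le hf.integrable
  have key := mixture_bound hα0 hα2 hf hm hi (R := B * ∫ x, f x ^ 2) hρi fun s hs => by
    have hr : 0 < s ^ (-(1 / 2) : ℝ) := by positivity
    rcases le_total s 1 with h | h
    · have h1 := ha.abs_flux_form_le_of_abs_le hf (s := s)
        (abs_flux_le_sqrt hs hf.contDiff.continuous hf.tame.integrable_sq)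
      have h2 := integral_abs_mul_le_sqrt_mul_sqrt (μ := volume)
        ha.differentiable.continuous.aestronglyMeasurable
        hf.contDiff.continuous.aestronglyMeasurable ha.integrable_sq hf.tame.integrable_sq
      have h3 := ha.sqrt_integral_sq_le
      have e : s ^ (-(1 / 2) : ℝ) = (√s)⁻¹ := by
        rw [Real.rpow_neg hs.le, Real.sqrt_eq_rpow]
      calc _ ≤ _ := h1
        _ ≤ √(∫ y, f y ^ 2) / √s * (B * √(∫ y, f y ^ 2)) := by
            gcongr
            exact h2.trans (mul_le_mul_of_nonneg_right h3 (Real.sqrt_nonneg _))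
        _ = B * (√(∫ y, f y ^ 2) * √(∫ y, f y ^ 2)) * (√s)⁻¹ := by ring
        _ = B * (∫ y, f y ^ 2) * s ^ (-(1 / 2) : ℝ) := by rw [Real.mul_self_sqrt hE, e]
        _ ≤ _ := by
            gcongr
            simp only [hρ]
            have h4 := mul_le_mul_of_nonneg_right (one_le_two_div hs h) hr.le
            have h5 : 0 ≤ 2 / (s ^ 2 + 1) := by positivity
            rw [one_mul, div_mul_eq_mul_div] at h4
            linarith
    · refine (ha.abs_flux_form_le hf hs).trans ?_
      rw [mul_div_assoc, mul_assoc, mul_div_assoc']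
      have h4 := inv_sq_le_two_div h
      have h5 : 0 ≤ 2 * s ^ (-(1 / 2) : ℝ) / (s ^ 2 + 1) := by positivity
      have h6 : 1 / s ^ 2 ≤ ρ s := by
        simp only [hρ]
        linarith
      calc _ = B * (∫ x, f x ^ 2) * (1 / s ^ 2) := by ring
        _ ≤ _ := by rw [← mul_assoc]; gcongr
  rw [div_mul_eq_mul_div, div_mul_eq_mul_div, le_div_iff₀ hmp, mul_comm]
  refine key.trans_eq ?_
  rw [← hL]
  ring

/-- The form estimate in `L¹ ∩ L²`. -/
theorem exists_drift_form_le (hα0 : 0 < α) (hα2 : α < 2) :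
    ∃ K : ℝ, 0 ≤ K ∧ ∀ (B : ℝ) (a f : ℝ → ℝ), GoodMultiplier B a → MemClass f →
      |∫ x, drift α f x * (a x * f x)| ≤ K * B * ((∫ x, f x ^ 2) + (∫ x, |f x|) ^ 2) := by
  have hmp := mixConst_pos hα0 hα2
  have hρi : IntegrableOn (fun s : ℝ => s ^ (1 - α) * (2 / (s ^ 2 + 1))) (Ioi 0) := by
    refine IntegrableOn.congr_fun ((integrableOn_mix hα0 hα2).const_mul 2) (fun s _ => ?_)
      measurableSet_Ioi
    ring
  set L := ∫ s in Ioi (0 : ℝ), s ^ (1 - α) * (2 / (s ^ 2 + 1)) with hL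
  have hL0 : 0 ≤ L := setIntegral_nonneg measurableSet_Ioi fun s hs => by
    have hs0 : (0 : ℝ) < s := hs
    positivity
  refine ⟨L / mixConst α, by positivity, fun B a f ha hf => ?_⟩
  have hE : 0 ≤ ∫ x, f x ^ 2 := integral_nonneg fun x => sq_nonneg _
  have hY : 0 ≤ ∫ x, |f x| := integral_nonneg fun x => abs_nonneg _
  have hB := ha.nonneg
  have hm : Measurable (fun x => a x * f x) :=
    (ha.differentiable.continuous.mul hf.contDiff.continuous).measurable
  have hi := integrable_mul_of_abs_le ha.differentiable.continuous.aestronglyMeasurable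
    ha.abs_le hf.integrable
  have key := mixture_bound hα0 hα2 hf hm hi
    (R := B * ((∫ x, f x ^ 2) + (∫ x, |f x|) ^ 2)) hρi fun s hs => by
    -- For s ≤ 1 the L¹ bound of the flux replaces the L² one, so no negative power of s appears and
    -- all α < 2 are admitted.
    rcases le_total s 1 with h | h
    · refine (ha.abs_flux_form_le_of_abs_le hf
        (abs_flux_le_integral hs hf.integrable)).trans ?_
      have h1 : ∫ x, |a x| * |f x| ≤ B * ∫ x, |f x| := by
        rw [← integral_const_mul]
        refine integral_mono (by simpa only [abs_mul] using hi.abs)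
          (hf.integrable.abs.const_mul B) fun x => ?_
        exact mul_le_mul_of_nonneg_right (ha.abs_le x) (abs_nonneg _)
      calc _ ≤ (∫ x, |f x|) * (B * ∫ x, |f x|) := by gcongr
        _ = B * (∫ x, |f x|) ^ 2 * 1 := by ring
        _ ≤ B * ((∫ x, f x ^ 2) + (∫ x, |f x|) ^ 2) * (2 / (s ^ 2 + 1)) := by
            gcongr
            · linarith
            · exact one_le_two_div hs h
    · refine (ha.abs_flux_form_le hf hs).trans ?_
      calc _ = B * (∫ x, f x ^ 2) * (1 / s ^ 2) := by ring
        _ ≤ B * ((∫ x, f x ^ 2) + (∫ x, |f x|) ^ 2) * (2 / (s ^ 2 + 1)) := by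
            refine mul_le_mul ?_ (inv_sq_le_two_div h) (by positivity) (by positivity)
            gcongr
            nlinarith
  rw [div_mul_eq_mul_div, div_mul_eq_mul_div, le_div_iff₀ hmp, mul_comm]
  refine key.trans_eq ?_
  rw [← hL]
  ring

/-- The `L¹` bound of the stretching term, in the range `1 < α`. -/
theorem exists_integral_abs_drift_mul_le (hα1 : 1 < α) (hα2 : α < 2) :
    ∃ K : ℝ, 0 ≤ K ∧ ∀ (B : ℝ) (a f : ℝ → ℝ), GoodMultiplier B a → MemClass f →
      ∫ x, |drift α f x| * |a x| ≤ K * B * (√(∫ x, f x ^ 2) + ∫ x, |f x|) := by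
  have hα0 : 0 < α := by linarith
  have hmp := mixConst_pos hα0 hα2
  -- With absolute values inside there is no cancellation, and the L² bound of the flux decays only
  -- like 1/s for s ≥ 1. The second summand covers this and is integrable against s^{1-α} because α
  -- > 1.
  set ρ : ℝ → ℝ := fun s => 2 / (s ^ 2 + 1) + 2 * s / (s ^ 2 + 1) with hρ
  have hρi : IntegrableOn (fun s : ℝ => s ^ (1 - α) * ρ s) (Ioi 0) := by
    have h1 := (integrableOn_mix hα0 hα2).const_mul 2
    have h2 := (integrableOn_mix (α := α - 1) (by linarith) (by linarith)).const_mul 2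
    refine IntegrableOn.congr_fun (h1.add h2) (fun s hs => ?_) measurableSet_Ioi
    have hs0 : (0 : ℝ) < s := hs
    have e : s ^ (1 - (α - 1)) = s ^ (1 - α) * s := by
      nth_rw 3 [← Real.rpow_one s]
      rw [← Real.rpow_add hs0]
      congr 1
      ring
    simp only [Pi.add_apply, hρ, e]
    ring
  set L := ∫ s in Ioi (0 : ℝ), s ^ (1 - α) * ρ s with hL
  have hL0 : 0 ≤ L := setIntegral_nonneg measurableSet_Ioi fun s hs => by
    have hs0 : (0 : ℝ) < s := hs
    simp only [hρ]
    positivity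
  refine ⟨L / mixConst α, by positivity, fun B a f ha hf => ?_⟩
  have hY : 0 ≤ ∫ x, |f x| := integral_nonneg fun x => abs_nonneg _
  have hB := ha.nonneg
  have hdc : Continuous (drift α f) := (hf.differentiable_drift hα0 hα2).continuous
  -- Putting the sign of the drift into the multiplier turns the L¹ norm into a linear form, to
  -- which the mixture formula applies.
  set b : ℝ → ℝ := fun x => if 0 ≤ drift α f x then |a x| else -|a x| with hbdef
  have hab : ∀ x, |b x| = |a x| := by
    intro x
    simp only [hbdef]
    split_ifs <;> simp
  have hm : Measurable b :=
    Measurable.ite (measurableSet_le measurable_const hdc.measurable)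
      ha.differentiable.continuous.abs.measurable ha.differentiable.continuous.abs.neg.measurable
  have hi : Integrable b := by
    refine ha.integrable.abs.mono' hm.aestronglyMeasurable (ae_of_all _ fun x => ?_)
    rw [Real.norm_eq_abs, hab]
  have hdb : ∀ x, drift α f x * b x = |drift α f x| * |a x| := by
    intro x
    simp only [hbdef]
    split_ifs with h
    · rw [abs_of_nonneg h]
    · rw [abs_of_neg (not_le.1 h)]
      ring
  have key := mixture_bound hα0 hα2 hf hm hi
    (R := B * (√(∫ x, f x ^ 2) + ∫ x, |f x|)) hρi fun s hs => by
    have hfc := continuous_flux hs hf.contDiff.continuous hf.integrable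
    have hρ1 : 0 ≤ 2 / (s ^ 2 + 1) := by positivity
    have hρ2 : 0 ≤ 2 * s / (s ^ 2 + 1) := by positivity
    have hfi : Integrable (fun x => |flux s f x| * |a x|) := by
      have := (integrable_mul_of_abs_le hfc.aestronglyMeasurable
        (abs_flux_le_integral hs hf.integrable) ha.integrable).abs
      simpa only [abs_mul] using this
    have h0 : |∫ x, flux s f x * b x| ≤ ∫ x, |flux s f x| * |a x| :=
      abs_integral_le_of_abs_le hfi fun x => by rw [abs_mul, hab]
    refine h0.trans ?_
    rcases le_total s 1 with h | h
    · calc _ ≤ ∫ x, (∫ x, |f x|) * |a x| := by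
            refine integral_mono hfi (ha.integrable.abs.const_mul _) fun x => ?_
            exact mul_le_mul_of_nonneg_right (abs_flux_le_integral hs hf.integrable x)
              (abs_nonneg _)
        _ = (∫ x, |f x|) * ∫ x, |a x| := integral_const_mul _ _
        _ ≤ (∫ x, |f x|) * B := mul_le_mul_of_nonneg_left ha.integral_abs_le hY
        _ = B * (∫ x, |f x|) * 1 := by ring
        _ ≤ _ := by
            have h3 := one_le_two_div hs h
            have h4 := Real.sqrt_nonneg (∫ x, f x ^ 2)
            gcongr
            · linarith
            · simp only [hρ]
              linarith
    · have h1 := integral_abs_mul_le_sqrt_mul_sqrt (μ := volume) hfc.aestronglyMeasurable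
        ha.differentiable.continuous.aestronglyMeasurable (hf.tame.integrable_flux_sq hs)
        ha.integrable_sq
      have h2 : √(∫ x, flux s f x ^ 2) ≤ √(∫ x, f x ^ 2) / s := by
        have := Real.sqrt_le_sqrt (hf.tame.integral_flux_sq_le hs)
        rwa [Real.sqrt_div' _ (sq_nonneg s), Real.sqrt_sq hs.le] at this
      have h3 : 1 / s ≤ ρ s := by
        have : 1 / s ≤ 2 * s / (s ^ 2 + 1) := by
          rw [div_le_div_iff₀ hs (by positivity)]
          nlinarith
        simp only [hρ]
        linarith
      calc _ ≤ _ := h1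
        _ ≤ √(∫ x, f x ^ 2) / s * B := by
            gcongr
            exact ha.sqrt_integral_sq_le
        _ = B * √(∫ x, f x ^ 2) * (1 / s) := by ring
        _ ≤ _ := by
            gcongr
            linarith
  simp only [hdb] at key
  rw [abs_of_nonneg (integral_nonneg fun x => by positivity)] at key
  rw [div_mul_eq_mul_div, div_mul_eq_mul_div, le_div_iff₀ hmp, mul_comm]
  refine key.trans_eq ?_
  rw [← hL]
  ring

end DriftForms

/-! ### Uniqueness -/

/-- The time derivative of the difference of two solutions. -/
def diffRate (α : ℝ) (f g : ℝ → ℝ) (x : ℝ) : ℝ :=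
  drift α g x * deriv g x - drift α f x * deriv f x

section Uniqueness

variable {α B : ℝ} {f g : ℝ → ℝ}

theorem integrable_drift_mul_deriv (hα0 : 0 < α) (hα2 : α < 2) (hf : MemClass f)
    (hfB : PointwiseBounds α B f) : Integrable (fun x => drift α f x * deriv f x) :=
  integrable_mul_of_abs_le (hf.differentiable_drift hα0 hα2).continuous.aestronglyMeasurable
    hfB.abs_drift_le hf.integrable_deriv

theorem integrable_diffRate (hα0 : 0 < α) (hα2 : α < 2) (hf : MemClass f) (hg : MemClass g)
    (hfB : PointwiseBounds α B f) (hgB : PointwiseBounds α B g) : Integrable (diffRate α f g) :=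
  (integrable_drift_mul_deriv hα0 hα2 hg hgB).sub (integrable_drift_mul_deriv hα0 hα2 hf hfB)

theorem integral_abs_drift_mul_deriv_le (hα0 : 0 < α) (hα2 : α < 2) (hf : MemClass f)
    (hfB : PointwiseBounds α B f) : ∫ x, |drift α f x * deriv f x| ≤ B ^ 2 := by
  have hB : 0 ≤ B := (abs_nonneg _).trans (hfB.abs_le 0)
  calc _ ≤ ∫ x, B * |deriv f x| := by
        refine integral_mono (integrable_drift_mul_deriv hα0 hα2 hf hfB).abs
          (hf.integrable_deriv.abs.const_mul B) fun x => ?_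
        simp only [abs_mul]
        exact mul_le_mul_of_nonneg_right (hfB.abs_drift_le x) (abs_nonneg _)
    _ = B * ∫ x, |deriv f x| := integral_const_mul _ _
    _ ≤ B ^ 2 := by
        rw [sq]
        exact mul_le_mul_of_nonneg_left hfB.integral_abs_deriv_le hB

theorem integral_abs_diffRate_le (hα0 : 0 < α) (hα2 : α < 2) (hf : MemClass f) (hg : MemClass g)
    (hfB : PointwiseBounds α B f) (hgB : PointwiseBounds α B g) :
    ∫ x, |diffRate α f g x| ≤ 2 * B ^ 2 := by
  have i1 := (integrable_drift_mul_deriv hα0 hα2 hg hgB).abs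
  have i2 := (integrable_drift_mul_deriv hα0 hα2 hf hfB).abs
  calc _ ≤ ∫ x, (|drift α g x * deriv g x| + |drift α f x * deriv f x|) :=
        integral_mono (integrable_diffRate hα0 hα2 hf hg hfB hgB).abs (i1.add i2)
          fun x => abs_sub _ _
    _ = _ := integral_add i1 i2
    _ ≤ 2 * B ^ 2 := by
        linarith [integral_abs_drift_mul_deriv_le hα0 hα2 hg hgB,
          integral_abs_drift_mul_deriv_le hα0 hα2 hf hfB]

/-- The renormalized transport identity for the difference of two solutions. -/
theorem integral_renormalized_diffRate (hα0 : 0 < α) (hα2 : α < 2) (hf : MemClass f)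
    (hg : MemClass g) (hfB : PointwiseBounds α B f) (hgB : PointwiseBounds α B g)
    {G G' : ℝ → ℝ} (hG : ∀ y, HasDerivAt G (G' y) y) (hG' : Continuous G') {C : ℝ}
    (hC' : ∀ y, |y| ≤ 2 * B → |G' y| ≤ C) (hC : ∀ y, |y| ≤ 2 * B → |G y| ≤ C * |y|) :
    ∫ x, G' (f x - g x) * diffRate α f g x =
      -(∫ x, drift α (fun x => f x - g x) x * (deriv f x * G' (f x - g x))) +
        ∫ x, deriv (drift α g) x * G (f x - g x) := by
  have hw := hf.sub hg
  have hwb : ∀ x, |f x - g x| ≤ 2 * B := fun x =>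
    (abs_sub _ _).trans (by linarith [hfB.abs_le x, hgB.abs_le x])
  have hwc : Continuous fun x => f x - g x := hw.contDiff.continuous
  have hGc : Continuous G := continuous_iff_continuousAt.2 fun y => (hG y).continuousAt
  have hdw : ∀ x, HasDerivAt (fun x => f x - g x) (deriv f x - deriv g x) x := fun x =>
    (hf.differentiable x).hasDerivAt.sub (hg.differentiable x).hasDerivAt
  have hdG : ∀ x, HasDerivAt (fun x => G (f x - g x))
      (G' (f x - g x) * (deriv f x - deriv g x)) x := fun x => (hG _).comp x (hdw x)
  have iG : Integrable (fun x => G (f x - g x)) := by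
    refine (hw.integrable.abs.const_mul C).mono' (hGc.comp hwc).aestronglyMeasurable
      (ae_of_all _ fun x => hC _ (hwb x))
  have iG' : Integrable (fun x => G' (f x - g x) * (deriv f x - deriv g x)) :=
    integrable_mul_of_abs_le (hG'.comp hwc).aestronglyMeasurable (fun x => hC' _ (hwb x))
      (hf.integrable_deriv.sub hg.integrable_deriv)
  have hdg := hg.differentiable_drift hα0 hα2
  -- With w = f - g, the rate is -u[w] f' - u[g] w'. The second term times G'(w) is -u[g] (G(w))',
  -- and integration by parts moves the derivative onto u[g].
  have ibp := integral_mul_deriv_eq_neg (fun x => (hdg x).hasDerivAt)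
    (hg.continuous_deriv_drift hα0 hα2) hgB.abs_drift_le hgB.abs_deriv_drift_le hdG iG iG'
  have i2 := integrable_mul_of_abs_le hdg.continuous.aestronglyMeasurable hgB.abs_drift_le iG'
  have i1 : Integrable (fun x => drift α (fun x => f x - g x) x * (deriv f x * G' (f x - g x))) := by
    have h1 : Integrable (fun x => G' (f x - g x) * deriv f x) :=
      integrable_mul_of_abs_le (hG'.comp hwc).aestronglyMeasurable (fun x => hC' _ (hwb x))
        hf.integrable_deriv
    have h2 : ∀ x, |drift α (fun x => f x - g x) x| ≤ 2 * B := fun x => by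
      rw [drift_sub hα0 hα2 hf hg]
      exact (abs_sub _ _).trans (by linarith [hfB.abs_drift_le x, hgB.abs_drift_le x])
    have := integrable_mul_of_abs_le
      (hw.differentiable_drift hα0 hα2).continuous.aestronglyMeasurable h2 h1
    simpa only [mul_comm] using this
  rw [← neg_eq_iff_eq_neg.2 ibp, ← integral_neg, ← integral_neg, ← integral_add (by exact i1.neg) (by exact i2.neg)]
  congr with x
  rw [drift_sub hα0 hα2 hf hg, diffRate]
  ring

variable {T t : ℝ} {θ₀ : ℝ → ℝ} {θ η : ℝ → ℝ → ℝ}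

/-- The chain rule in time, integrated over space; the common datum and G(0) = 0 remove the initial
term. G = y² gives the energy, smooth approximations of |y| give the L¹ norm. -/
theorem renormalized_evolution (hα0 : 0 < α) (hα2 : α < 2) (hθ : IsSolution α θ₀ T θ)
    (hη : IsSolution α θ₀ T η) (ht : t < T)
    (hθB : ∀ τ ∈ Icc 0 t, PointwiseBounds α B (θ τ))
    (hηB : ∀ τ ∈ Icc 0 t, PointwiseBounds α B (η τ))
    {G G' : ℝ → ℝ} (hG0 : G 0 = 0) (hG : ∀ y, HasDerivAt G (G' y) y) (hG' : Continuous G') {C : ℝ}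
    (hC' : ∀ y, |y| ≤ 2 * B → |G' y| ≤ C) (hC : ∀ y, |y| ≤ 2 * B → |G y| ≤ C * |y|) :
    ∀ τ ∈ Icc 0 t,
      IntervalIntegrable (fun r => ∫ x, G' (θ r x - η r x) * diffRate α (θ r) (η r) x)
        volume 0 τ ∧
      ∫ x, G (θ τ x - η τ x) =
        ∫ r in (0 : ℝ)..τ, ∫ x, G' (θ r x - η r x) * diffRate α (θ r) (η r) x := by
  intro τ hτ
  have hsub : Icc 0 τ ⊆ Ico 0 T := fun r hr => ⟨hr.1, (hr.2.trans hτ.2).trans_lt ht⟩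
  have hsub' : Icc 0 τ ⊆ Icc 0 t := Icc_subset_Icc_right hτ.2
  have hGc : Continuous G := continuous_iff_continuousAt.2 fun y => (hG y).continuousAt
  have hcθ := hθ.contCurve
  have hcη := hη.contCurve
  have hwb : ∀ r ∈ Icc 0 τ, ∀ x, |θ r x - η r x| ≤ 2 * B := fun r hr x =>
    (abs_sub _ _).trans (by
      linarith [(hθB r (hsub' hr)).abs_le x, (hηB r (hsub' hr)).abs_le x])
  have hGi : ∀ r ∈ Icc 0 τ, Integrable (fun x => G (θ r x - η r x)) := by
    intro r hr
    have hw := (hθ.memClass r (hsub hr)).sub (hη.memClass r (hsub hr))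
    exact (hw.integrable.abs.const_mul C).mono'
      (hGc.comp hw.contDiff.continuous).aestronglyMeasurable
      (ae_of_all _ fun x => hC _ (hwb r hr x))
  have hC0 : 0 ≤ C := (abs_nonneg _).trans (hC' 0 (by
    rw [abs_zero]
    linarith [(abs_nonneg _).trans ((hθB τ hτ).abs_le 0)]))
  have hRi : ∀ r ∈ Icc 0 τ, Integrable (fun x => G' (θ r x - η r x) * diffRate α (θ r) (η r) x) := by
    intro r hr
    have m1 := hθ.memClass r (hsub hr)
    have m2 := hη.memClass r (hsub hr)
    exact integrable_mul_of_abs_le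
      (hG'.comp (m1.sub m2).contDiff.continuous).aestronglyMeasurable
      (fun x => hC' _ (hwb r hr x))
      (integrable_diffRate hα0 hα2 m1 m2 (hθB r (hsub' hr)) (hηB r (hsub' hr)))
  have key := integral_sub_eq_integral_deriv (Φ := fun r x => G (θ r x - η r x))
    (Φ' := fun r x => G' (θ r x - η r x) * diffRate α (θ r) (η r) x) (B := C * (2 * B ^ 2))
    hτ.1 MeasurableSet.univ ?_ ?_ (fun r hr => (hRi r hr).integrableOn) ?_
    (hGi 0 ⟨le_rfl, hτ.1⟩).integrableOn (hGi τ ⟨hτ.1, le_rfl⟩).integrableOn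
  · simp only [Measure.restrict_univ] at key
    refine ⟨key.1, ?_⟩
    rw [← key.2]
    simp [hθ.initial, hη.initial, hG0]
  · intro x _ r hr
    have h1 := ((hθ.equation r (hsub hr) x).sub (hη.equation r (hsub hr) x)).mono hsub
    have h2 := HasDerivAt.comp_hasDerivWithinAt (h₂ := G) r (hG _) h1
    refine h2.congr_deriv ?_
    rw [diffRate, Pi.sub_apply]
    ring
  · have h1 := hcθ.continuousOn_self
    have h2 := hcη.continuousOn_self
    have h3 := (hcη.continuousOn_drift hα0 hα2).mul hcη.continuousOn_deriv
    have h4 := (hcθ.continuousOn_drift hα0 hα2).mul hcθ.continuousOn_deriv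
    have h5 := (hG'.comp_continuousOn (h1.sub h2)).mul (h3.sub h4)
    exact h5.mono (prod_mono hsub Subset.rfl)
  · intro r hr
    have m1 := hθ.memClass r (hsub hr)
    have m2 := hη.memClass r (hsub hr)
    have b1 := hθB r (hsub' hr)
    have b2 := hηB r (hsub' hr)
    rw [Measure.restrict_univ]
    calc _ ≤ ∫ x, C * |diffRate α (θ r) (η r) x| := by
          refine integral_mono (hRi r hr).abs
            ((integrable_diffRate hα0 hα2 m1 m2 b1 b2).abs.const_mul C) fun x => ?_
          simp only [abs_mul]
          exact mul_le_mul_of_nonneg_right (hC' _ (hwb r hr x)) (abs_nonneg _)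
      _ = C * ∫ x, |diffRate α (θ r) (η r) x| := integral_const_mul _ _
      _ ≤ _ := mul_le_mul_of_nonneg_left (integral_abs_diffRate_le hα0 hα2 m1 m2 b1 b2) hC0

/-- The energy inequality for the difference of two solutions. -/
theorem energy_evolution (hα0 : 0 < α) (hα2 : α < 2) (hθ : IsSolution α θ₀ T θ)
    (hη : IsSolution α θ₀ T η) (ht : t < T)
    (hθB : ∀ τ ∈ Icc 0 t, PointwiseBounds α B (θ τ))
    (hηB : ∀ τ ∈ Icc 0 t, PointwiseBounds α B (η τ)) {Z : ℝ → ℝ} {K : ℝ}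
    (hZ : ContinuousOn Z (Icc 0 t))
    (hEZ : ∀ τ ∈ Icc 0 t, ∫ x, (θ τ x - η τ x) ^ 2 ≤ Z τ)
    (hK : ∀ τ ∈ Icc 0 t, |∫ x, drift α (fun x => θ τ x - η τ x) x *
      (deriv (θ τ) x * (θ τ x - η τ x))| ≤ K * B * Z τ) :
    ∀ τ ∈ Icc 0 t, ∫ x, (θ τ x - η τ x) ^ 2 ≤ (2 * K * B + B) * ∫ r in (0 : ℝ)..τ, Z r := by
  intro τ hτ
  have hB : 0 ≤ B := (abs_nonneg _).trans ((hθB τ hτ).abs_le 0)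
  have hev := renormalized_evolution hα0 hα2 hθ hη ht hθB hηB (G := fun y => y ^ 2)
    (G' := fun y => 2 * y) (by simp) (fun y => by simpa using hasDerivAt_pow 2 y) (by fun_prop)
    (C := 4 * B) (fun y hy => by rw [abs_mul, abs_two]; linarith)
    (fun y hy => by
      rw [abs_pow, sq]
      exact mul_le_mul_of_nonneg_right (hy.trans (by linarith)) (abs_nonneg _)) τ hτ
  have hsub : Icc 0 τ ⊆ Icc 0 t := Icc_subset_Icc_right hτ.2
  rw [hev.2, ← intervalIntegral.integral_const_mul]
  refine intervalIntegral.integral_mono_on hτ.1 hev.1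
    (((hZ.mono hsub).intervalIntegrable_of_Icc hτ.1).const_mul _) fun r hr => ?_
  have hr' : r ∈ Ico 0 T := ⟨hr.1, (hr.2.trans hτ.2).trans_lt ht⟩
  have m1 := hθ.memClass r hr'
  have m2 := hη.memClass r hr'
  have b1 := hθB r (hsub hr)
  have b2 := hηB r (hsub hr)
  rw [integral_renormalized_diffRate hα0 hα2 m1 m2 b1 b2 (G := fun y => y ^ 2)
    (G' := fun y => 2 * y) (fun y => by simpa using hasDerivAt_pow 2 y) (by fun_prop)
    (C := 4 * B) (fun y hy => by rw [abs_mul, abs_two]; linarith)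
    (fun y hy => by
      rw [abs_pow, sq]
      exact mul_le_mul_of_nonneg_right (hy.trans (by linarith)) (abs_nonneg _))]
  have e : ∫ x, drift α (fun x => θ r x - η r x) x * (deriv (θ r) x * (2 * (θ r x - η r x))) =
      2 * ∫ x, drift α (fun x => θ r x - η r x) x * (deriv (θ r) x * (θ r x - η r x)) := by
    rw [← integral_const_mul]
    congr with x
    ring
  rw [e]
  have h1 := (abs_le.1 (hK r (hsub hr))).1
  have h2 : ∫ x, deriv (drift α (η r)) x * (θ r x - η r x) ^ 2 ≤
      B * ∫ x, (θ r x - η r x) ^ 2 := by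
    have i := (m1.sub m2).tame.integrable_sq
    rw [← integral_const_mul]
    refine integral_mono (integrable_mul_of_abs_le
      (m2.continuous_deriv_drift hα0 hα2).aestronglyMeasurable b2.abs_deriv_drift_le i)
      (i.const_mul B) fun x => ?_
    exact mul_le_mul_of_nonneg_right ((le_abs_self _).trans (b2.abs_deriv_drift_le x))
      (sq_nonneg _)
  have h3 := mul_le_mul_of_nonneg_left (hEZ r (hsub hr)) hB
  linarith

/-- The `L¹` inequality for the difference of two solutions. -/
theorem integral_abs_evolution (hα0 : 0 < α) (hα2 : α < 2) (hθ : IsSolution α θ₀ T θ)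
    (hη : IsSolution α θ₀ T η) (ht : t < T)
    (hθB : ∀ τ ∈ Icc 0 t, PointwiseBounds α B (θ τ))
    (hηB : ∀ τ ∈ Icc 0 t, PointwiseBounds α B (η τ)) {Z : ℝ → ℝ} {K : ℝ}
    (hZ : ContinuousOn Z (Icc 0 t))
    (hYZ : ∀ τ ∈ Icc 0 t, ∫ x, |θ τ x - η τ x| ≤ Z τ)
    (hK : ∀ τ ∈ Icc 0 t, ∫ x, |drift α (fun x => θ τ x - η τ x) x| * |deriv (θ τ) x|
      ≤ K * B * Z τ) :
    ∀ τ ∈ Icc 0 t, ∫ x, |θ τ x - η τ x| ≤ (K * B + B) * ∫ r in (0 : ℝ)..τ, Z r := by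
  intro τ hτ
  have hB : 0 ≤ B := (abs_nonneg _).trans ((hθB τ hτ).abs_le 0)
  have hsub : Icc 0 τ ⊆ Icc 0 t := Icc_subset_Icc_right hτ.2
  have hsq : ∀ ε : ℝ, 0 < ε → ∀ y : ℝ, 0 < y ^ 2 + ε ^ 2 := fun ε hε y => by positivity
  have habs : ∀ ε : ℝ, 0 < ε → ∀ y : ℝ, |y| ≤ √(y ^ 2 + ε ^ 2) := fun ε hε y =>
    Real.abs_le_sqrt (by linarith [sq_nonneg ε])
  have hup : ∀ ε : ℝ, 0 < ε → ∀ y : ℝ, √(y ^ 2 + ε ^ 2) ≤ |y| + ε := fun ε hε y => by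
    rw [Real.sqrt_le_left (by positivity)]
    nlinarith [abs_nonneg y, sq_abs y, mul_nonneg (abs_nonneg y) hε.le]
  have hlow : ∀ ε : ℝ, 0 < ε → ∀ y : ℝ, ε ≤ √(y ^ 2 + ε ^ 2) := fun ε hε y =>
    Real.le_sqrt_of_sq_le (by linarith [sq_nonneg y])
  have hG : ∀ ε : ℝ, 0 < ε → ∀ y : ℝ, HasDerivAt (fun y => √(y ^ 2 + ε ^ 2) - ε)
      (y / √(y ^ 2 + ε ^ 2)) y := by
    intro ε hε y
    have h := (((hasDerivAt_pow 2 y).add_const (ε ^ 2)).sqrt (hsq ε hε y).ne').sub_const ε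
    refine h.congr_deriv ?_
    have := (Real.sqrt_pos.2 (hsq ε hε y)).ne'
    field_simp
    simp
  have hG' : ∀ ε : ℝ, 0 < ε → Continuous (fun y : ℝ => y / √(y ^ 2 + ε ^ 2)) := fun ε hε =>
    continuous_id.div (by fun_prop) fun y => (Real.sqrt_pos.2 (hsq ε hε y)).ne'
  have hC' : ∀ ε : ℝ, 0 < ε → ∀ y : ℝ, |y / √(y ^ 2 + ε ^ 2)| ≤ 1 := by
    intro ε hε y
    rw [abs_div, abs_of_nonneg (Real.sqrt_nonneg _),
      div_le_one (Real.sqrt_pos.2 (hsq ε hε y))]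
    exact habs ε hε y
  have hC : ∀ ε : ℝ, 0 < ε → ∀ y : ℝ, |√(y ^ 2 + ε ^ 2) - ε| ≤ 1 * |y| := by
    intro ε hε y
    rw [abs_of_nonneg (by linarith [hlow ε hε y])]
    linarith [hup ε hε y]
  -- The regularization √(y² + ε²) - ε is smooth, vanishes at 0, lies between 0 and |y| and has
  -- slope at most 1, so the bound is uniform in ε and dominated convergence recovers |y|.
  have hε : ∀ ε : ℝ, 0 < ε → ∫ x, (√((θ τ x - η τ x) ^ 2 + ε ^ 2) - ε) ≤
      (K * B + B) * ∫ r in (0 : ℝ)..τ, Z r := by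
    intro ε hε
    have hev := renormalized_evolution hα0 hα2 hθ hη ht hθB hηB
      (G := fun y => √(y ^ 2 + ε ^ 2) - ε) (by simp [Real.sqrt_sq hε.le]) (hG ε hε) (hG' ε hε)
      (C := 1) (fun y _ => hC' ε hε y) (fun y _ => hC ε hε y) τ hτ
    rw [hev.2, ← intervalIntegral.integral_const_mul]
    refine intervalIntegral.integral_mono_on hτ.1 hev.1
      (((hZ.mono hsub).intervalIntegrable_of_Icc hτ.1).const_mul _) fun r hr => ?_
    have hr' : r ∈ Ico 0 T := ⟨hr.1, (hr.2.trans hτ.2).trans_lt ht⟩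
    have m1 := hθ.memClass r hr'
    have m2 := hη.memClass r hr'
    have b1 := hθB r (hsub hr)
    have b2 := hηB r (hsub hr)
    have mw := m1.sub m2
    rw [integral_renormalized_diffRate hα0 hα2 m1 m2 b1 b2 (hG ε hε) (hG' ε hε)
      (C := 1) (fun y _ => hC' ε hε y) (fun y _ => hC ε hε y)]
    have i1 : Integrable (fun x => |drift α (fun x => θ r x - η r x) x| * |deriv (θ r) x|) := by
      have h2 : ∀ x, |drift α (fun x => θ r x - η r x) x| ≤ 2 * B := fun x => by
        rw [drift_sub hα0 hα2 m1 m2]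
        exact (abs_sub _ _).trans (by linarith [b1.abs_drift_le x, b2.abs_drift_le x])
      have := (integrable_mul_of_abs_le
        (mw.differentiable_drift hα0 hα2).continuous.aestronglyMeasurable h2
        m1.integrable_deriv).abs
      simpa only [abs_mul] using this
    have h1 : |∫ x, drift α (fun x => θ r x - η r x) x * (deriv (θ r) x *
        ((θ r x - η r x) / √((θ r x - η r x) ^ 2 + ε ^ 2)))| ≤ K * B * Z r := by
      refine le_trans (abs_integral_le_of_abs_le i1 fun x => ?_) (hK r (hsub hr))
      rw [abs_mul, abs_mul, ← mul_assoc]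
      exact mul_le_of_le_one_right (by positivity) (hC' ε hε _)
    have h2 : |∫ x, deriv (drift α (η r)) x * (√((θ r x - η r x) ^ 2 + ε ^ 2) - ε)| ≤
        B * ∫ x, |θ r x - η r x| := by
      rw [← integral_const_mul]
      refine abs_integral_le_of_abs_le (mw.integrable.abs.const_mul B) fun x => ?_
      rw [abs_mul]
      refine mul_le_mul (b2.abs_deriv_drift_le x) ?_ (abs_nonneg _) hB
      simpa using hC ε hε (θ r x - η r x)
    have h3 := mul_le_mul_of_nonneg_left (hYZ r (hsub hr)) hB
    have h4 := (abs_le.1 h1).1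
    have h5 := (abs_le.1 h2).2
    linarith
  have hτ' : τ ∈ Ico 0 T := ⟨hτ.1, hτ.2.trans_lt ht⟩
  have mw := (hθ.memClass τ hτ').sub (hη.memClass τ hτ')
  have hlim : Tendsto (fun n : ℕ => ∫ x, (√((θ τ x - η τ x) ^ 2 + (1 / ((n : ℝ) + 1)) ^ 2) -
      1 / ((n : ℝ) + 1))) atTop (𝓝 (∫ x, |θ τ x - η τ x|)) := by
    have hn : Tendsto (fun n : ℕ => 1 / ((n : ℝ) + 1)) atTop (𝓝 0) :=
      tendsto_one_div_add_atTop_nhds_zero_nat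
    refine tendsto_integral_of_dominated_convergence (fun x => |θ τ x - η τ x|)
      (fun n => ?_) mw.integrable.abs (fun n => ae_of_all _ fun x => ?_) (ae_of_all _ fun x => ?_)
    · have := mw.contDiff.continuous
      exact Continuous.aestronglyMeasurable (by fun_prop)
    · simpa using hC (1 / ((n : ℝ) + 1)) (by positivity) (θ τ x - η τ x)
    · have h1 : Continuous fun ε : ℝ => √((θ τ x - η τ x) ^ 2 + ε ^ 2) - ε := by fun_prop
      have h2 := (h1.tendsto 0).comp hn
      have e : √((θ τ x - η τ x) ^ 2 + 0 ^ 2) - 0 = |θ τ x - η τ x| := by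
        simp [Real.sqrt_sq_eq_abs]
      rw [e] at h2
      exact h2
  exact le_of_tendsto hlim (Eventually.of_forall fun n => hε _ (by positivity))

theorem eq_of_integral_sq_eq_zero {w : ℝ → ℝ} (hw : Tame w) (h : ∫ x, w x ^ 2 = 0) (x : ℝ) :
    w x = 0 := by
  have h1 := (integral_eq_zero_iff_of_nonneg (fun x => sq_nonneg (w x)) hw.integrable_sq).1 h
  have h2 : (fun x => w x ^ 2) = fun _ => 0 := by
    have hc := hw.continuous
    exact Continuous.ae_eq_iff_eq volume (by fun_prop) continuous_const |>.1 h1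
  have := congrFun h2 x
  simpa using this

/-- Solutions in the class are unique. -/
theorem IsSolution.unique (hα0 : 0 < α) (hα2 : α < 2) (hθ : IsSolution α θ₀ T θ)
    (hη : IsSolution α θ₀ T η) : ∀ t ∈ Ico 0 T, ∀ x, θ t x = η t x := by
  intro t ht x
  obtain ⟨B₁, hB₁0, hB₁⟩ := hθ.contCurve.exists_pointwiseBounds hα0 hα2 ht.2
  obtain ⟨B₂, hB₂0, hB₂⟩ := hη.contCurve.exists_pointwiseBounds hα0 hα2 ht.2
  set B := max B₁ B₂ with hBdef
  have hB : 0 ≤ B := hB₁0.le.trans (le_max_left _ _)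
  have hθB : ∀ τ ∈ Icc 0 t, PointwiseBounds α B (θ τ) := fun τ hτ =>
    (hB₁ τ hτ).mono (le_max_left _ _)
  have hηB : ∀ τ ∈ Icc 0 t, PointwiseBounds α B (η τ) := fun τ hτ =>
    (hB₂ τ hτ).mono (le_max_right _ _)
  have hsub : Icc 0 t ⊆ Ico 0 T := fun r hr => ⟨hr.1, hr.2.trans_lt ht.2⟩
  have hm : ∀ τ ∈ Icc 0 t, MemClass fun x => θ τ x - η τ x := fun τ hτ =>
    (hθ.memClass τ (hsub hτ)).sub (hη.memClass τ (hsub hτ))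
  have hgm : ∀ τ ∈ Icc 0 t, GoodMultiplier B (deriv (θ τ)) := fun τ hτ =>
    (hθB τ hτ).goodMultiplier (hθ.memClass τ (hsub hτ))
  set E : ℝ → ℝ := fun τ => ∫ x, (θ τ x - η τ x) ^ 2 with hE
  set Y : ℝ → ℝ := fun τ => ∫ x, |θ τ x - η τ x| with hY
  have hEc : ContinuousOn E (Icc 0 t) :=
    (hθ.contCurve.continuousOn_integral_sq_sub hη.contCurve).mono hsub
  have hYc : ContinuousOn Y (Icc 0 t) :=
    (hθ.contCurve.continuousOn_integral_abs_sub hη.contCurve).mono hsub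
  have hE0 : ∀ τ, 0 ≤ E τ := fun τ => integral_nonneg fun x => sq_nonneg _
  have hY0 : ∀ τ, 0 ≤ Y τ := fun τ => integral_nonneg fun x => abs_nonneg _
  have htm : t ∈ Icc 0 t := ⟨ht.1, le_rfl⟩
  suffices h : E t = 0 from sub_eq_zero.1 (eq_of_integral_sq_eq_zero (hm t htm).tame h x)
  -- For α ≤ 1 the energy inequality closes in L². For α > 1 it involves the L¹ norm Y, whose own
  -- inequality involves √E, so Grönwall is applied to E + Y².
  rcases le_or_gt α 1 with hα1 | hα1
  · obtain ⟨K, -, hK⟩ := exists_drift_form_le_of_le_one hα0 hα1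
    have hev := energy_evolution hα0 hα2 hθ hη ht.2 hθB hηB hEc (fun τ _ => le_rfl)
      (fun τ hτ => hK B _ _ (hgm τ hτ) (hm τ hτ))
    exact eq_zero_of_le_integral hEc (fun τ _ => hE0 τ) hev t htm
  · obtain ⟨K₁, -, hK₁⟩ := exists_drift_form_le hα0 hα2
    obtain ⟨K₂, hK₂0, hK₂⟩ := exists_integral_abs_drift_mul_le hα1 hα2
    set Z : ℝ → ℝ := fun τ => E τ + Y τ ^ 2 with hZ
    have hZc : ContinuousOn Z (Icc 0 t) := hEc.add (hYc.pow 2)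
    have hZ0 : ∀ τ, 0 ≤ Z τ := fun τ => add_nonneg (hE0 τ) (sq_nonneg _)
    have hev := energy_evolution hα0 hα2 hθ hη ht.2 hθB hηB (Z := Z) hZc
      (fun τ _ => le_add_of_nonneg_right (sq_nonneg _))
      (fun τ hτ => hK₁ B _ _ (hgm τ hτ) (hm τ hτ))
    set V : ℝ → ℝ := fun τ => √(E τ) + Y τ with hV
    have hVc : ContinuousOn V (Icc 0 t) := hEc.sqrt.add hYc
    have hev' := integral_abs_evolution hα0 hα2 hθ hη ht.2 hθB hηB (Z := V) hVc
      (fun τ _ => le_add_of_nonneg_left (Real.sqrt_nonneg _))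
      (fun τ hτ => hK₂ B _ _ (hgm τ hτ) (hm τ hτ))
    have hV2 : ∀ τ, V τ ^ 2 ≤ 2 * Z τ := by
      intro τ
      have h1 := Real.sq_sqrt (hE0 τ)
      simp only [hV, hZ]
      nlinarith [sq_nonneg (√(E τ) - Y τ)]
    -- The L¹ inequality is linear in V = √E + Y while Z is quadratic. Squaring it and using
    -- Cauchy–Schwarz in time together with V² ≤ 2Z makes the two inequalities compatible.
    have hCS : ∀ τ ∈ Icc 0 t, (∫ r in (0 : ℝ)..τ, V r) ^ 2 ≤ t * (2 * ∫ r in (0 : ℝ)..τ, Z r) := by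
      intro τ hτ
      have hs : Icc 0 τ ⊆ Icc 0 t := Icc_subset_Icc_right hτ.2
      have hVm : IntegrableOn V (Ioc 0 τ) :=
        ((hVc.mono hs).integrableOn_Icc).mono_set Ioc_subset_Icc_self
      have hV2i : IntegrableOn (fun r => V r ^ 2) (Ioc 0 τ) :=
        (((hVc.pow 2).mono hs).integrableOn_Icc).mono_set Ioc_subset_Icc_self
      have hZi : IntegrableOn Z (Ioc 0 τ) :=
        ((hZc.mono hs).integrableOn_Icc).mono_set Ioc_subset_Icc_self
      have h := sq_integral_abs_mul_le (μ := volume.restrict (Ioc 0 τ)) (f := fun _ => 1) (g := V)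
        aestronglyMeasurable_const hVm.aestronglyMeasurable (by simp) hV2i
      have hV0 : ∀ r, 0 ≤ V r := fun r => add_nonneg (Real.sqrt_nonneg _) (hY0 r)
      simp only [abs_one, one_mul, one_pow, abs_of_nonneg (hV0 _), integral_const,
        MeasurableSet.univ, measureReal_restrict_apply, univ_inter, smul_eq_mul, mul_one,
        Real.volume_real_Ioc_of_le hτ.1, sub_zero] at h
      rw [intervalIntegral.integral_of_le hτ.1, intervalIntegral.integral_of_le hτ.1]
      have h2 : ∫ r in Ioc 0 τ, V r ^ 2 ≤ 2 * ∫ r in Ioc 0 τ, Z r := by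
        rw [← integral_const_mul]
        exact integral_mono hV2i (hZi.const_mul 2) fun r => hV2 r
      have h3 : 0 ≤ ∫ r in Ioc 0 τ, Z r := integral_nonneg fun r => hZ0 r
      calc _ ≤ _ := h
        _ ≤ t * (2 * ∫ r in Ioc 0 τ, Z r) :=
            mul_le_mul hτ.2 h2 (integral_nonneg fun r => sq_nonneg _) ht.1
    have hfin := eq_zero_of_le_integral (K := (2 * K₁ * B + B) + (K₂ * B + B) ^ 2 * (2 * t)) hZc
      (fun τ _ => hZ0 τ) (fun τ hτ => by
        have h1 := hev τ hτ
        have h2 := hev' τ hτ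
        have h3 := hCS τ hτ
        have h4 : Y τ ^ 2 ≤ ((K₂ * B + B) * ∫ r in (0 : ℝ)..τ, V r) ^ 2 :=
          pow_le_pow_left₀ (hY0 τ) h2 2
        have h5 := mul_le_mul_of_nonneg_left h3 (sq_nonneg (K₂ * B + B))
        rw [mul_pow] at h4
        simp only [hZ] at h1 h5 ⊢
        simp only [hE] at h1 h5 ⊢
        linarith) t htm
    have h1 := hE0 t
    have h2 := sq_nonneg (Y t)
    simp only [hZ] at hfin
    linarith

end Uniqueness

/-! ### Evenness -/

/-- Reflection exchanges the two exponential averages, hence reverses each flux; the mixture formula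
carries this over to the drift. -/
theorem drift_comp_neg {α : ℝ} (hα0 : 0 < α) (hα2 : α < 2) {f : ℝ → ℝ} (hf : MemClass f) (x : ℝ) :
    drift α (fun y => f (-y)) x = -drift α f (-x) := by
  have h1 := hf.comp_neg.drift_eq_integral_flux hα0 hα2 x
  have h2 := hf.drift_eq_integral_flux hα0 hα2 (-x)
  simp only [flux_comp_neg, mul_neg] at h1
  rw [integral_neg, ← h2] at h1
  have := (mixConst_pos hα0 hα2).ne'
  refine mul_left_cancel₀ this ?_
  linarith

theorem IsSolution.comp_neg {α T : ℝ} {θ₀ : ℝ → ℝ} {θ : ℝ → ℝ → ℝ} (hα0 : 0 < α) (hα2 : α < 2)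
    (h : IsSolution α θ₀ T θ) (hev : ∀ x, θ₀ (-x) = θ₀ x) :
    IsSolution α θ₀ T (fun t x => θ t (-x)) where
  initial := by
    funext x
    rw [h.initial, hev]
  memClass t ht := (h.memClass t ht).comp_neg
  continuous t ht := by
    refine (h.continuous t ht).congr' ?_
    filter_upwards [self_mem_nhdsWithin] with s hs
    exact (classNorm_comp_neg ((h.memClass s hs).sub (h.memClass t ht))).symm
  equation t ht x := by
    refine (h.equation t ht (-x)).congr_deriv ?_
    rw [drift_comp_neg hα0 hα2 (h.memClass t ht), deriv_comp_neg]
    ring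

/-- The reflected function solves the same problem, so uniqueness identifies it with the solution.
-/
theorem IsSolution.even {α T : ℝ} {θ₀ : ℝ → ℝ} {θ : ℝ → ℝ → ℝ} (hα0 : 0 < α) (hα2 : α < 2)
    (h : IsSolution α θ₀ T θ) (hev : ∀ x, θ₀ (-x) = θ₀ x) {t : ℝ} (ht : t ∈ Ico 0 T) (x : ℝ) :
    θ t (-x) = θ t x :=
  ((h.unique hα0 hα2 (h.comp_neg hα0 hα2 hev)) t ht x).symm

/-! ### The maximum principle -/

theorem MemClass.tendsto_cocompact {f : ℝ → ℝ} (hf : MemClass f) :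
    Tendsto f (cocompact ℝ) (𝓝 0) := by
  have hd : ∀ x, HasDerivAt f (deriv f x) x := fun x => (hf.differentiable x).hasDerivAt
  rw [cocompact_eq_atBot_atTop, tendsto_sup]
  exact ⟨tendsto_zero_of_hasDerivAt_of_integrableOn_Iic (a := 0) (fun x _ => hd x)
      hf.integrable_deriv.integrableOn hf.integrable.integrableOn,
    tendsto_zero_of_hasDerivAt_of_integrableOn_Ioi (a := 0) (fun x _ => hd x)
      hf.integrable_deriv.integrableOn hf.integrable.integrableOn⟩

theorem MemClass.bddAbove {f : ℝ → ℝ} (hf : MemClass f) : BddAbove (range fun x => |f x|) := by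
  obtain ⟨C, hC⟩ := hf.tame.bdd
  exact ⟨C, by rintro _ ⟨x, rfl⟩; exact hC x⟩

/-- Functions of the class vanish at infinity, so a positive supremum is attained. -/
theorem MemClass.exists_abs_eq_iSup {f : ℝ → ℝ} (hf : MemClass f) (h : 0 < ⨆ x, |f x|) :
    ∃ y, |f y| = ⨆ x, |f x| := by
  obtain ⟨x₀, hx₀⟩ := exists_lt_of_lt_ciSup h
  have hc : Continuous fun x => |f x| := hf.contDiff.continuous.abs
  have ht : Tendsto (fun x => |f x|) (cocompact ℝ) (𝓝 0) := by
    simpa using hf.tendsto_cocompact.abs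
  obtain ⟨y, hy⟩ := hc.exists_forall_ge' x₀ ((ht.eventually_lt_const hx₀).mono fun _ h => h.le)
  exact ⟨y, le_antisymm (le_ciSup hf.bddAbove y) (ciSup_le hy)⟩

theorem ContCurve.continuousOn_iSup_abs {T : ℝ} {θ : ℝ → ℝ → ℝ} (h : ContCurve T θ) :
    ContinuousOn (fun t => ⨆ x, |θ t x|) (Ico 0 T) := by
  intro t ht
  obtain ⟨C, -, hC⟩ := AlphaModel.exists_pointwiseBounds (α := 1) one_pos one_lt_two
  have h1 := (h.tendsto t ht).const_mul C
  rw [mul_zero] at h1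
  rw [ContinuousWithinAt, tendsto_iff_norm_sub_tendsto_zero]
  refine squeeze_zero' (Eventually.of_forall fun _ => norm_nonneg _) ?_ h1
  filter_upwards [self_mem_nhdsWithin] with s hs
  have hm := h.memClass s hs
  have hm' := h.memClass t ht
  have hb := (hC _ (hm.sub hm')).abs_le
  rw [Real.norm_eq_abs, abs_sub_le_iff]
  constructor
  · rw [sub_le_iff_le_add]
    refine ciSup_le fun x => ?_
    have h2 := le_ciSup hm'.bddAbove x
    have h3 := abs_sub_abs_le_abs_sub (θ s x) (θ t x)
    linarith [hb x]
  · rw [sub_le_iff_le_add]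
    refine ciSup_le fun x => ?_
    have h2 := le_ciSup hm.bddAbove x
    have h3 := abs_sub_abs_le_abs_sub (θ t x) (θ s x)
    rw [abs_sub_comm] at h3
    linarith [hb x]

/-- Solutions do not grow in the supremum norm. -/
theorem IsSolution.abs_le {α T M : ℝ} {θ₀ : ℝ → ℝ} {θ : ℝ → ℝ → ℝ} (h : IsSolution α θ₀ T θ)
    (hM : ∀ x, |θ₀ x| ≤ M) {t : ℝ} (ht : t ∈ Ico 0 T) (x : ℝ) : |θ t x| ≤ M := by
  by_contra! hlt
  have ht0 : 0 < t := by
    rcases ht.1.eq_or_lt with rfl | h0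
    · rw [h.initial] at hlt
      exact absurd (hM x) (not_le.2 hlt)
    · exact h0
  have hM0 : 0 ≤ M := (abs_nonneg _).trans (hM 0)
  have hsub : Icc 0 t ⊆ Ico 0 T := fun r hr => ⟨hr.1, hr.2.trans_lt ht.2⟩
  set m : ℝ → ℝ := fun t => ⨆ x, |θ t x| with hm
  have hle : ∀ r ∈ Ico 0 T, ∀ y, |θ r y| ≤ m r := fun r hr y =>
    le_ciSup (h.memClass r hr).bddAbove y
  -- Half the average growth rate: the penalty εr tilts the maximum just enough that m(r) - εr still
  -- exceeds M at its maximum, which therefore lies at a positive time.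
  set ε := (|θ t x| - M) / (2 * t) with hε
  have hε0 : 0 < ε := div_pos (by linarith) (by linarith)
  have hεt : ε * t = (|θ t x| - M) / 2 := by
    rw [hε]
    field_simp
  have hcont : ContinuousOn (fun r => m r - ε * r) (Icc 0 t) :=
    (h.contCurve.continuousOn_iSup_abs.mono hsub).sub (by fun_prop)
  obtain ⟨r, hr, hmax⟩ := isCompact_Icc.exists_isMaxOn (nonempty_Icc.2 ht.1) hcont
  have hmax' : ∀ s ∈ Icc 0 t, m s - ε * s ≤ m r - ε * r := hmax
  have hrT := hsub hr
  have hmr : M < m r - ε * r := by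
    have h1 := hmax' t ⟨ht.1, le_rfl⟩
    have h2 := hle t ht x
    linarith
  have hεr : 0 ≤ ε * r := mul_nonneg hε0.le hr.1
  have hr0 : 0 < r := by
    rcases hr.1.eq_or_lt with h0 | h0
    · have h1 : m r ≤ M := ciSup_le fun y => by
        rw [← h0, h.initial]
        exact hM y
      linarith
    · exact h0
  obtain ⟨y, hy⟩ := (h.memClass r hrT).exists_abs_eq_iSup (show 0 < m r by linarith)
  have hy' : |θ r y| = m r := hy
  have hne : θ r y ≠ 0 := by
    rw [← abs_pos, hy']
    linarith
  have hd0 : deriv (θ r) y = 0 := by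
    have hloc : IsLocalMax (fun z => θ r z ^ 2) y := Eventually.of_forall fun z => by
      change θ r z ^ 2 ≤ θ r y ^ 2
      rw [sq_le_sq, hy']
      exact hle r hrT z
    have h1 := hloc.hasDerivAt_eq_zero
      (((h.memClass r hrT).differentiable y).hasDerivAt.pow 2)
    simpa [hne] using h1
  have heq := h.equation r hrT y
  rw [hd0, mul_zero, neg_zero, hasDerivWithinAt_iff_isLittleO] at heq
  -- The time derivative at the extremal point y vanishes, so going back to s < r changes θ(·, y) by
  -- at most ε(r - s)/2, whereas maximality at r forces a drop of at least ε(r - s).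
  have hev := heq.def (half_pos hε0)
  have hne : (𝓝[Ico 0 r] r).NeBot := by
    rw [← mem_closure_iff_nhdsWithin_neBot, closure_Ico hr0.ne]
    exact ⟨hr0.le, le_rfl⟩
  have hev' := hev.filter_mono (nhdsWithin_mono r (Ico_subset_Ico_right hrT.2.le))
  obtain ⟨s, hs, hs'⟩ := (hev'.and self_mem_nhdsWithin).exists
  simp only [smul_zero, sub_zero, Real.norm_eq_abs] at hs
  have hst : s ∈ Icc 0 t := ⟨hs'.1, hs'.2.le.trans hr.2⟩
  have h1 := hmax' s hst
  have h2 := hle s (hsub hst) y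
  have h3 := abs_sub_abs_le_abs_sub (θ r y) (θ s y)
  have h4 : 0 < ε * (r - s) := mul_pos hε0 (sub_pos.2 hs'.2)
  rw [abs_sub_comm s r, abs_of_pos (sub_pos.2 hs'.2), abs_sub_comm] at hs
  linarith

/-! ### The quadratic lower bound -/

section LowerBound

variable {α M : ℝ} {f : ℝ → ℝ}

theorem fwd_deriv {s : ℝ} (hs : 0 < s) (hf : Tame f) (x : ℝ) :
    fwd s (deriv f) x = s * fwd s f x - f x := by
  obtain ⟨C, hC⟩ := hf.bdd
  obtain ⟨C', hC'⟩ := hf.bdd_deriv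
  have i1 := integrableOn_fwd hs hf.continuous hC x
  have i2 := integrableOn_fwd hs hf.continuous_deriv hC' x
  have hd : ∀ z ∈ Ici (0 : ℝ), HasDerivAt (fun z => Real.exp (-s * z) * f (x + z))
      (Real.exp (-s * z) * deriv f (x + z) - s * (Real.exp (-s * z) * f (x + z))) z := by
    intro z _
    have h1 : HasDerivAt (fun z => Real.exp (-s * z)) (Real.exp (-s * z) * (-s * 1)) z :=
      ((hasDerivAt_id z).const_mul (-s)).exp
    have h2 : HasDerivAt (fun z => f (x + z)) (deriv f (x + z)) z :=
      (hf.hasDerivAt (x + z)).comp_const_add x z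
    refine (h1.mul h2).congr_deriv ?_
    ring
  have hl : Tendsto (fun z => Real.exp (-s * z) * f (x + z)) atTop (𝓝 0) := by
    have h1 : Tendsto (fun z => Real.exp (-s * z)) atTop (𝓝 0) :=
      Real.tendsto_exp_atBot.comp (tendsto_id.const_mul_atTop_of_neg (by linarith))
    refine squeeze_zero_norm (a := fun z => Real.exp (-s * z) * C) (fun z => ?_)
      (by simpa using h1.mul_const C)
    rw [norm_mul, Real.norm_eq_abs, Real.norm_eq_abs, abs_of_pos (Real.exp_pos _)]
    gcongr
    exact hC _
  have h := integral_Ioi_of_hasDerivAt_of_tendsto' hd (i2.sub (i1.const_mul s)) hl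
  rw [integral_sub i2 (i1.const_mul s), integral_const_mul] at h
  simp only [mul_zero, Real.exp_zero, add_zero, one_mul, zero_sub] at h
  simp only [fwd]
  linarith

/-- The right side is also the derivative of the flux of f, so differentiation commutes with the
flux, and bounds on f'' give decay in s of that derivative. -/
theorem flux_deriv {s : ℝ} (hs : 0 < s) (hf : Tame f) (x : ℝ) :
    flux s (deriv f) x = s ^ 2 * pot s f x - f x := by
  have h1 := fwd_deriv hs hf x
  have h2 := fwd_deriv hs hf.comp_neg (-x)
  have e : deriv (fun y => f (-y)) = fun y => -deriv f (-y) := funext fun y => deriv_comp_neg _ _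
  have h3 : fwd s (fun y => -deriv f (-y)) (-x) = -bwd s (deriv f) x := by
    simp only [bwd_eq_fwd, fwd, mul_neg, integral_neg]
  rw [e, h3, neg_neg, ← bwd_eq_fwd] at h2
  rw [flux, pot, h1]
  field_simp
  linarith

theorem MemClass.tame_deriv (hf : MemClass f) : Tame (deriv f) := by
  obtain ⟨C, -, hC⟩ := AlphaModel.exists_pointwiseBounds (α := 1) one_pos one_lt_two
  refine ⟨?_, hf.integrable_deriv, ⟨_, (hC f hf).abs_deriv_le⟩, ⟨_, (hC f hf).abs_deriv_deriv_le⟩⟩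
  rw [contDiff_one_iff_deriv]
  exact ⟨fun x => (hf.hasDerivAt_deriv x).1.differentiableAt, hf.continuous_deriv_deriv⟩

/-- Fubini with the weight 1/x needs vanishing at x = 0 and decay in s at once. Both follow by
integrating from 0 the derivative of the flux, which is bounded for s ≤ 1 and O(1/s²) for s ≥ 1. -/
theorem MemClass.exists_abs_flux_le_mul (hf : MemClass f) (hev : ∀ x, f (-x) = f x) :
    ∃ C : ℝ, 0 ≤ C ∧ ∀ s : ℝ, 0 < s → ∀ x, |flux s f x| ≤ C * |x| / (s ^ 2 + 1) := by
  obtain ⟨C₁, hC₁⟩ := hf.tame.bdd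
  obtain ⟨C₂, hC₂⟩ := hf.tame_deriv.bdd_deriv
  have h1 : 0 ≤ C₁ := (abs_nonneg _).trans (hC₁ 0)
  have h2 : 0 ≤ C₂ := (abs_nonneg _).trans (hC₂ 0)
  refine ⟨2 * (2 * C₁ + C₂), by positivity, fun s hs x => ?_⟩
  have key : ∀ z, |s ^ 2 * pot s f z - f z| ≤ 2 * (2 * C₁ + C₂) / (s ^ 2 + 1) := by
    intro z
    rcases le_total s 1 with h | h
    · have h3 := Tame.abs_deriv_flux_le hs hC₁ z
      have h4 := mul_le_mul_of_nonneg_left (one_le_two_div hs h)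
        (show 0 ≤ 2 * C₁ + C₂ by positivity)
      rw [mul_one, mul_div_assoc', mul_comm _ (2 : ℝ)] at h4
      linarith
    · rw [← flux_deriv hs hf.tame]
      refine (hf.tame_deriv.abs_flux_le_div hs hC₂ z).trans ?_
      calc _ = C₂ * (1 / s ^ 2) := by ring
        _ ≤ (2 * C₁ + C₂) * (2 / (s ^ 2 + 1)) :=
          mul_le_mul (by linarith) (inv_sq_le_two_div h) (by positivity) (by positivity)
        _ = _ := by ring
  have h := Convex.norm_image_sub_le_of_norm_hasDerivWithin_le
    (fun z _ => (hasDerivAt_flux hs hf.tame.continuous hf.integrable z).hasDerivWithinAt)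
    (fun z _ => key z) convex_univ (mem_univ 0) (mem_univ x)
  rw [flux_zero_of_even hev, sub_zero, sub_zero, Real.norm_eq_abs, Real.norm_eq_abs] at h
  rwa [mul_div_right_comm]

/-- The mixture is split at s = 1: below, each resolvent costs at most 2M² and the integral of
s^{1-α} over (0, 1) is 1/(2 - α); above, the squares of the Laplace transform control the functional
by Cauchy–Schwarz. -/
theorem MemClass.le_integral_drift_div (hα0 : 0 < α) (hα2 : α < 2) (hf : MemClass f)
    (hev : ∀ x, f (-x) = f x) (hM : ∀ x, |f x| ≤ M) :
    (2 - α) / 2 * blowupFunctional f ^ 2 - 2 * M ^ 2 / (2 - α) ≤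
      mixConst α * ∫ x in Ioi (0 : ℝ), drift α f x * (deriv f x * Real.exp (-x) / x) := by
  have hα : 0 < 2 - α := by linarith
  obtain ⟨C, hC0, hC⟩ := hf.exists_abs_flux_le_mul hev
  obtain ⟨D, hD⟩ := hf.tame.bdd_deriv
  have hD0 : 0 ≤ D := (abs_nonneg _).trans (hD 0)
  have hexp : IntegrableOn (fun x => Real.exp (-x)) (Ioi (0 : ℝ)) := integrableOn_exp_neg_Ioi 0
  obtain ⟨hint, heq⟩ := mixture_fubini hα0 hα2 hf
    (b := fun x => deriv f x * Real.exp (-x) / x) (S := Ioi 0)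
    (c := fun x => C * D * Real.exp (-x))
    ((hf.continuous_deriv.measurable.mul (by fun_prop)).div measurable_id) measurableSet_Ioi
    (hexp.const_mul _) (by
      intro s hs x hx
      have hx0 : (0 : ℝ) < x := hx
      have h1 := hC s hs x
      rw [abs_mul, abs_div, abs_mul, abs_of_pos (Real.exp_pos _), abs_of_pos hx0]
      rw [abs_of_pos hx0] at h1
      calc _ ≤ C * x / (s ^ 2 + 1) * (D * Real.exp (-x) / x) := by
            gcongr
            exact hD x
        _ = _ := by field_simp)
  rw [heq]
  set q : ℝ → ℝ := fun s => ∫ x in Ioi (0 : ℝ), flux s f x * (deriv f x * Real.exp (-x) / x)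
    with hq
  have hq' : ∀ s, q s = ∫ x in Ioi (0 : ℝ), flux s f x / x * deriv f x * Real.exp (-x) := by
    intro s
    simp only [hq]
    congr with x
    ring
  change _ ≤ ∫ s in Ioi (0 : ℝ), s ^ (1 - α) * q s
  have hint' : IntegrableOn (fun s : ℝ => s ^ (1 - α) * q s) (Ioi 0) := hint
  have hd : Disjoint (Ioc (0 : ℝ) 1) (Ioi 1) := Ioc_disjoint_Ioi le_rfl
  rw [← Ioc_union_Ioi_eq_Ioi zero_le_one] at hint' ⊢
  rw [setIntegral_union hd measurableSet_Ioi hint'.left_of_union hint'.right_of_union]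
  have hlow : -(2 * M ^ 2 / (2 - α)) ≤ ∫ s in Ioc (0 : ℝ) 1, s ^ (1 - α) * q s := by
    have i0 : IntervalIntegrable (fun s : ℝ => s ^ (1 - α)) volume 0 1 :=
      intervalIntegral.intervalIntegrable_rpow' (by linarith)
    have e : ∫ s in Ioc (0 : ℝ) 1, s ^ (1 - α) * (-(2 * M ^ 2)) = -(2 * M ^ 2 / (2 - α)) := by
      rw [integral_mul_const, ← intervalIntegral.integral_of_le zero_le_one,
        integral_rpow (Or.inl (by linarith)), Real.one_rpow, Real.zero_rpow (by linarith)]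
      have : 1 - α + 1 = 2 - α := by ring
      rw [this]
      ring
    rw [← e]
    refine setIntegral_mono_on (i0.1.mul_const _) hint'.left_of_union measurableSet_Ioc
      fun s hs => ?_
    rw [hq']
    exact mul_le_mul_of_nonneg_left (hf.tame.neg_le_integral_flux_div hs.1 hev hM)
      (Real.rpow_nonneg hs.1.le _)
  have hhigh : (2 - α) / 2 * blowupFunctional f ^ 2 ≤ ∫ s in Ioi (1 : ℝ), s ^ (1 - α) * q s := by
    obtain ⟨iF, eF⟩ := hf.tame.blowupFunctional_eq
    set J := blowupFunctional f with hJ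
    -- Cauchy–Schwarz in linear form: s^{3-α} L²/2 ≥ l L - l² s^{α-3}/2 for every l. As s^{α-3} has
    -- integral 1/(2 - α) over s > 1, the best choice is l = (2 - α) J. No integrability of s^{3-α}
    -- L² is then required.
    set l := (2 - α) * J with hl
    have ir : IntegrableOn (fun s : ℝ => s ^ (α - 3)) (Ioi 1) :=
      integrableOn_Ioi_rpow_of_lt (by linarith) one_pos
    have e : ∫ s in Ioi (1 : ℝ), (l * laplaceDefect f s - l ^ 2 / 2 * s ^ (α - 3)) =
        (2 - α) / 2 * J ^ 2 := by
      rw [integral_sub (iF.const_mul l) (ir.const_mul _), integral_const_mul, integral_const_mul,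
        ← eF, integral_Ioi_rpow_of_lt (by linarith) one_pos, Real.one_rpow, hl]
      have : α - 3 + 1 = -(2 - α) := by ring
      rw [this]
      field_simp
      ring
    rw [← e]
    refine setIntegral_mono_on ((iF.const_mul l).sub (ir.const_mul _)) hint'.right_of_union
      measurableSet_Ioi fun s hs => ?_
    have hs1 : (1 : ℝ) < s := hs
    have hs0 : 0 < s := by linarith
    have h1 := mul_le_mul_of_nonneg_left (hf.tame.sq_laplaceDefect_le hs1.le hev)
      (Real.rpow_nonneg hs0.le (1 - α))
    rw [hq']
    refine le_trans ?_ h1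
    have hw : 0 < s ^ (3 - α) := Real.rpow_pos_of_pos hs0 _
    have e1 : s ^ (1 - α) * s ^ 2 = s ^ (3 - α) := by
      rw [← Real.rpow_natCast, ← Real.rpow_add hs0]
      congr 1
      push_cast
      ring
    have e2 : s ^ (α - 3) = (s ^ (3 - α))⁻¹ := by
      rw [← Real.rpow_neg hs0.le, neg_sub]
    have e3 : s ^ (1 - α) * (s ^ 2 * laplaceDefect f s ^ 2 / 2) =
        s ^ (3 - α) * laplaceDefect f s ^ 2 / 2 := by
      rw [← e1]
      ring
    rw [e2, e3, ← sub_nonneg]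
    have e4 : s ^ (3 - α) * laplaceDefect f s ^ 2 / 2 -
        (l * laplaceDefect f s - l ^ 2 / 2 * (s ^ (3 - α))⁻¹) =
        (s ^ (3 - α) * laplaceDefect f s - l) ^ 2 / (2 * s ^ (3 - α)) := by
      field_simp
      ring
    rw [e4]
    positivity
  linarith

end LowerBound

/-! ### Evolution of the functional and blow-up -/

theorem drift_zero_of_even {α : ℝ} (hα0 : 0 < α) (hα2 : α < 2) {f : ℝ → ℝ} (hf : MemClass f)
    (hev : ∀ x, f (-x) = f x) : drift α f 0 = 0 := by
  have h := drift_comp_neg hα0 hα2 hf 0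
  rw [show (fun y => f (-y)) = f from funext hev, neg_zero] at h
  linarith

theorem PointwiseBounds.abs_drift_le_mul {α B : ℝ} {f : ℝ → ℝ} (hα0 : 0 < α) (hα2 : α < 2)
    (h : PointwiseBounds α B f) (hf : MemClass f) (hev : ∀ x, f (-x) = f x) (x : ℝ) :
    |drift α f x| ≤ B * |x| := by
  have := Convex.norm_image_sub_le_of_norm_deriv_le
    (fun z _ => (hf.differentiable_drift hα0 hα2) z) (fun z _ => h.abs_deriv_drift_le z)
    convex_univ (mem_univ 0) (mem_univ x)
  simpa [drift_zero_of_even hα0 hα2 hf hev] using! this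

/-- Evenness kills the drift at 0, so the term θ_t(0) drops out and |u| ≤ B|x| compensates the
singular weight. -/
theorem IsSolution.blowupFunctional_sub {α T : ℝ} {θ₀ : ℝ → ℝ} {θ : ℝ → ℝ → ℝ} (hα0 : 0 < α)
    (hα2 : α < 2) (h : IsSolution α θ₀ T θ) (hev : ∀ x, θ₀ (-x) = θ₀ x) {t : ℝ}
    (ht : t ∈ Ico 0 T) :
    IntervalIntegrable (fun τ => ∫ x in Ioi (0 : ℝ),
        drift α (θ τ) x * (deriv (θ τ) x * Real.exp (-x) / x)) volume 0 t ∧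
      blowupFunctional (θ t) - blowupFunctional (θ 0) = ∫ τ in (0 : ℝ)..t, ∫ x in Ioi (0 : ℝ),
        drift α (θ τ) x * (deriv (θ τ) x * Real.exp (-x) / x) := by
  obtain ⟨B, hB0, hB⟩ := h.contCurve.exists_pointwiseBounds hα0 hα2 ht.2
  have hsub : Icc 0 t ⊆ Ico 0 T := fun r hr => ⟨hr.1, hr.2.trans_lt ht.2⟩
  have hexp : IntegrableOn (fun x => Real.exp (-x)) (Ioi (0 : ℝ)) := integrableOn_exp_neg_Ioi 0
  have hle : ∀ τ ∈ Icc 0 t, ∀ x ∈ Ioi (0 : ℝ),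
      |drift α (θ τ) x * (deriv (θ τ) x * Real.exp (-x) / x)| ≤ B * B * Real.exp (-x) := by
    intro τ hτ x hx
    have hx0 : (0 : ℝ) < x := hx
    have h1 := (hB τ hτ).abs_drift_le_mul hα0 hα2 (h.memClass τ (hsub hτ))
      (fun x => h.even hα0 hα2 hev (hsub hτ) x) x
    rw [abs_mul, abs_div, abs_mul, abs_of_pos (Real.exp_pos _), abs_of_pos hx0]
    rw [abs_of_pos hx0] at h1
    calc _ ≤ B * x * (B * Real.exp (-x) / x) := by
          gcongr
          exact (hB τ hτ).abs_deriv_le x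
      _ = _ := by field_simp
  have hi : ∀ τ ∈ Icc 0 t, IntegrableOn
      (fun x => drift α (θ τ) x * (deriv (θ τ) x * Real.exp (-x) / x)) (Ioi 0) := by
    intro τ hτ
    have hm := h.memClass τ (hsub hτ)
    refine (hexp.const_mul (B * B)).mono' ?_
      ((ae_restrict_iff' measurableSet_Ioi).2 (ae_of_all _ fun x hx => hle τ hτ x hx))
    exact ((hm.differentiable_drift hα0 hα2).continuous.measurable.mul
      ((hm.continuous_deriv.measurable.mul (by fun_prop)).div measurable_id)).aestronglyMeasurable
  refine integral_sub_eq_integral_deriv (B := B * B)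
    (Φ := fun τ x => (θ τ 0 - θ τ x) / x * Real.exp (-x)) ht.1 measurableSet_Ioi ?_ ?_ hi ?_
    (h.memClass 0 (hsub ⟨le_rfl, ht.1⟩)).tame.integrableOn_blowupFunctional
    (h.memClass t ht).tame.integrableOn_blowupFunctional
  · intro x hx τ hτ
    have h0 := (h.equation τ (hsub hτ) 0).mono hsub
    have h1 := (h.equation τ (hsub hτ) x).mono hsub
    refine (((h0.sub h1).div_const x).mul_const (Real.exp (-x))).congr_deriv ?_
    rw [drift_zero_of_even hα0 hα2 (h.memClass τ (hsub hτ))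
      (fun x => h.even hα0 hα2 hev (hsub hτ) x)]
    ring
  · have hs : Icc 0 t ×ˢ Ioi (0 : ℝ) ⊆ Ico 0 T ×ˢ univ := prod_mono hsub (subset_univ _)
    have h1 := (h.contCurve.continuousOn_drift hα0 hα2).mono hs
    have h2 := h.contCurve.continuousOn_deriv.mono hs
    have h3 : ContinuousOn (fun p : ℝ × ℝ => Real.exp (-p.2)) (Icc 0 t ×ˢ Ioi (0 : ℝ)) := by
      fun_prop
    exact h1.mul ((h2.mul h3).div continuousOn_snd fun p hp => (ne_of_gt hp.2))
  · intro τ hτ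
    calc _ ≤ ∫ x in Ioi (0 : ℝ), B * B * Real.exp (-x) :=
          setIntegral_mono_on (hi τ hτ).abs (hexp.const_mul _) measurableSet_Ioi (hle τ hτ)
      _ = B * B := by rw [integral_const_mul, integral_exp_neg_Ioi_zero, mul_one]

/-- A continuous function that satisfies an integrated Riccati inequality with a large initial value
lives for a short time only. -/
theorem lt_of_riccati {J : ℝ → ℝ} {t c d J₀ : ℝ} (ht : 0 ≤ t) (hJ : ContinuousOn J (Icc 0 t))
    (hc : 0 < c) (hJ₀ : 0 < J₀) (hd : 2 * d ≤ c * J₀ ^ 2)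
    (hle : ∀ τ ∈ Icc 0 t, J₀ + ∫ r in (0 : ℝ)..τ, (c * J r ^ 2 - d) ≤ J τ) :
    t < 3 / (c * J₀) := by
  by_contra! hlt
  set b := 3 / (c * J₀) with hb
  have hb0 : 0 < b := by positivity
  -- A globally continuous extension of J makes its integral K differentiable everywhere; K lies
  -- below J on the interval and is the function compared with the barrier.
  set G : ℝ → ℝ := IccExtend ht ((Icc 0 t).domRestrict J) with hG
  have hGc : Continuous G := hJ.domRestrict.Icc_extend'
  have hGJ : ∀ τ ∈ Icc 0 t, G τ = J τ := fun τ hτ => IccExtend_of_mem ht _ hτ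
  set K : ℝ → ℝ := fun τ => J₀ + ∫ r in (0 : ℝ)..τ, (c * G r ^ 2 - d) with hK
  have hKd : ∀ τ, HasDerivAt K (c * G τ ^ 2 - d) τ := by
    intro τ
    have h1 : Continuous fun r => c * G r ^ 2 - d := by fun_prop
    exact (h1.integral_hasStrictDerivAt 0 τ).hasDerivAt.const_add J₀
  have hKc : Continuous K := continuous_iff_continuousAt.2 fun τ => (hKd τ).continuousAt
  have hKG : ∀ τ ∈ Icc 0 t, K τ ≤ G τ := by
    intro τ hτ
    rw [hGJ τ hτ]
    refine le_trans (le_of_eq ?_) (hle τ hτ)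
    simp only [hK]
    congr 1
    refine intervalIntegral.integral_congr fun r hr => ?_
    rw [uIcc_of_le hτ.1] at hr
    simp only [hGJ r ⟨hr.1, hr.2.trans hτ.2⟩]
  have hden : ∀ τ, τ < b → 0 < 1 - c * J₀ / 3 * τ := by
    intro τ hτ
    rw [hb, lt_div_iff₀ (by positivity)] at hτ
    linarith
  have hbnd : ∀ τ ∈ Ico 0 b, J₀ ≤ K τ * (1 - c * J₀ / 3 * τ) := by
    intro τ hτ
    have hsubt : ∀ r ∈ Icc 0 τ, r ∈ Icc 0 t := fun r hr =>
      ⟨hr.1, hr.2.trans (hτ.2.le.trans hlt)⟩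
    have hpos : ∀ r ∈ Icc 0 τ, 0 < 1 - c * J₀ / 3 * r := fun r hr =>
      hden r (hr.2.trans_lt hτ.2)
    -- The barrier solves y' = c y²/3 with y(0) = J₀ and explodes at b. Where K meets it, K ≥ J₀
    -- gives d ≤ c K²/2, hence K' ≥ c K²/2 > c K²/3; the gap between 1/2 and 1/3 supplies the strict
    -- inequality that the comparison needs.
    have hf : ∀ r ∈ Icc 0 τ, HasDerivAt (fun r => J₀ / (1 - c * J₀ / 3 * r))
        (c / 3 * (J₀ / (1 - c * J₀ / 3 * r)) ^ 2) r := by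
      intro r hr
      have h1 : HasDerivAt (fun r => 1 - c * J₀ / 3 * r) (-(c * J₀ / 3 * 1)) r :=
        ((hasDerivAt_id r).const_mul _).const_sub 1
      refine ((hasDerivAt_const r J₀).div h1 (hpos r hr).ne').congr_deriv ?_
      have := (hpos r hr).ne'
      rw [div_pow]
      ring
    have hcmp := image_le_of_deriv_right_lt_deriv_boundary'
      (f := fun r => J₀ / (1 - c * J₀ / 3 * r)) (B := K) (a := 0) (b := τ)
      (fun r hr => (hf r hr).continuousAt.continuousWithinAt)
      (fun r hr => (hf r ⟨hr.1, hr.2.le⟩).hasDerivWithinAt) (by simp [hK]) hKc.continuousOn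
      (fun r _ => (hKd r).hasDerivWithinAt) (fun r hr hr' => by
        have hr1 : r ∈ Icc 0 τ := ⟨hr.1, hr.2.le⟩
        have h2 := hKG r (hsubt r hr1)
        have h3 : J₀ ≤ J₀ / (1 - c * J₀ / 3 * r) := by
          rw [le_div_iff₀ (hpos r hr1)]
          have : 0 ≤ c * J₀ / 3 * r := mul_nonneg (by positivity) hr.1
          nlinarith
        rw [hr'] at h3 ⊢
        have h4 : K r ^ 2 ≤ G r ^ 2 := pow_le_pow_left₀ (hJ₀.le.trans h3) h2 2
        have h5 : J₀ ^ 2 ≤ K r ^ 2 := pow_le_pow_left₀ hJ₀.le h3 2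
        have h6 := mul_le_mul_of_nonneg_left h4 hc.le
        have h7 := mul_le_mul_of_nonneg_left h5 hc.le
        have h8 : 0 < c * J₀ ^ 2 := by positivity
        linarith) (right_mem_Icc.2 hτ.1)
    rwa [div_le_iff₀ (hden τ hτ.2)] at hcmp
  -- K is finite at b while the other factor vanishes there, which contradicts the lower bound J₀ >
  -- 0.
  have hlim : Tendsto (fun τ => K τ * (1 - c * J₀ / 3 * τ)) (𝓝[<] b) (𝓝 0) := by
    have h1 : Continuous fun τ => K τ * (1 - c * J₀ / 3 * τ) := by fun_prop
    have h2 := (h1.tendsto b).mono_left (nhdsWithin_le_nhds (s := Iio b))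
    have e : 1 - c * J₀ / 3 * b = 0 := by
      rw [hb]
      field_simp
      ring
    rwa [e, mul_zero] at h2
  have : J₀ ≤ 0 := by
    refine ge_of_tendsto hlim ?_
    filter_upwards [Ico_mem_nhdsLT hb0] with τ hτ
    exact hbnd τ hτ
  linarith

/-- An even solution with a large value of the functional lives for a short time only. -/
theorem IsSolution.le_of_blowupFunctional {α T M : ℝ} {θ₀ : ℝ → ℝ} {θ : ℝ → ℝ → ℝ} (hα0 : 0 < α)
    (hα2 : α < 2) (h : IsSolution α θ₀ T θ) (hev : ∀ x, θ₀ (-x) = θ₀ x)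
    (hM : ∀ x, |θ₀ x| ≤ M) (hJ : 3 / (2 - α) * (M + 1) ≤ blowupFunctional θ₀) :
    T ≤ 3 / ((2 - α) / (2 * mixConst α) * blowupFunctional θ₀) := by
  have hα : 0 < 2 - α := by linarith
  have hm := mixConst_pos hα0 hα2
  have hM0 : 0 ≤ M := (abs_nonneg _).trans (hM 0)
  set J₀ := blowupFunctional θ₀ with hJ₀
  have hJ0 : 0 < J₀ := lt_of_lt_of_le (by positivity) hJ
  -- These c and d are the coefficients of the quadratic lower bound divided by `mixConst α`.
  set c := (2 - α) / (2 * mixConst α) with hc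
  set d := 2 * M ^ 2 / ((2 - α) * mixConst α) with hd
  have hc0 : 0 < c := by positivity
  refine le_of_forall_lt fun t htT => ?_
  rcases lt_or_ge t 0 with ht0 | ht0
  · exact ht0.trans (by positivity)
  have hsub : Icc 0 t ⊆ Ico 0 T := fun r hr => ⟨hr.1, hr.2.trans_lt htT⟩
  have hevol := fun τ (hτ : τ ∈ Icc 0 t) => h.blowupFunctional_sub hα0 hα2 hev (hsub hτ)
  simp only [h.initial] at hevol
  have hint := (hevol t ⟨ht0, le_rfl⟩).1
  have hcont : ContinuousOn (fun τ => blowupFunctional (θ τ)) (Icc 0 t) := by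
    have h1 := intervalIntegral.continuousOn_primitive_interval' hint left_mem_uIcc
    rw [uIcc_of_le ht0] at h1
    refine (h1.const_add J₀).congr fun τ hτ => ?_
    have := (hevol τ hτ).2
    linarith
  refine lt_of_riccati (d := d) ht0 hcont hc0 hJ0 ?_ fun τ hτ => ?_
  -- The 3 in the threshold is used here: up to the factor M²/((2 - α) `mixConst α`), c J₀² is at
  -- least 9/2 and 2d is 4.
  · have h1 : (3 / (2 - α) * M) ^ 2 ≤ J₀ ^ 2 := by
      refine pow_le_pow_left₀ (by positivity) (le_trans ?_ hJ) 2
      gcongr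
      linarith
    refine le_trans ?_ (mul_le_mul_of_nonneg_left h1 hc0.le)
    rw [hc, hd, ← sub_nonneg]
    have e : (2 - α) / (2 * mixConst α) * (3 / (2 - α) * M) ^ 2 -
        2 * (2 * M ^ 2 / ((2 - α) * mixConst α)) = M ^ 2 / (2 * ((2 - α) * mixConst α)) := by
      field_simp
      ring
    rw [e]
    positivity
  · have hsubτ : Icc 0 τ ⊆ Icc 0 t := Icc_subset_Icc_right hτ.2
    rw [← le_sub_iff_add_le', (hevol τ hτ).2]
    refine intervalIntegral.integral_mono_on hτ.1 ?_ (hevol τ hτ).1 fun r hr => ?_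
    · refine ContinuousOn.intervalIntegrable_of_Icc hτ.1 ?_
      have := hcont.mono hsubτ
      fun_prop
    · have hrT := hsub (hsubτ hr)
      have key := (h.memClass r hrT).le_integral_drift_div hα0 hα2
        (fun x => h.even hα0 hα2 hev hrT x) (fun x => h.abs_le hM hrT x)
      refine le_of_mul_le_mul_left (le_trans (le_of_eq ?_) key) hm
      rw [hc, hd]
      field_simp

end AlphaModel

end

/-! ### The choice of the constant and the conclusion. -/

theorem theorem5p3 (α : ℝ) (hα0 : 0 < α) (hα2 : α < 2) :
    ∃ A : ℝ, 0 < A ∧ ∀ θ₀ : 𝓢(ℝ, ℝ), (∀ x : ℝ, θ₀ (-x) = θ₀ x) →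
      A * ((⨆ x : ℝ, |θ₀ x|) + 1) ≤
        ∫ x in Set.Ioi (0 : ℝ), (θ₀ 0 - θ₀ x) / x * Real.exp (-x) →
      AlphaModel.BlowsUpInFiniteTime α θ₀ := by
  have hα : 0 < 2 - α := by linarith
  have hm := AlphaModel.mixConst_pos hα0 hα2
  -- The constant only has to make c J₀² dominate 2d; the added 1 in the hypothesis keeps J₀
  -- positive when the datum vanishes.
  refine ⟨3 / (2 - α), by positivity, fun θ₀ hev hJ => ?_⟩
  have hJ' : 3 / (2 - α) * ((⨆ x : ℝ, |θ₀ x|) + 1) ≤ AlphaModel.blowupFunctional θ₀ := hJ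
  have hM0 : 0 ≤ ⨆ x : ℝ, |θ₀ x| := Real.iSup_nonneg fun x => abs_nonneg _
  have hJ0 : 0 < AlphaModel.blowupFunctional θ₀ := lt_of_lt_of_le (by positivity) hJ'
  have hpos : 0 < 3 / ((2 - α) / (2 * AlphaModel.mixConst α) *
      AlphaModel.blowupFunctional θ₀) := by positivity
  refine ⟨_, hpos, fun T θ h => ?_⟩
  rcases le_or_gt T 0 with hT | hT
  · exact hT.trans hpos.le
  -- For T > 0 the datum itself belongs to the class, which provides the boundedness behind the
  -- supremum.
  have hmem := h.memClass 0 ⟨le_rfl, hT⟩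
  rw [h.initial] at hmem
  exact h.le_of_blowupFunctional hα0 hα2 hev (le_ciSup hmem.bddAbove) hJ'
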